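/- Let $T$ be one of the following 2-monads on the 2-category $\mathrm{Cat}$ of small categories: the free strict monoidal category 2-monad $\mathsf M$, the free permutative (i.e. symmetric strict monoidal) category 2-monad $\mathsf S$, or the free braided strict monoidal category 2-monad $\mathsf B$. The objects of $TC$ are finite tuples $\langle a\rangle=(a_1,\dots,a_n)$, $n\ge 0$, of objects of $C$, with product the concatenation of tuples, written ";". The unit $\eta_C\colon C\to TC$ sends $a$ to the 1-tuple $(a)$, and the multiplication concatenates tuples of tuples. A $T$-algebra $(A,x)$ is a category $A$ with a strictly unital and associative action $x\colon TA\to A$; we write $a_\bullet = x\langle a\rangle$ and $t_\bullet = x(t)$ for objects $\langle a\rangle$ and morphisms $t$ of $TA$. A $T$-map $(f,f_\bullet)\colon (A,x)\to (B,y)$ is a functor $f\colon A\to B$ with a natural isomorphism $f_\bullet\colon y\circ Tf\cong f\circ x$ whose whiskering with $\eta_A$ is the identity and which is compatible with the multiplication of $T$; it is strict if $f_\bullet$ is an identity. A $T$-algebra 2-cell $f\to g$ is a natural transformation compatible with $f_\bullet$ and $g_\bullet$. Let $T\text{-Alg}$ (respectively $T\text{-Alg}_s$) be the 2-category of $T$-algebras,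 $T$-maps (respectively strict $T$-maps) and $T$-algebra 2-cells, and let $i\colon T\text{-Alg}_s\to T\text{-Alg}$ be the inclusion. For a $T$-algebra $A$, let $QA$ be the $T$-algebra (strict monoidal, permutative, or braided strict monoidal category) whose objects are those of $TA$, with product given by concatenation, and whose morphisms are generated under composition and concatenation by the morphisms $t$ of $TA$ (the free morphisms; $\iota\colon TA\to QA$ denotes their inclusion) and adjoined isomorphisms $q_{\langle a\rangle}\colon \langle a\rangle\to (a_\bullet)$, one for each tuple $\langle a\rangle$, subject to the following axioms. * $\iota$ is a strict $T$-map: composites and products of free morphisms are those of $TA$, and the symmetry or braiding of $QA$ (in the cases $\mathsf S$, $\mathsf B$) is that of $TA$. * Naturality: $q_{\langle a'\rangle}\circ t=(t_\bullet)\circ q_{\langle a\rangle}$ for each free $t\colon\langle a\rangle\to\langle a'\rangle$. * Associativity: for all tuples $\langle a\rangle,\langle b\rangle$, $$q_{\langle a\rangle;(e);\langle b\rangle}\circ(1;q_{\langle\rangle};1)=q_{\langle a\rangle;\langle b\rangle},\quad q_{\langle a\rangle;(b_\bullet)}\circ(1_{\langle a\rangle};q_{\langle b\rangle})=q_{\langle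 a\rangle;\langle b\rangle}=q_{(a_\bullet);\langle b\rangle}\circ(q_{\langle a\rangle};1_{\langle b\rangle}),$$ where $e=\langle\rangle_\bullet$ is the unit object of $A$. * Normality: $q_{(a)}=1_{(a)}$ for each object $a$ of $A$. For a $T$-map $f\colon A\to B$, let $Qf\colon QA\to QB$ be the strict $T$-map with $(Qf)\langle a_i\rangle_i=\langle f(a_i)\rangle_i$, $(Qf)(\iota t)=\iota((Tf)t)$ and $(Qf)(q_{\langle a\rangle})=(f_\bullet)\circ q_{\langle f(a_i)\rangle_i}$, and for a $T$-algebra 2-cell $\alpha$ let $(Q\alpha)_{\langle a_i\rangle_i}=\langle\alpha_{a_i}\rangle_i$. This defines a 2-functor $Q\colon T\text{-Alg}\to T\text{-Alg}_s$. **Statement.** For each $T\in\{\mathsf M,\mathsf S,\mathsf B\}$, the 2-functor $Q$ is an effective pseudomorphism classifier for $T$. That is, $Q$ is left 2-adjoint to $i$, with 2-natural unit $\zeta_A\colon A\to iQA$ and 2-natural counit $\delta_B\colon QiB\to B$, and for each $T$-algebra $B$ there is a $T$-algebra 2-cell isomorphism $\Theta\colon\zeta_B\delta_B\cong 1_{QB}$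 such that $(\zeta_B,\delta_B,\Theta)$ is an adjoint surjective equivalence in $T\text{-Alg}$, i.e. $\delta_B\zeta_B=1_B$ and $\Theta*\zeta_B=1_{\zeta_B}$. Explicitly, these may be taken as follows. * $\zeta_A$ sends each object and morphism of $A$ to the corresponding 1-tuple in $QA$, and its algebra constraint at $\langle a\rangle$ is $q_{\langle a\rangle}$. * $\delta_B$ sends $\langle b\rangle$ to $b_\bullet$, a free morphism $t$ to $t_\bullet$, and each $q_{\langle b\rangle}$ to the identity of $b_\bullet$. * $\Theta_{\langle b\rangle}=q_{\langle b\rangle}^{-1}\colon(b_\bullet)\to\langle b\rangle$. -/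

import Mathlib

open CategoryTheory Bicategory

namespace PsMor

section TwoMonads

universe w v u

/-- A 2-monad `(T, η, μ)` on a 2-category: a strict 2-functor with a 2-natural unit and a 2-natural
multiplication that satisfy the monad axioms strictly. -/
structure TwoMonad (K : Type u) [Bicategory.{w, v} K] [Strict K] where
  T : StrictPseudofunctor K K
  η : ∀ X : K, X ⟶ T.obj X
  η_nat : ∀ {X Y : K} (f : X ⟶ Y), f ≫ η Y = η X ≫ T.map f
  η_nat₂ : ∀ {X Y : K} {f g : X ⟶ Y} (α : f ⟶ g),
    α ▷ η Y = eqToHom (η_nat f) ≫ η X ◁ T.map₂ α ≫ eqToHom (η_nat g).symm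
  μ : ∀ X : K, T.obj (T.obj X) ⟶ T.obj X
  μ_nat : ∀ {X Y : K} (f : X ⟶ Y), T.map (T.map f) ≫ μ Y = μ X ≫ T.map f
  μ_nat₂ : ∀ {X Y : K} {f g : X ⟶ Y} (α : f ⟶ g),
    T.map₂ (T.map₂ α) ▷ μ Y =
      eqToHom (μ_nat f) ≫ μ X ◁ T.map₂ α ≫ eqToHom (μ_nat g).symm
  left_unit : ∀ X : K, η (T.obj X) ≫ μ X = 𝟙 (T.obj X)
  right_unit : ∀ X : K, T.map (η X) ≫ μ X = 𝟙 (T.obj X)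
  assoc : ∀ X : K, T.map (μ X) ≫ μ X = μ (T.obj X) ≫ μ X

variable {K : Type u} [Bicategory.{w, v} K] [Strict K]

/-- A (strict) algebra `(X, x)` over a 2-monad. -/
structure Algebra (M : TwoMonad K) where
  X : K
  x : M.T.obj X ⟶ X
  unit : M.η X ≫ x = 𝟙 X
  mult : M.T.map x ≫ x = M.μ X ≫ x

variable {M : TwoMonad K}

theorem TMap.unit_aux (A B : Algebra M) (f : A.X ⟶ B.X) :
    M.η A.X ≫ M.T.map f ≫ B.x = M.η A.X ≫ A.x ≫ f := by
  rw [← Strict.assoc, ← M.η_nat, Strict.assoc, B.unit, ← Strict.assoc, A.unit, Strict.id_comp,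
    Strict.comp_id]

theorem TMap.mult_aux₁ (A B : Algebra M) (f : A.X ⟶ B.X) :
    M.μ A.X ≫ M.T.map f ≫ B.x = M.T.map (M.T.map f ≫ B.x) ≫ B.x := by
  rw [M.T.map_comp, Strict.assoc, B.mult, ← Strict.assoc, ← Strict.assoc, M.μ_nat]

theorem TMap.mult_aux₂ (A B : Algebra M) (f : A.X ⟶ B.X) :
    M.T.map (A.x ≫ f) ≫ B.x = M.T.map A.x ≫ M.T.map f ≫ B.x := by
  rw [M.T.map_comp, Strict.assoc]

theorem TMap.mult_aux₃ (A B : Algebra M) (f : A.X ⟶ B.X) :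
    M.T.map A.x ≫ A.x ≫ f = M.μ A.X ≫ A.x ≫ f := by
  rw [← Strict.assoc, A.mult, Strict.assoc]

/-- A T-map (pseudomorphism) `(f, f_•) : A ⟶ B`: a 1-cell `f` together with an invertible 2-cell
`f_• : y ∘ T f ≅ f ∘ x`, the algebra constraint, satisfying the unit and multiplication axioms. -/
@[ext]
structure TMap (A B : Algebra M) where
  f : A.X ⟶ B.X
  con : M.T.map f ≫ B.x ≅ A.x ≫ f
  unit : M.η A.X ◁ con.hom = eqToHom (TMap.unit_aux A B f)
  mult : M.μ A.X ◁ con.hom =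
    eqToHom (TMap.mult_aux₁ A B f) ≫ M.T.map₂ con.hom ▷ B.x ≫
      eqToHom (TMap.mult_aux₂ A B f) ≫ M.T.map A.x ◁ con.hom ≫
      eqToHom (TMap.mult_aux₃ A B f)

namespace TMap

theorem id_aux (A : Algebra M) : M.T.map (𝟙 A.X) ≫ A.x = A.x ≫ 𝟙 A.X := by
  rw [M.T.map_id, Strict.id_comp, Strict.comp_id]

/-- The identity T-map -/
def id (A : Algebra M) : TMap A A where
  f := 𝟙 A.X
  con := eqToIso (id_aux A)
  unit := by simp
  mult := by simp [PrelaxFunctor.map₂_eqToHom]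

theorem map₂_whiskerLeft {a b c : K} (F : StrictPseudofunctor K K) (f : a ⟶ b) {g h : b ⟶ c}
    (α : g ⟶ h) :
    F.map₂ (f ◁ α) = eqToHom (F.map_comp f g) ≫ F.map f ◁ F.map₂ α ≫
      eqToHom (F.map_comp f h).symm := by
  rw [F.map₂_whisker_left]; simp [F.mapComp_eq_eqToIso]

theorem map₂_whiskerRight {a b c : K} (F : StrictPseudofunctor K K) {f g : a ⟶ b} (α : f ⟶ g)
    (h : b ⟶ c) :
    F.map₂ (α ▷ h) = eqToHom (F.map_comp f h) ≫ F.map₂ α ▷ F.map h ≫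
      eqToHom (F.map_comp g h).symm := by
  rw [F.map₂_whisker_right]; simp [F.mapComp_eq_eqToIso]

theorem wl_comp {a b c d : K} (f : a ⟶ b) (g : b ⟶ c) {h h' : c ⟶ d} (α : h ⟶ h') :
    f ◁ g ◁ α = eqToHom (Strict.assoc f g h).symm ≫ (f ≫ g) ◁ α ≫
      eqToHom (Strict.assoc f g h') := by
  rw [comp_whiskerLeft]; simp [Strict.associator_eqToIso]

theorem wr_comp {a b c d : K} {f f' : a ⟶ b} (α : f ⟶ f') (g : b ⟶ c) (h : c ⟶ d) :
    α ▷ g ▷ h = eqToHom (Strict.assoc f g h) ≫ α ▷ (g ≫ h) ≫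
      eqToHom (Strict.assoc f' g h).symm := by
  rw [whiskerRight_comp]; simp [Strict.associator_eqToIso]

theorem wlr {a b c d : K} (f : a ⟶ b) {g g' : b ⟶ c} (α : g ⟶ g') (h : c ⟶ d) :
    (f ◁ α) ▷ h = eqToHom (Strict.assoc f g h) ≫ f ◁ α ▷ h ≫
      eqToHom (Strict.assoc f g' h).symm := by
  rw [whisker_assoc]; simp [Strict.associator_eqToIso]

theorem wlr' {a b c d : K} (f : a ⟶ b) {g g' : b ⟶ c} (α : g ⟶ g') (h : c ⟶ d) :
    f ◁ α ▷ h = eqToHom (Strict.assoc f g h).symm ≫ (f ◁ α) ▷ h ≫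
      eqToHom (Strict.assoc f g' h) := by
  rw [wlr]; simp

theorem id_wl {a b : K} {f g : a ⟶ b} (α : f ⟶ g) :
    𝟙 a ◁ α = eqToHom (Strict.id_comp f) ≫ α ≫ eqToHom (Strict.id_comp g).symm := by
  rw [id_whiskerLeft]; simp [Strict.leftUnitor_eqToIso]

theorem wr_id {a b : K} {f g : a ⟶ b} (α : f ⟶ g) :
    α ▷ 𝟙 b = eqToHom (Strict.comp_id f) ≫ α ≫ eqToHom (Strict.comp_id g).symm := by
  rw [whiskerRight_id]; simp [Strict.rightUnitor_eqToIso]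

theorem wl_comp' {a b c d : K} (f : a ⟶ b) (g : b ⟶ c) {h h' : c ⟶ d} (α : h ⟶ h') :
    (f ≫ g) ◁ α = eqToHom (Strict.assoc f g h) ≫ f ◁ g ◁ α ≫
      eqToHom (Strict.assoc f g h').symm := by
  rw [wl_comp]; simp

theorem wr_comp' {a b c d : K} {f f' : a ⟶ b} (α : f ⟶ f') (g : b ⟶ c) (h : c ⟶ d) :
    α ▷ (g ≫ h) = eqToHom (Strict.assoc f g h).symm ≫ α ▷ g ▷ h ≫
      eqToHom (Strict.assoc f' g h) := by
  rw [wr_comp]; simp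

theorem eq_conj {C : Type*} [Category C] {a b : C} (p : a = a) (q : b = b) (f : a ⟶ b) :
    eqToHom p ≫ f ≫ eqToHom q = f := by simp

theorem eq₂ {C : Type*} [Category C] {a b c : C} (p : a = b) (q : b = c) :
    eqToHom p ≫ eqToHom q = eqToHom (p.trans q) := by simp

theorem eq₃ {C : Type*} [Category C] {a b c d : C} (p : a = b) (q : b = c) (r : c = d) :
    eqToHom p ≫ eqToHom q ≫ eqToHom r = eqToHom ((p.trans q).trans r) := by simp

theorem compCon_aux {A B C : Algebra M} (f : A.X ⟶ B.X) (g : B.X ⟶ C.X) :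
    M.T.map (f ≫ g) ≫ C.x = M.T.map f ≫ M.T.map g ≫ C.x := by
  rw [M.T.map_comp, Strict.assoc]

/-- The pasting of two algebra constraints -/
def compCon {A B C : Algebra M} {f : A.X ⟶ B.X} {g : B.X ⟶ C.X}
    (cf : M.T.map f ≫ B.x ≅ A.x ≫ f) (cg : M.T.map g ≫ C.x ≅ B.x ≫ g) :
    M.T.map (f ≫ g) ≫ C.x ≅ A.x ≫ f ≫ g :=
  eqToIso (compCon_aux f g) ≪≫ whiskerLeftIso (M.T.map f) cg ≪≫
    eqToIso (Strict.assoc _ _ _).symm ≪≫ whiskerRightIso cf g ≪≫ eqToIso (Strict.assoc _ _ _)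

theorem compCon_hom {A B C : Algebra M} {f : A.X ⟶ B.X} {g : B.X ⟶ C.X}
    (cf : M.T.map f ≫ B.x ≅ A.x ≫ f) (cg : M.T.map g ≫ C.x ≅ B.x ≫ g) :
    (compCon cf cg).hom = eqToHom (compCon_aux f g) ≫ M.T.map f ◁ cg.hom ≫
    eqToHom (Strict.assoc _ _ _).symm ≫ cf.hom ▷ g ≫ eqToHom (Strict.assoc _ _ _) := by
  simp [compCon]

theorem compCon_assoc {A B C D : Algebra M} {f : A.X ⟶ B.X} {g : B.X ⟶ C.X} {h : C.X ⟶ D.X}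
    (cf : M.T.map f ≫ B.x ≅ A.x ≫ f) (cg : M.T.map g ≫ C.x ≅ B.x ≫ g)
    (ch : M.T.map h ≫ D.x ≅ C.x ≫ h) :
    (compCon (compCon cf cg) ch).hom =
      eqToHom (by rw [Strict.assoc]) ≫ (compCon cf (compCon cg ch)).hom ≫
        eqToHom (by rw [Strict.assoc]) := by
  simp [compCon_hom, congr_whiskerLeft (M.T.map_comp f g), Strict.associator_eqToIso]

theorem id_compCon {A B : Algebra M} {f : A.X ⟶ B.X} (cf : M.T.map f ≫ B.x ≅ A.x ≫ f) :
    (compCon (eqToIso (id_aux A)) cf).hom =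
      eqToHom (by rw [Strict.id_comp]) ≫ cf.hom ≫ eqToHom (by rw [Strict.id_comp]) := by
  simp [compCon_hom, congr_whiskerLeft (M.T.map_id A.X), Strict.leftUnitor_eqToIso]

theorem compCon_id {A B : Algebra M} {f : A.X ⟶ B.X} (cf : M.T.map f ≫ B.x ≅ A.x ≫ f) :
    (compCon cf (eqToIso (id_aux B))).hom =
      eqToHom (by rw [Strict.comp_id]) ≫ cf.hom ≫ eqToHom (by rw [Strict.comp_id]) := by
  simp [compCon_hom, Strict.rightUnitor_eqToIso]

theorem comm_left {A B C : Algebra M} {f : A.X ⟶ B.X} {g h : B.X ⟶ C.X}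
    (cf : M.T.map f ≫ B.x ≅ A.x ≫ f) (cg : M.T.map g ≫ C.x ≅ B.x ≫ g)
    (ch : M.T.map h ≫ C.x ≅ B.x ≫ h) (α : g ⟶ h)
    (w : cg.hom ≫ B.x ◁ α = M.T.map₂ α ▷ C.x ≫ ch.hom) :
    (compCon cf cg).hom ≫ A.x ◁ f ◁ α = M.T.map₂ (f ◁ α) ▷ C.x ≫ (compCon cf ch).hom := by
  have e1 := whisker_exchange cf.hom α
  have e2 := congrArg (fun t => M.T.map f ◁ t) w
  simp only [whiskerLeft_comp] at e2
  rw [wl_comp, compCon_hom, compCon_hom, map₂_whiskerLeft]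
  simp only [comp_whiskerRight, Category.assoc, eqToHom_trans_assoc, eqToHom_refl,
    Category.id_comp, eqToHom_whiskerRight, wlr]
  rw [← reassoc_of% e2, wl_comp (M.T.map f)]
  simp only [Category.assoc, eqToHom_trans_assoc, eqToHom_refl,
    Category.id_comp]
  rw [← reassoc_of% e1]

theorem comm_right {A B C : Algebra M} {f g : A.X ⟶ B.X} {h : B.X ⟶ C.X}
    (cf : M.T.map f ≫ B.x ≅ A.x ≫ f) (cg : M.T.map g ≫ B.x ≅ A.x ≫ g)
    (ch : M.T.map h ≫ C.x ≅ B.x ≫ h) (α : f ⟶ g)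
    (w : cf.hom ≫ A.x ◁ α = M.T.map₂ α ▷ B.x ≫ cg.hom) :
    (compCon cf ch).hom ≫ A.x ◁ α ▷ h = M.T.map₂ (α ▷ h) ▷ C.x ≫ (compCon cg ch).hom := by
  have e1 := whisker_exchange (M.T.map₂ α) ch.hom
  have e2 := congrArg (fun t => t ▷ h) w
  simp only [comp_whiskerRight] at e2
  rw [compCon_hom, compCon_hom, map₂_whiskerRight, wlr']
  simp only [comp_whiskerRight, Category.assoc, eqToHom_trans_assoc, eqToHom_refl,
    Category.id_comp, eqToHom_whiskerRight]
  rw [reassoc_of% e2, wr_comp (M.T.map₂ α), wr_comp (M.T.map₂ α)]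
  simp only [Category.assoc, eqToHom_trans_assoc, eqToHom_refl,
    Category.id_comp]
  rw [reassoc_of% e1]

/-- composite -/
def comp {A B C : Algebra M} (f : TMap A B) (g : TMap B C) : TMap A C where
  f := f.f ≫ g.f
  con := compCon f.con g.con
  unit := by
    have h1 : M.η A.X ◁ M.T.map f.f ◁ g.con.hom = eqToHom (by
      rw [← Strict.assoc, ← M.η_nat, Strict.assoc, TMap.unit_aux, ← Strict.assoc, M.η_nat,
        Strict.assoc]) := by
      rw [wl_comp, congr_whiskerLeft (M.η_nat f.f).symm, comp_whiskerLeft, g.unit]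
      simp [Strict.associator_eqToIso]
    have h2 : M.η A.X ◁ f.con.hom ▷ g.f = eqToHom (by
      rw [← Strict.assoc, TMap.unit_aux, Strict.assoc]) := by
      rw [wlr', f.unit]
      simp
    rw [compCon_hom]; simp [h1, h2]
  mult := by
    have h2 : M.μ A.X ◁ M.T.map f.f ◁ g.con.hom =
        eqToHom (by rw [← Strict.assoc, ← M.μ_nat, Strict.assoc, TMap.mult_aux₁]) ≫
          M.T.map (M.T.map f.f) ◁ M.T.map₂ g.con.hom ▷ C.x ≫
          eqToHom (by rw [mult_aux₂, M.T.map_comp, Strict.assoc]) ≫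
          M.T.map (M.T.map f.f ≫ B.x) ◁ g.con.hom ≫
          eqToHom (by rw [M.T.map_comp, Strict.assoc, mult_aux₃, ← Strict.assoc, M.μ_nat,
            Strict.assoc]) := by
      rw [wl_comp, congr_whiskerLeft (M.μ_nat f.f).symm, comp_whiskerLeft, g.mult,
        congr_whiskerLeft (M.T.map_comp (M.T.map f.f) B.x), comp_whiskerLeft]
      simp [Strict.associator_eqToIso]
    have h3 : M.μ A.X ◁ f.con.hom ▷ g.f =
        eqToHom (by rw [← Strict.assoc, mult_aux₁, Strict.assoc]) ≫
          M.T.map₂ f.con.hom ▷ (B.x ≫ g.f) ≫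
          eqToHom (by rw [← Strict.assoc, mult_aux₂, Strict.assoc, Strict.assoc]) ≫
          M.T.map A.x ◁ f.con.hom ▷ g.f ≫
          eqToHom (by rw [Strict.assoc, mult_aux₃]) := by
      rw [wlr', f.mult]
      rw [comp_whiskerRight, comp_whiskerRight, comp_whiskerRight, comp_whiskerRight, wr_comp, wlr]
      simp only [Category.assoc, eqToHom_trans_assoc, eqToHom_whiskerRight,
        eqToHom_trans]
    have h4 := whisker_exchange (M.T.map₂ f.con.hom) g.con.hom
    simp only [compCon_hom,
      whiskerLeft_comp, h2, h3, Bicategory.whiskerLeft_eqToHom, Category.assoc, eqToHom_trans_assoc,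
      eqToHom_trans, PrelaxFunctor.map₂_comp, comp_whiskerRight, PrelaxFunctor.map₂_eqToHom,
      eqToHom_whiskerRight, map₂_whiskerLeft, map₂_whiskerRight, wlr, eqToHom_refl,
      Category.id_comp, reassoc_of% h4]
    rw [wr_comp (M.T.map₂ f.con.hom) (M.T.map g.f) C.x, congr_whiskerLeft (M.T.map_comp A.x f.f),
      comp_whiskerLeft]
    simp [Strict.associator_eqToIso]

/-- An algebra 2-cell between T-maps: a 2-cell compatible with the algebra constraints. -/
@[ext]
structure Cell {A B : Algebra M} (f g : TMap A B) where
  cell : f.f ⟶ g.f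
  comm : f.con.hom ≫ A.x ◁ cell = M.T.map₂ cell ▷ B.x ≫ g.con.hom

instance {A B : Algebra M} : Category (TMap A B) where
  Hom f g := Cell f g
  id f := ⟨𝟙 f.f, by simp⟩
  comp α β := ⟨α.cell ≫ β.cell, by
    simp only [whiskerLeft_comp, PrelaxFunctor.map₂_comp, comp_whiskerRight, Category.assoc,
      ← β.comm, reassoc_of% α.comm]⟩

@[ext]
theorem hom_ext {A B : Algebra M} {f g : TMap A B} {α β : f ⟶ g} (h : α.cell = β.cell) : α = β :=
  Cell.ext h

@[simp] theorem id_cell {A B : Algebra M} (f : TMap A B) : Cell.cell (𝟙 f) = 𝟙 f.f := rfl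
@[simp] theorem comp_cell {A B : Algebra M} {f g h : TMap A B} (α : f ⟶ g) (β : g ⟶ h) :
    Cell.cell (α ≫ β) = α.cell ≫ β.cell := rfl
@[simp] theorem eqToHom_cell {A B : Algebra M} {f g : TMap A B} (h : f = g) :
    Cell.cell (eqToHom h) = eqToHom (congrArg TMap.f h) := by subst h; rfl

theorem ext' {A B : Algebra M} {f g : TMap A B} (h : f.f = g.f)
    (h' : f.con.hom = eqToHom (by rw [h]) ≫ g.con.hom ≫ eqToHom (by rw [h])) : f = g := by
  obtain ⟨f, cf, _, _⟩ := f
  obtain ⟨g, cg, _, _⟩ := g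
  obtain rfl : f = g := h
  obtain rfl : cf = cg := by ext; simpa using h'
  rfl

theorem id_comp {A B : Algebra M} (f : TMap A B) : (TMap.id A).comp f = f := by
  exact ext' (Strict.id_comp _) (id_compCon _)

theorem comp_id {A B : Algebra M} (f : TMap A B) : f.comp (TMap.id B) = f := by
  exact ext' (Strict.comp_id _) (compCon_id _)

theorem assoc {A B C D : Algebra M} (f : TMap A B) (g : TMap B C) (h : TMap C D) :
    (f.comp g).comp h = f.comp (g.comp h) := by
  refine ext' (Strict.assoc _ _ _) ?_
  exact compCon_assoc _ _ _

end TMap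

/-- The 2-category of algebras, T-maps and algebra 2-cells. -/
instance Algebra.bicategory : Bicategory (Algebra M) where
  Hom A B := TMap A B
  id := TMap.id
  comp f g := f.comp g
  homCategory A B := inferInstance
  whiskerLeft {A B C} f {g h} α := TMap.Cell.mk (f := f.comp g) (g := f.comp h) (f.f ◁ α.cell)
    (TMap.comm_left _ _ _ _ α.comm)
  whiskerRight {A B C} {f g} α h := TMap.Cell.mk (f := f.comp h) (g := g.comp h) (α.cell ▷ h.f)
    (TMap.comm_right _ _ _ _ α.comm)
  associator f g h := eqToIso (TMap.assoc f g h)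
  leftUnitor f := eqToIso (TMap.id_comp f)
  rightUnitor f := eqToIso (TMap.comp_id f)
  whiskerLeft_id f g := TMap.hom_ext (whiskerLeft_id f.f g.f)
  whiskerLeft_comp f _ _ _ α β := TMap.hom_ext (whiskerLeft_comp f.f α.cell β.cell)
  id_whiskerLeft α := TMap.hom_ext (by
    simp only [TMap.comp_cell, eqToIso.hom, eqToIso.inv, TMap.eqToHom_cell]; exact TMap.id_wl α.cell)
  comp_whiskerLeft f g _ _ α := TMap.hom_ext (by
    simp only [TMap.comp_cell, eqToIso.hom, eqToIso.inv, TMap.eqToHom_cell]; exact TMap.wl_comp' f.f g.f α.cell)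
  id_whiskerRight f g := TMap.hom_ext (id_whiskerRight f.f g.f)
  comp_whiskerRight α β h := TMap.hom_ext (comp_whiskerRight α.cell β.cell h.f)
  whiskerRight_id α := TMap.hom_ext (by
    simp only [TMap.comp_cell, eqToIso.hom, eqToIso.inv, TMap.eqToHom_cell]; exact TMap.wr_id α.cell)
  whiskerRight_comp α g h := TMap.hom_ext (by
    simp only [TMap.comp_cell, eqToIso.hom, eqToIso.inv, TMap.eqToHom_cell]; exact TMap.wr_comp' α.cell g.f h.f)
  whisker_assoc f _ _ α h := TMap.hom_ext (by
    simp only [TMap.comp_cell, eqToIso.hom, eqToIso.inv, TMap.eqToHom_cell]; exact TMap.wlr f.f α.cell h.f)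
  whisker_exchange α β := TMap.hom_ext (whisker_exchange α.cell β.cell)
  pentagon f g h i := TMap.hom_ext (by
    simp only [TMap.comp_cell, eqToIso.hom, TMap.eqToHom_cell, eqToHom_whiskerRight,
      Bicategory.whiskerLeft_eqToHom, eqToHom_trans]; exact TMap.eq₃ _ _ _)
  triangle f g := TMap.hom_ext (by
    simp only [TMap.comp_cell, eqToIso.hom, TMap.eqToHom_cell, eqToHom_whiskerRight,
      Bicategory.whiskerLeft_eqToHom]; exact TMap.eq₂ _ _)

instance Algebra.strict : Strict (Algebra M) where
  id_comp := TMap.id_comp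
  comp_id := TMap.comp_id
  assoc := TMap.assoc

namespace TMap

@[simp] theorem vid_cell {A B : Algebra M} (f : A ⟶ B) : Cell.cell (𝟙 f) = 𝟙 (TMap.f f) := rfl

@[simp] theorem vcomp_cell {A B : Algebra M} {f g h : A ⟶ B} (α : f ⟶ g) (β : g ⟶ h) :
    Cell.cell (α ≫ β) = α.cell ≫ β.cell := rfl

@[simp] theorem veqToHom_cell {A B : Algebra M} {f g : A ⟶ B} (h : f = g) :
    Cell.cell (eqToHom h) = eqToHom (congrArg TMap.f h) := by subst h; rfl

@[simp] theorem hcomp_f {A B C : Algebra M} (f : A ⟶ B) (g : B ⟶ C) :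
    TMap.f (f ≫ g) = f.f ≫ g.f := rfl

@[simp] theorem hid_f (A : Algebra M) : TMap.f (𝟙 A) = 𝟙 A.X := rfl

@[simp] theorem whiskerLeft_cell {A B C : Algebra M} (f : A ⟶ B) {g h : B ⟶ C} (α : g ⟶ h) :
    Cell.cell (f ◁ α) = f.f ◁ α.cell := rfl

@[simp] theorem whiskerRight_cell {A B C : Algebra M} {f g : A ⟶ B} (α : f ⟶ g) (h : B ⟶ C) :
    Cell.cell (α ▷ h) = α.cell ▷ h.f := rfl

end TMap

/-- A strict map of algebras: a 1-cell commuting with the structure 1-cells. -/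
@[ext]
structure StrictTMap (A B : Algebra M) where
  f : A.X ⟶ B.X
  comm : M.T.map f ≫ B.x = A.x ≫ f

namespace StrictTMap

/-- A strict map regarded as a pseudomorphism whose algebra constraint is an identity. -/
def toTMap {A B : Algebra M} (f : StrictTMap A B) : A ⟶ B :=
  TMap.mk (A := A) (B := B) f.f (eqToIso f.comm) (by simp) (by simp [PrelaxFunctor.map₂_eqToHom])

def id (A : Algebra M) : StrictTMap A A := ⟨𝟙 A.X, TMap.id_aux A⟩

def comp {A B C : Algebra M} (f : StrictTMap A B) (g : StrictTMap B C) : StrictTMap A C :=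
  ⟨f.f ≫ g.f, by
    rw [TMap.compCon_aux, g.comm, ← Strict.assoc, f.comm, Strict.assoc]⟩

theorem id_toTMap (A : Algebra M) : (id A).toTMap = 𝟙 A := rfl

theorem comp_toTMap {A B C : Algebra M} (f : StrictTMap A B) (g : StrictTMap B C) :
    (f.comp g).toTMap = f.toTMap ≫ g.toTMap := by
  refine TMap.ext' rfl ?_
  have h := TMap.compCon_hom (eqToIso f.comm) (eqToIso g.comm)
  simp only [eqToIso.hom, Bicategory.whiskerLeft_eqToHom, eqToHom_whiskerRight,
    eqToHom_trans] at h
  refine Eq.trans ?_ ((Category.id_comp _).trans (Category.comp_id _)).symm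
  exact h.symm

/-- A 2-cell between strict maps is an algebra 2-cell between the underlying T-maps. -/
@[ext]
structure Cell {A B : Algebra M} (f g : StrictTMap A B) where
  toCell : f.toTMap ⟶ g.toTMap

instance {A B : Algebra M} : Category (StrictTMap A B) where
  Hom f g := Cell f g
  id f := ⟨𝟙 f.toTMap⟩
  comp α β := ⟨α.toCell ≫ β.toCell⟩

theorem hom_ext {A B : Algebra M} {f g : StrictTMap A B} {α β : f ⟶ g}
    (h : α.toCell.cell = β.toCell.cell) : α = β := Cell.ext (TMap.hom_ext h)

@[simp] theorem id_toCell {A B : Algebra M} (f : StrictTMap A B) :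
    Cell.toCell (𝟙 f) = 𝟙 f.toTMap := rfl
@[simp] theorem comp_toCell {A B : Algebra M} {f g h : StrictTMap A B} (α : f ⟶ g) (β : g ⟶ h) :
    Cell.toCell (α ≫ β) = α.toCell ≫ β.toCell := rfl
@[simp] theorem eqToHom_toCell {A B : Algebra M} {f g : StrictTMap A B} (h : f = g) :
    Cell.toCell (eqToHom h) = eqToHom (congrArg StrictTMap.toTMap h) := by subst h; rfl

end StrictTMap

variable (M) in
/-- The objects of the 2-category of algebras and strict maps. -/
@[ext]
structure StrictAlgebra where
  alg : Algebra M

namespace StrictAlgebra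

open StrictTMap

def whiskerL {A B C : Algebra M} (f : StrictTMap A B) {g h : StrictTMap B C} (α : g ⟶ h) :
    f.comp g ⟶ f.comp h :=
  Cell.mk (eqToHom (comp_toTMap f g) ≫ f.toTMap ◁ α.toCell ≫ eqToHom (comp_toTMap f h).symm)

def whiskerR {A B C : Algebra M} {f g : StrictTMap A B} (α : f ⟶ g) (h : StrictTMap B C) :
    f.comp h ⟶ g.comp h :=
  Cell.mk (eqToHom (comp_toTMap f h) ≫ α.toCell ▷ h.toTMap ≫ eqToHom (comp_toTMap g h).symm)

theorem whiskerL_cell {A B C : Algebra M} (f : StrictTMap A B) {g h : StrictTMap B C}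
    (α : g ⟶ h) : (whiskerL f α).toCell.cell = f.f ◁ α.toCell.cell := by
  simp only [whiskerL, TMap.vcomp_cell, TMap.veqToHom_cell, TMap.whiskerLeft_cell]
  exact TMap.eq_conj _ _ _

theorem whiskerR_cell {A B C : Algebra M} {f g : StrictTMap A B} (α : f ⟶ g)
    (h : StrictTMap B C) : (whiskerR α h).toCell.cell = α.toCell.cell ▷ h.f := by
  simp only [whiskerR, TMap.vcomp_cell, TMap.veqToHom_cell, TMap.whiskerRight_cell]
  exact TMap.eq_conj _ _ _

/-- The 2-category of algebras, strict maps, and algebra 2-cells. -/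
instance bicategory : Bicategory (StrictAlgebra M) where
  Hom A B := StrictTMap A.alg B.alg
  id A := StrictTMap.id A.alg
  comp f g := f.comp g
  homCategory A B := inferInstance
  whiskerLeft f _ _ α := whiskerL f α
  whiskerRight α h := whiskerR α h
  associator f g h := eqToIso (StrictTMap.ext (Strict.assoc f.f g.f h.f))
  leftUnitor f := eqToIso (StrictTMap.ext (Strict.id_comp f.f))
  rightUnitor f := eqToIso (StrictTMap.ext (Strict.comp_id f.f))
  whiskerLeft_id f g := hom_ext (by
    rw [whiskerL_cell]; exact whiskerLeft_id f.f g.f)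
  whiskerLeft_comp f _ _ _ α β := hom_ext (by
    simp only [comp_toCell, TMap.vcomp_cell, whiskerL_cell]
    exact whiskerLeft_comp f.f α.toCell.cell β.toCell.cell)
  id_whiskerLeft α := hom_ext (by
    simp only [comp_toCell, TMap.vcomp_cell, whiskerL_cell, eqToIso.hom, eqToIso.inv,
      eqToHom_toCell, TMap.veqToHom_cell]
    exact TMap.id_wl α.toCell.cell)
  comp_whiskerLeft f g _ _ α := hom_ext (by
    simp only [comp_toCell, TMap.vcomp_cell, whiskerL_cell, eqToIso.hom, eqToIso.inv,
      eqToHom_toCell, TMap.veqToHom_cell]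
    exact TMap.wl_comp' f.f g.f α.toCell.cell)
  id_whiskerRight f g := hom_ext (by
    rw [whiskerR_cell]; exact id_whiskerRight f.f g.f)
  comp_whiskerRight α β h := hom_ext (by
    simp only [comp_toCell, TMap.vcomp_cell, whiskerR_cell]
    exact comp_whiskerRight α.toCell.cell β.toCell.cell h.f)
  whiskerRight_id α := hom_ext (by
    simp only [comp_toCell, TMap.vcomp_cell, whiskerR_cell, eqToIso.hom, eqToIso.inv,
      eqToHom_toCell, TMap.veqToHom_cell]
    exact TMap.wr_id α.toCell.cell)
  whiskerRight_comp α g h := hom_ext (by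
    simp only [comp_toCell, TMap.vcomp_cell, whiskerR_cell, eqToIso.hom, eqToIso.inv,
      eqToHom_toCell, TMap.veqToHom_cell]
    exact TMap.wr_comp' α.toCell.cell g.f h.f)
  whisker_assoc f _ _ α h := hom_ext (by
    simp only [comp_toCell, TMap.vcomp_cell, whiskerR_cell, whiskerL_cell, eqToIso.hom,
      eqToIso.inv, eqToHom_toCell, TMap.veqToHom_cell]
    exact TMap.wlr f.f α.toCell.cell h.f)
  whisker_exchange α β := hom_ext (by
    simp only [comp_toCell, TMap.vcomp_cell, whiskerR_cell, whiskerL_cell]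
    exact whisker_exchange α.toCell.cell β.toCell.cell)
  pentagon f g h i := hom_ext (by
    simp only [comp_toCell, TMap.vcomp_cell, whiskerR_cell, whiskerL_cell, eqToIso.hom,
      eqToHom_toCell, TMap.veqToHom_cell, eqToHom_whiskerRight, Bicategory.whiskerLeft_eqToHom]
    exact (TMap.eq₃ _ _ _).trans (TMap.eq₂ _ _).symm)
  triangle f g := hom_ext (by
    simp only [comp_toCell, TMap.vcomp_cell, whiskerR_cell, whiskerL_cell, eqToIso.hom,
      eqToHom_toCell, TMap.veqToHom_cell, eqToHom_whiskerRight, Bicategory.whiskerLeft_eqToHom]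
    exact TMap.eq₂ _ _)

instance strict : Strict (StrictAlgebra M) where
  id_comp f := StrictTMap.ext (Strict.id_comp f.f)
  comp_id f := StrictTMap.ext (Strict.comp_id f.f)
  assoc f g h := StrictTMap.ext (Strict.assoc f.f g.f h.f)

variable (M) in
/-- The inclusion 2-functor from algebras and strict maps to algebras and T-maps. -/
def incl : StrictPseudofunctor (StrictAlgebra M) (Algebra M) :=
  StrictPseudofunctor.mk''
    { obj := StrictAlgebra.alg
      map := fun f => StrictTMap.toTMap f
      map₂ := fun α => StrictTMap.Cell.toCell α
      map_id := fun A => StrictTMap.id_toTMap A.alg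
      map_comp := fun f g => StrictTMap.comp_toTMap f g
      map₂_id := fun _ => rfl
      map₂_comp := fun _ _ => rfl
      map₂_whisker_left := fun _ _ _ _ => rfl
      map₂_whisker_right := fun _ _ => rfl }

end StrictAlgebra

/-- A 2-adjunction between strict 2-functors, given by a 2-natural unit and counit satisfying the
triangle identities. -/
structure TwoAdjunction {B : Type*} {C : Type*} [Bicategory B] [Strict B] [Bicategory C] [Strict C]
    (F : StrictPseudofunctor B C) (G : StrictPseudofunctor C B) where
  unit : ∀ X : B, X ⟶ G.obj (F.obj X)
  unit_nat : ∀ {X Y : B} (f : X ⟶ Y), f ≫ unit Y = unit X ≫ G.map (F.map f)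
  unit_nat₂ : ∀ {X Y : B} {f g : X ⟶ Y} (α : f ⟶ g),
    α ▷ unit Y =
      eqToHom (unit_nat f) ≫ unit X ◁ G.map₂ (F.map₂ α) ≫ eqToHom (unit_nat g).symm
  counit : ∀ Y : C, F.obj (G.obj Y) ⟶ Y
  counit_nat : ∀ {X Y : C} (f : X ⟶ Y), F.map (G.map f) ≫ counit Y = counit X ≫ f
  counit_nat₂ : ∀ {X Y : C} {f g : X ⟶ Y} (α : f ⟶ g),
    F.map₂ (G.map₂ α) ▷ counit Y =
      eqToHom (counit_nat f) ≫ counit X ◁ α ≫ eqToHom (counit_nat g).symm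
  right_triangle : ∀ Y : C, unit (G.obj Y) ≫ G.map (counit Y) = 𝟙 (G.obj Y)
  left_triangle : ∀ X : B, F.map (unit X) ≫ counit (F.obj X) = 𝟙 (F.obj X)

/-- `(ζ, δ, Θ)` is an adjoint surjective equivalence: `δ ∘ ζ = 1` and `Θ * ζ = 1`. -/
def IsAdjointSurjectiveEquivalence {B : Type*} [Bicategory B] [Strict B] {Y Z : B}
    (ζ : Y ⟶ Z) (δ : Z ⟶ Y) (Θ : δ ≫ ζ ≅ 𝟙 Z) : Prop :=
  ∃ h : ζ ≫ δ = 𝟙 Y,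
    ζ ◁ Θ.hom = eqToHom (by rw [← Strict.assoc, h, Strict.id_comp, Strict.comp_id])

end TwoMonads

universe u v

/-! ## Strict monoidal structures -/

/-- The three cases: strict monoidal (`plain`), permutative (`symmetric`) and braided strict
monoidal (`braided`). -/
inductive Kind
  | plain
  | symmetric
  | braided

/-- Equality of morphisms whose (co)domains are equal but not syntactically so. -/
def MEq {X : Type*} [Category X] {a b c d : X} (f : a ⟶ b) (g : c ⟶ d) : Prop :=
  ∃ (h : a = c) (h' : b = d), f = eqToHom h ≫ g ≫ eqToHom h'.symm

namespace MEq

variable {X : Type*} [Category X]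

theorem refl {a b : X} (f : a ⟶ b) : MEq f f := ⟨rfl, rfl, by simp⟩

theorem of_eq {a b : X} {f g : a ⟶ b} (h : f = g) : MEq f g := ⟨rfl, rfl, by simp [h]⟩

theorem symm {a b c d : X} {f : a ⟶ b} {g : c ⟶ d} (h : MEq f g) : MEq g f := by
  obtain ⟨rfl, rfl, rfl⟩ := h; exact of_eq (by simp)

theorem trans {a b c d a' b' : X} {f : a ⟶ b} {g : c ⟶ d} {k : a' ⟶ b'} (h : MEq f g)
    (h' : MEq g k) : MEq f k := by
  obtain ⟨rfl, rfl, rfl⟩ := h; obtain ⟨rfl, rfl, rfl⟩ := h'; exact of_eq (by simp)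

theorem eq {a b : X} {f g : a ⟶ b} (h : MEq f g) : f = g := by
  obtain ⟨_, _, h⟩ := h; simpa using h

theorem left {a b c : X} (h : a = b) (f : b ⟶ c) : MEq (eqToHom h ≫ f) f := by
  subst h; exact of_eq (by simp)

theorem right {a b c : X} (f : a ⟶ b) (h : b = c) : MEq (f ≫ eqToHom h) f := by
  subst h; exact of_eq (by simp)

theorem conj {a b c d : X} (h : a = b) (f : b ⟶ c) (h' : c = d) :
    MEq (eqToHom h ≫ f ≫ eqToHom h') f := by
  subst h; subst h'; exact of_eq (by simp)

theorem eqToHom {a b c d : X} (h : a = b) (h' : c = d) (e : a = c) :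
    MEq (eqToHom h) (eqToHom h') := by
  subst h; subst h'; subst e; exact refl _

theorem comp {a b c a' b' c' : X} {f : a ⟶ b} {g : b ⟶ c} {f' : a' ⟶ b'} {g' : b' ⟶ c'}
    (h : MEq f f') (h' : MEq g g') : MEq (f ≫ g) (f' ≫ g') := by
  obtain ⟨rfl, rfl, rfl⟩ := h; obtain ⟨h, rfl, rfl⟩ := h'; exact of_eq (by simp)

theorem map {Y : Type*} [Category Y] (F : X ⥤ Y) {a b c d : X} {f : a ⟶ b} {g : c ⟶ d}
    (h : MEq f g) : MEq (F.map f) (F.map g) := by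
  obtain ⟨rfl, rfl, rfl⟩ := h; exact of_eq (by simp)

theorem of_functor_eq {Y : Type*} [Category Y] {F G : X ⥤ Y} (h : F = G) {a b : X} (f : a ⟶ b) :
    MEq (F.map f) (G.map f) := by
  subst h; exact refl _

theorem app {Y : Type*} [Category Y] {F G : X ⥤ Y} (θ : F ⟶ G) {a b : X} (h : a = b) :
    MEq (θ.app a) (θ.app b) := by
  subst h; exact refl _

end MEq

/-- Structure on a category `X` of a strict monoidal category (`k = plain`), of a permutative
category (`k = symmetric`), or of a braided strict monoidal category (`k = braided`). -/
class StrictStr (k : Kind) (X : Type u) [Category.{v} X] where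
  mul : X → X → X
  one : X
  mul_assoc : ∀ a b c, mul (mul a b) c = mul a (mul b c)
  one_mul : ∀ a, mul one a = a
  mul_one : ∀ a, mul a one = a
  tensor : ∀ {a b c d : X}, (a ⟶ b) → (c ⟶ d) → (mul a c ⟶ mul b d)
  tensor_id : ∀ a b : X, tensor (𝟙 a) (𝟙 b) = 𝟙 (mul a b)
  tensor_comp : ∀ {a b c a' b' c' : X} (f : a ⟶ b) (g : b ⟶ c) (f' : a' ⟶ b') (g' : b' ⟶ c'),
    tensor (f ≫ g) (f' ≫ g') = tensor f f' ≫ tensor g g'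
  tensor_assoc : ∀ {a b c a' b' c' : X} (f : a ⟶ a') (g : b ⟶ b') (h : c ⟶ c'),
    MEq (tensor (tensor f g) h) (tensor f (tensor g h))
  one_tensor : ∀ {a b : X} (f : a ⟶ b), MEq (tensor (𝟙 one) f) f
  tensor_one : ∀ {a b : X} (f : a ⟶ b), MEq (tensor f (𝟙 one)) f
  braid : k ≠ Kind.plain → ∀ a b : X, mul a b ⟶ mul b a
  braidInv : k ≠ Kind.plain → ∀ a b : X, mul b a ⟶ mul a b
  braid_inv : ∀ (hk : k ≠ Kind.plain) (a b : X), braid hk a b ≫ braidInv hk a b = 𝟙 _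
  inv_braid : ∀ (hk : k ≠ Kind.plain) (a b : X), braidInv hk a b ≫ braid hk a b = 𝟙 _
  braid_nat : ∀ (hk : k ≠ Kind.plain) {a b c d : X} (f : a ⟶ b) (g : c ⟶ d),
    tensor f g ≫ braid hk b d = braid hk a c ≫ tensor g f
  hexagon₁ : ∀ (hk : k ≠ Kind.plain) (a b c : X),
    MEq (braid hk a (mul b c))
      (tensor (braid hk a b) (𝟙 c) ≫ eqToHom (mul_assoc b a c) ≫ tensor (𝟙 b) (braid hk a c))
  hexagon₂ : ∀ (hk : k ≠ Kind.plain) (a b c : X),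
    MEq (braid hk (mul a b) c)
      (tensor (𝟙 a) (braid hk b c) ≫ eqToHom (mul_assoc a c b).symm ≫ tensor (braid hk a c) (𝟙 b))
  symmetry : ∀ (hk : k ≠ Kind.plain), k = Kind.symmetric → ∀ a b : X,
    braid hk a b ≫ braid hk b a = 𝟙 _

namespace StrictStr

variable {k : Kind} {X : Type*} [Category X] [StrictStr k X]

variable (k) in
theorem tensor_congr {a b c d a' b' c' d' : X} {f : a ⟶ b} {g : c ⟶ d} {f' : a' ⟶ b'}
    {g' : c' ⟶ d'} (h : MEq f f') (h' : MEq g g') :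
    MEq (tensor (k := k) f g) (tensor (k := k) f' g') := by
  obtain ⟨rfl, rfl, rfl⟩ := h; obtain ⟨rfl, rfl, rfl⟩ := h'; exact MEq.of_eq (by simp)

theorem braid_congr (hk : k ≠ Kind.plain) {a b a' b' : X} (h : a = a') (h' : b = b') :
    MEq (braid hk a b) (braid hk a' b') := by
  subst h; subst h'; exact MEq.refl _

theorem braidInv_congr (hk : k ≠ Kind.plain) {a b a' b' : X} (h : a = a') (h' : b = b') :
    MEq (braidInv hk a b) (braidInv hk a' b') := by
  subst h; subst h'; exact MEq.refl _

end StrictStr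

open StrictStr

/-! ## Structures presented by generators and relations -/

/-- Formal words in a family of generating morphisms `G` between tuples of elements of `O`, built
with composition, concatenation and, unless `k` is plain, braidings. -/
inductive Word (k : Kind) {O : Type u} (G : List O → List O → Type u) :
    List O → List O → Type u
  | id (a : List O) : Word k G a a
  | comp {a b c : List O} (f : Word k G a b) (g : Word k G b c) : Word k G a c
  | gen {a b : List O} (x : G a b) : Word k G a b
  | tensor {a b c d : List O} (f : Word k G a b) (g : Word k G c d) : Word k G (a ++ c) (b ++ d)
  | braid (hk : k ≠ Kind.plain) (a b : List O) : Word k G (a ++ b) (b ++ a)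
  | braidInv (hk : k ≠ Kind.plain) (a b : List O) : Word k G (b ++ a) (a ++ b)

/-- The identity word, seen as a word between two equal tuples. -/
def Word.cast {k : Kind} {O : Type u} {G : List O → List O → Type u} {a b : List O} (h : a = b) :
    Word k G a b :=
  h ▸ Word.id a

/-- A presentation of a strict monoidal structure whose monoid of objects is free: objects `Ob`,
generating morphisms `Gen` between tuples of objects, and relations `Rel` between words. -/
structure Presentation (k : Kind) where
  Ob : Type u
  Gen : List Ob → List Ob → Type u
  Rel : ∀ {a b : List Ob}, Word k Gen a b → Word k Gen a b → Prop

namespace Presentation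

variable {k : Kind} (P : Presentation.{u} k)

/-- The relations `P.Rel`, together with the axioms of a category and of a strict monoidal
structure of kind `k`. -/
inductive Eqv : ∀ {a b : List P.Ob}, Word k P.Gen a b → Word k P.Gen a b → Prop
  | rel {a b} {f g : Word k P.Gen a b} (h : P.Rel f g) : Eqv f g
  | comp_left {a b c} {f f' : Word k P.Gen a b} (g : Word k P.Gen b c) (h : Eqv f f') :
      Eqv (f.comp g) (f'.comp g)
  | comp_right {a b c} (f : Word k P.Gen a b) {g g' : Word k P.Gen b c} (h : Eqv g g') :
      Eqv (f.comp g) (f.comp g')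
  | tensor_left {a b c d} {f f' : Word k P.Gen a b} (g : Word k P.Gen c d) (h : Eqv f f') :
      Eqv (f.tensor g) (f'.tensor g)
  | tensor_right {a b c d} (f : Word k P.Gen a b) {g g' : Word k P.Gen c d} (h : Eqv g g') :
      Eqv (f.tensor g) (f.tensor g')
  | id_comp {a b} (f : Word k P.Gen a b) : Eqv ((Word.id a).comp f) f
  | comp_id {a b} (f : Word k P.Gen a b) : Eqv (f.comp (Word.id b)) f
  | assoc {a b c d} (f : Word k P.Gen a b) (g : Word k P.Gen b c) (h : Word k P.Gen c d) :
      Eqv ((f.comp g).comp h) (f.comp (g.comp h))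
  | tensor_id (a b) : Eqv ((Word.id a).tensor (Word.id b)) (Word.id (a ++ b))
  | tensor_comp {a b c a' b' c'} (f : Word k P.Gen a b) (g : Word k P.Gen b c)
      (f' : Word k P.Gen a' b') (g' : Word k P.Gen b' c') :
      Eqv ((f.comp g).tensor (f'.comp g')) ((f.tensor f').comp (g.tensor g'))
  | tensor_assoc {a b c a' b' c'} (f : Word k P.Gen a a') (g : Word k P.Gen b b')
      (h : Word k P.Gen c c') :
      Eqv ((f.tensor g).tensor h)
        ((Word.cast (List.append_assoc a b c)).comp
          ((f.tensor (g.tensor h)).comp (Word.cast (List.append_assoc a' b' c').symm)))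
  | nil_tensor {a b} (f : Word k P.Gen a b) :
      Eqv ((Word.id []).tensor f) f
  | tensor_nil {a b} (f : Word k P.Gen a b) :
      Eqv (f.tensor (Word.id []))
        ((Word.cast (List.append_nil a)).comp (f.comp (Word.cast (List.append_nil b).symm)))
  | braid_inv (hk : k ≠ Kind.plain) (a b) :
      Eqv ((Word.braid hk a b).comp (Word.braidInv hk a b)) (Word.id (a ++ b))
  | inv_braid (hk : k ≠ Kind.plain) (a b) :
      Eqv ((Word.braidInv hk a b).comp (Word.braid hk a b)) (Word.id (b ++ a))
  | braid_nat (hk : k ≠ Kind.plain) {a b c d} (f : Word k P.Gen a b) (g : Word k P.Gen c d) :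
      Eqv ((f.tensor g).comp (Word.braid hk b d)) ((Word.braid hk a c).comp (g.tensor f))
  | hexagon₁ (hk : k ≠ Kind.plain) (a b c) :
      Eqv (Word.braid hk a (b ++ c))
        ((Word.cast (List.append_assoc a b c).symm).comp
          ((((Word.braid hk a b).tensor (Word.id c)).comp
            ((Word.cast (List.append_assoc b a c)).comp
              ((Word.id b).tensor (Word.braid hk a c)))).comp
                (Word.cast (List.append_assoc b c a).symm)))
  | hexagon₂ (hk : k ≠ Kind.plain) (a b c) :
      Eqv (Word.braid hk (a ++ b) c)
        ((Word.cast (List.append_assoc a b c)).comp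
          ((((Word.id a).tensor (Word.braid hk b c)).comp
            ((Word.cast (List.append_assoc a c b).symm).comp
              ((Word.braid hk a c).tensor (Word.id b)))).comp
                (Word.cast (List.append_assoc c a b))))
  | symmetry (hk : k ≠ Kind.plain) (hs : k = Kind.symmetric) (a b) :
      Eqv ((Word.braid hk a b).comp (Word.braid hk b a)) (Word.id (a ++ b))

/-- The objects of the presented category: tuples of elements of `P.Ob`. -/
@[ext]
structure Carrier where
  tuple ::
  toList : List P.Ob

/-- The presented category. -/
instance : Category.{u} P.Carrier where
  Hom a b := Quot (P.Eqv (a := a.toList) (b := b.toList))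
  id a := Quot.mk _ (Word.id a.toList)
  comp f g := Quot.map₂ Word.comp (fun f _ _ h => Eqv.comp_right f h)
    (fun _ _ g h => Eqv.comp_left g h) f g
  id_comp := by rintro a b ⟨f⟩; exact Quot.sound (Eqv.id_comp f)
  comp_id := by rintro a b ⟨f⟩; exact Quot.sound (Eqv.comp_id f)
  assoc := by rintro a b c d ⟨f⟩ ⟨g⟩ ⟨h⟩; exact Quot.sound (Eqv.assoc f g h)

/-- The class of a word, as a morphism. -/
def hom {a b : List P.Ob} (w : Word k P.Gen a b) : Carrier.tuple (P := P) a ⟶ Carrier.tuple b :=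
  Quot.mk _ w

/-- A generator, as a morphism. -/
def gen {a b : List P.Ob} (x : P.Gen a b) : Carrier.tuple (P := P) a ⟶ Carrier.tuple b :=
  P.hom (Word.gen x)

theorem hom_cast {a b : List P.Ob} (h : a = b) :
    P.hom (Word.cast h) = eqToHom (congrArg Carrier.tuple h) := by
  subst h; rfl

theorem hom_id (a : List P.Ob) : P.hom (Word.id a) = 𝟙 _ := rfl

theorem hom_comp {a b c : List P.Ob} (f : Word k P.Gen a b) (g : Word k P.Gen b c) :
    P.hom (f.comp g) = P.hom f ≫ P.hom g := rfl

theorem hom_surj {a b : P.Carrier} (f : a ⟶ b) :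
    ∃ w : Word k P.Gen a.toList b.toList, P.hom w = f := Quot.exists_rep f

theorem hom_sound {a b : List P.Ob} {f g : Word k P.Gen a b} (h : P.Eqv f g) :
    P.hom f = P.hom g := Quot.sound h

variable {P} in
/-- Concatenation of tuples. -/
def append (a b : P.Carrier) : P.Carrier := ⟨a.toList ++ b.toList⟩

variable {P} in
/-- Concatenation of morphisms. -/
def tensorHom {a b c d : P.Carrier} (f : a ⟶ b) (g : c ⟶ d) : append a c ⟶ append b d :=
  Quot.map₂ Word.tensor (fun f _ _ h => Eqv.tensor_right f h)
    (fun _ _ g h => Eqv.tensor_left g h) f g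

/-- The strict monoidal structure of a presented category, given by concatenation. -/
instance : StrictStr k P.Carrier where
  mul := append
  one := ⟨[]⟩
  mul_assoc a b c := Carrier.ext (List.append_assoc a.toList b.toList c.toList)
  one_mul _ := rfl
  mul_one a := Carrier.ext (List.append_nil a.toList)
  tensor f g := tensorHom f g
  tensor_id a b := P.hom_sound (Eqv.tensor_id a.toList b.toList)
  tensor_comp := by
    rintro a b c a' b' c' ⟨f⟩ ⟨g⟩ ⟨f'⟩ ⟨g'⟩; exact P.hom_sound (Eqv.tensor_comp f g f' g')
  tensor_assoc := by
    rintro a b c a' b' c' ⟨f⟩ ⟨g⟩ ⟨h⟩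
    refine ⟨Carrier.ext (List.append_assoc _ _ _), Carrier.ext (List.append_assoc _ _ _), ?_⟩
    have e := P.hom_sound (Eqv.tensor_assoc f g h)
    rw [hom_comp, hom_comp, hom_cast, hom_cast] at e
    exact e
  one_tensor := by
    rintro a b ⟨f⟩
    exact MEq.of_eq (a := a) (b := b) (P.hom_sound (Eqv.nil_tensor f))
  tensor_one := by
    rintro a b ⟨f⟩
    refine ⟨Carrier.ext (List.append_nil _), Carrier.ext (List.append_nil _), ?_⟩
    have e := P.hom_sound (Eqv.tensor_nil f)
    rw [hom_comp, hom_comp, hom_cast, hom_cast] at e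
    exact e
  braid hk a b := P.hom (Word.braid hk a.toList b.toList)
  braidInv hk a b := P.hom (Word.braidInv hk a.toList b.toList)
  braid_inv hk a b := P.hom_sound (Eqv.braid_inv hk a.toList b.toList)
  inv_braid hk a b := P.hom_sound (Eqv.inv_braid hk a.toList b.toList)
  braid_nat := by
    rintro hk a b c d ⟨f⟩ ⟨g⟩; exact P.hom_sound (Eqv.braid_nat hk f g)
  hexagon₁ hk a b c := by
    refine ⟨Carrier.ext (List.append_assoc _ _ _).symm, Carrier.ext (List.append_assoc _ _ _), ?_⟩
    have e := P.hom_sound (Eqv.hexagon₁ hk a.toList b.toList c.toList)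
    rw [hom_comp, hom_comp, hom_comp, hom_comp, hom_cast, hom_cast, hom_cast] at e
    exact e
  hexagon₂ hk a b c := by
    refine ⟨Carrier.ext (List.append_assoc _ _ _), Carrier.ext (List.append_assoc _ _ _).symm, ?_⟩
    have e := P.hom_sound (Eqv.hexagon₂ hk a.toList b.toList c.toList)
    rw [hom_comp, hom_comp, hom_comp, hom_comp, hom_cast, hom_cast, hom_cast] at e
    exact e
  symmetry hk hs a b := P.hom_sound (Eqv.symmetry hk hs a.toList b.toList)

end Presentation
/-! ## Strict functors and monoidal transformations -/

/-- A functor preserving strict monoidal structures on the nose. -/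
structure IsStrictFun (k : Kind) {X Y : Type*} [Category X] [Category Y] [StrictStr k X]
    [StrictStr k Y] (F : X ⥤ Y) : Prop where
  map_one : F.obj (one k) = one k
  map_mul : ∀ a b : X, F.obj (mul k a b) = mul k (F.obj a) (F.obj b)
  map_tensor : ∀ {a b c d : X} (f : a ⟶ b) (g : c ⟶ d),
    MEq (F.map (tensor (k := k) f g)) (tensor (k := k) (F.map f) (F.map g))
  map_braid : ∀ (hk : k ≠ Kind.plain) (a b : X),
    MEq (F.map (braid hk a b)) (braid hk (F.obj a) (F.obj b))

/-- A monoidal transformation between strict functors. -/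
structure IsMonTrans (k : Kind) {X Y : Type*} [Category X] [Category Y] [StrictStr k X]
    [StrictStr k Y] {F G : X ⥤ Y} (θ : F ⟶ G) : Prop where
  app_one : MEq (θ.app (one k)) (𝟙 (one k : Y))
  app_mul : ∀ a b : X, MEq (θ.app (mul k a b)) (tensor (k := k) (θ.app a) (θ.app b))

namespace IsStrictFun

variable {k : Kind} {X Y Z : Type*} [Category X] [Category Y] [Category Z] [StrictStr k X]
  [StrictStr k Y] [StrictStr k Z]

theorem map_braidInv {F : X ⥤ Y} (hF : IsStrictFun k F) (hk : k ≠ Kind.plain) (a b : X) :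
    MEq (F.map (braidInv hk a b)) (braidInv hk (F.obj a) (F.obj b)) := by
  have h := hF.map_braid hk a b
  have e1 : F.map (braid hk a b) ≫ F.map (braidInv hk a b) = 𝟙 _ := by
    rw [← F.map_comp, braid_inv, F.map_id]
  obtain ⟨p, q, h⟩ := h
  refine ⟨q, p, ?_⟩
  have : IsIso (F.map (braid hk a b)) := ⟨F.map (braidInv hk a b), e1, by
    rw [← F.map_comp, inv_braid, F.map_id]⟩
  rw [← cancel_epi (F.map (braid hk a b)), e1, h]
  simp [reassoc_of% (braid_inv hk (F.obj a) (F.obj b))]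

theorem id : IsStrictFun k (𝟭 X) :=
  ⟨rfl, fun _ _ => rfl, fun _ _ => MEq.refl _, fun _ _ _ => MEq.refl _⟩

theorem comp {F : X ⥤ Y} {G : Y ⥤ Z} (hF : IsStrictFun k F) (hG : IsStrictFun k G) :
    IsStrictFun k (F ⋙ G) where
  map_one := by simp [hF.map_one, hG.map_one]
  map_mul a b := by simp [hF.map_mul, hG.map_mul]
  map_tensor f g := ((hF.map_tensor f g).map G).trans (hG.map_tensor _ _)
  map_braid hk a b := ((hF.map_braid hk a b).map G).trans (hG.map_braid _ _ _)

end IsStrictFun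

namespace IsMonTrans

variable {k : Kind} {X Y Z : Type*} [Category X] [Category Y] [Category Z] [StrictStr k X]
  [StrictStr k Y] [StrictStr k Z]

theorem id {F : X ⥤ Y} (hF : IsStrictFun k F) : IsMonTrans k (𝟙 F) where
  app_one := MEq.eqToHom rfl rfl hF.map_one
  app_mul a b := by
    rw [NatTrans.id_app, NatTrans.id_app, NatTrans.id_app, tensor_id]
    exact MEq.eqToHom rfl rfl (hF.map_mul a b)

theorem comp {F G H : X ⥤ Y} {θ : F ⟶ G} {θ' : G ⟶ H} (h : IsMonTrans k θ)
    (h' : IsMonTrans k θ') : IsMonTrans k (θ ≫ θ') where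
  app_one := by
    have := MEq.comp h.app_one h'.app_one
    rwa [Category.comp_id] at this
  app_mul a b := by
    have := MEq.comp (h.app_mul a b) (h'.app_mul a b)
    rwa [← tensor_comp] at this

theorem whiskerLeft {F : X ⥤ Y} {G H : Y ⥤ Z} {θ : G ⟶ H} (hF : IsStrictFun k F)
    (h : IsMonTrans k θ) : IsMonTrans k (F.whiskerLeft θ) where
  app_one := (MEq.app θ hF.map_one).trans h.app_one
  app_mul a b := (MEq.app θ (hF.map_mul a b)).trans (h.app_mul _ _)

theorem whiskerRight {F G : X ⥤ Y} {H : Y ⥤ Z} {θ : F ⟶ G} (hH : IsStrictFun k H)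
    (h : IsMonTrans k θ) : IsMonTrans k (Functor.whiskerRight θ H) where
  app_one := by
    refine (h.app_one.map H).trans ?_
    rw [H.map_id]; exact MEq.eqToHom rfl rfl hH.map_one
  app_mul a b := ((h.app_mul a b).map H).trans (hH.map_tensor _ _)

end IsMonTrans

/-! ## Universal property of a presented category -/

namespace Presentation

variable {k : Kind} {P : Presentation.{u} k}

section Interp

variable {X : Type*} [Category X] [StrictStr k X]

/-- The product of the values of a tuple. -/
def evalObj (o : P.Ob → X) : List P.Ob → X
  | [] => one k
  | a :: l => mul k (o a) (evalObj o l)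

theorem evalObj_append (o : P.Ob → X) (a b : List P.Ob) :
    evalObj o (a ++ b) = mul k (evalObj o a) (evalObj o b) := by
  induction a with
  | nil => exact (StrictStr.one_mul _).symm
  | cons x a ih => simp [evalObj, ih, StrictStr.mul_assoc]

theorem evalObj_singleton (o : P.Ob → X) (a : P.Ob) : evalObj o [a] = o a := StrictStr.mul_one _

/-- The value of a word. -/
def evalWord (o : P.Ob → X) (g : ∀ {a b : List P.Ob}, P.Gen a b → (evalObj o a ⟶ evalObj o b)) :
    ∀ {a b : List P.Ob}, Word k P.Gen a b → (evalObj o a ⟶ evalObj o b)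
  | _, _, Word.id a => 𝟙 (evalObj o a)
  | _, _, Word.comp f f' => evalWord o g f ≫ evalWord o g f'
  | _, _, Word.gen x => g x
  | _, _, Word.tensor (a := a) (b := b) (c := c) (d := d) f f' =>
      eqToHom (evalObj_append o a c) ≫ tensor (k := k) (evalWord o g f) (evalWord o g f') ≫
        eqToHom (evalObj_append o b d).symm
  | _, _, Word.braid hk a b =>
      eqToHom (evalObj_append o a b) ≫ braid hk (evalObj o a) (evalObj o b) ≫
        eqToHom (evalObj_append o b a).symm
  | _, _, Word.braidInv hk a b =>
      eqToHom (evalObj_append o b a) ≫ braidInv hk (evalObj o a) (evalObj o b) ≫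
        eqToHom (evalObj_append o a b).symm

variable (o : P.Ob → X) (g : ∀ {a b : List P.Ob}, P.Gen a b → (evalObj o a ⟶ evalObj o b))

theorem evalWord_tensor {a b c d : List P.Ob} (f : Word k P.Gen a b) (f' : Word k P.Gen c d) :
    MEq (evalWord o g (f.tensor f')) (tensor (k := k) (evalWord o g f) (evalWord o g f')) :=
  MEq.conj _ _ _

theorem evalWord_braid (hk : k ≠ Kind.plain) (a b : List P.Ob) :
    MEq (evalWord o g (Word.braid hk a b)) (braid hk (evalObj o a) (evalObj o b)) :=
  MEq.conj _ _ _

theorem evalWord_braidInv (hk : k ≠ Kind.plain) (a b : List P.Ob) :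
    MEq (evalWord o g (Word.braidInv hk a b)) (braidInv hk (evalObj o a) (evalObj o b)) :=
  MEq.conj _ _ _

theorem evalWord_cast {a b : List P.Ob} (h : a = b) :
    evalWord o g (Word.cast h) = eqToHom (congrArg (evalObj o) h) := by
  subst h; rfl

theorem evalWord_conj {a b c d : List P.Ob} (h : a = b) (f : Word k P.Gen b c) (h' : c = d) :
    MEq (evalWord o g ((Word.cast h).comp (f.comp (Word.cast h')))) (evalWord o g f) := by
  subst h; subst h'; exact MEq.of_eq (by simp [evalWord, evalWord_cast])

theorem evalWord_sound
    (hg : ∀ {a b : List P.Ob} {f f' : Word k P.Gen a b}, P.Rel f f' →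
      evalWord o g f = evalWord o g f')
    {a b : List P.Ob} {f f' : Word k P.Gen a b} (h : P.Eqv f f') :
    evalWord o g f = evalWord o g f' := by
  induction h with
  | rel h => exact hg h
  | comp_left g h ih => simp [evalWord, ih]
  | comp_right f h ih => simp [evalWord, ih]
  | tensor_left g h ih => simp [evalWord, ih]
  | tensor_right f h ih => simp [evalWord, ih]
  | id_comp f => simp [evalWord]
  | comp_id f => simp [evalWord]
  | assoc f g h => simp [evalWord]
  | tensor_id a b => simp [evalWord, tensor_id]
  | tensor_comp f g f' g' => simp [evalWord, tensor_comp]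
  | tensor_assoc f f' f'' =>
    apply MEq.eq
    refine (evalWord_tensor o g _ _).trans ?_
    refine (tensor_congr k (evalWord_tensor o g _ _) (MEq.refl _)).trans ?_
    refine (StrictStr.tensor_assoc _ _ _).trans ?_
    refine MEq.trans ?_ (evalWord_conj o g _ _ _).symm
    refine MEq.trans ?_ (evalWord_tensor o g _ _).symm
    exact tensor_congr k (MEq.refl _) (evalWord_tensor o g _ _).symm
  | nil_tensor f =>
    exact ((evalWord_tensor o g _ _).trans (one_tensor _)).eq
  | tensor_nil f =>
    exact ((evalWord_tensor o g _ _).trans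
      ((tensor_one _).trans (evalWord_conj o g _ _ _).symm)).eq
  | braid_inv hk a b => simp [evalWord, reassoc_of% braid_inv hk (evalObj o a) (evalObj o b)]
  | inv_braid hk a b => simp [evalWord, reassoc_of% inv_braid hk (evalObj o a) (evalObj o b)]
  | braid_nat hk f f' =>
    simp [evalWord, reassoc_of% braid_nat hk (evalWord o g f) (evalWord o g f')]
  | hexagon₁ hk a b c =>
    apply MEq.eq
    refine MEq.trans ?_ (evalWord_conj o g _ _ _).symm
    refine (evalWord_braid o g _ _ _).trans ?_
    refine (braid_congr hk rfl (evalObj_append o b c)).trans ?_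
    refine (hexagon₁ hk _ _ _).trans ?_
    simp only [evalWord, evalWord_cast]
    refine MEq.comp ?_ (MEq.comp ?_ ?_)
    · exact MEq.trans (tensor_congr k (MEq.conj _ _ _).symm (MEq.refl _)) (MEq.conj _ _ _).symm
    · exact MEq.eqToHom _ _ (by rw [evalObj_append, evalObj_append])
    · exact MEq.trans (tensor_congr k (MEq.refl _) (MEq.conj _ _ _).symm) (MEq.conj _ _ _).symm
  | hexagon₂ hk a b c =>
    apply MEq.eq
    refine MEq.trans ?_ (evalWord_conj o g _ _ _).symm
    refine (evalWord_braid o g _ _ _).trans ?_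
    refine (braid_congr hk (evalObj_append o a b) rfl).trans ?_
    refine (hexagon₂ hk _ _ _).trans ?_
    simp only [evalWord, evalWord_cast]
    refine MEq.comp ?_ (MEq.comp ?_ ?_)
    · exact MEq.trans (tensor_congr k (MEq.refl _) (MEq.conj _ _ _).symm) (MEq.conj _ _ _).symm
    · exact MEq.eqToHom _ _ (by rw [evalObj_append, evalObj_append])
    · exact MEq.trans (tensor_congr k (MEq.conj _ _ _).symm (MEq.refl _)) (MEq.conj _ _ _).symm
  | symmetry hk hs a b =>
    simp [evalWord, reassoc_of% symmetry hk hs (evalObj o a) (evalObj o b)]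

variable
  (hg : ∀ {a b : List P.Ob} {f f' : Word k P.Gen a b}, P.Rel f f' →
    evalWord o g f = evalWord o g f')

/-- The functor induced by an interpretation of generators that respects the relations. -/
def lift : P.Carrier ⥤ X where
  obj a := evalObj o a.toList
  map f := Quot.lift (fun w => evalWord o g w) (fun _ _ h => evalWord_sound o g hg h) f
  map_id _ := rfl
  map_comp := by rintro a b c ⟨f⟩ ⟨f'⟩; rfl

theorem lift_strict : IsStrictFun k (lift o g hg) where
  map_one := rfl
  map_mul a b := evalObj_append o a.toList b.toList
  map_tensor := by
    rintro a b c d ⟨f⟩ ⟨f'⟩; exact evalWord_tensor o g f f'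
  map_braid hk a b := evalWord_braid o g hk a.toList b.toList

end Interp

section Ext

variable {X Y : Type*} [Category X] [StrictStr k X] [Category Y] [StrictStr k Y]

/-- Strict functors that agree on generators are equal. -/
theorem functor_ext {F G : P.Carrier ⥤ X} (hF : IsStrictFun k F) (hG : IsStrictFun k G)
    (ho : ∀ a : P.Ob, F.obj ⟨[a]⟩ = G.obj ⟨[a]⟩)
    (hg : ∀ {a b : List P.Ob} (x : P.Gen a b), MEq (F.map (P.gen x)) (G.map (P.gen x))) :
    F = G := by
  have ho' : ∀ l : List P.Ob, F.obj ⟨l⟩ = G.obj ⟨l⟩ := by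
    intro l
    induction l with
    | nil => exact hF.map_one.trans hG.map_one.symm
    | cons a l ih =>
      refine (hF.map_mul ⟨[a]⟩ ⟨l⟩).trans (Eq.trans ?_ (hG.map_mul ⟨[a]⟩ ⟨l⟩).symm)
      rw [ho, ih]
  have key : ∀ {a b : List P.Ob} (w : Word k P.Gen a b),
      MEq (F.map (P.hom w)) (G.map (P.hom w)) := by
    intro a b w
    induction w with
    | id a =>
      rw [hom_id, F.map_id, G.map_id]; exact MEq.eqToHom rfl rfl (ho' a)
    | comp f g hf hg =>
      rw [hom_comp, F.map_comp, G.map_comp]; exact hf.comp hg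
    | gen x => exact hg x
    | tensor f g hf hg =>
      exact (hF.map_tensor (P.hom f) (P.hom g)).trans
        ((tensor_congr k hf hg).trans (hG.map_tensor (P.hom f) (P.hom g)).symm)
    | braid hk a b =>
      exact (hF.map_braid hk ⟨a⟩ ⟨b⟩).trans
        ((braid_congr hk (ho' a) (ho' b)).trans (hG.map_braid hk ⟨a⟩ ⟨b⟩).symm)
    | braidInv hk a b =>
      exact (hF.map_braidInv hk ⟨a⟩ ⟨b⟩).trans
        ((braidInv_congr hk (ho' a) (ho' b)).trans (hG.map_braidInv hk ⟨a⟩ ⟨b⟩).symm)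
  refine CategoryTheory.Functor.ext (fun a => ho' a.toList) ?_
  rintro a b f
  obtain ⟨w, rfl⟩ := P.hom_surj f
  obtain ⟨_, _, h⟩ := key w
  exact h

/-- Monoidal transformations that agree on singletons agree. -/
theorem trans_ext {F G F' G' : P.Carrier ⥤ X} {θ : F ⟶ G} {θ' : F' ⟶ G'}
    (hθ : IsMonTrans k θ) (hθ' : IsMonTrans k θ')
    (h : ∀ a : P.Ob, MEq (θ.app ⟨[a]⟩) (θ'.app ⟨[a]⟩)) (l : P.Carrier) :
    MEq (θ.app l) (θ'.app l) := by
  obtain ⟨l⟩ := l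
  induction l with
  | nil => exact hθ.app_one.trans hθ'.app_one.symm
  | cons a l ih =>
    exact (hθ.app_mul ⟨[a]⟩ ⟨l⟩).trans
      ((tensor_congr k (h a) ih).trans (hθ'.app_mul ⟨[a]⟩ ⟨l⟩).symm)

section LiftTrans

variable {F G : P.Carrier ⥤ X} (hF : IsStrictFun k F) (hG : IsStrictFun k G)
  (t : ∀ a : P.Ob, F.obj ⟨[a]⟩ ⟶ G.obj ⟨[a]⟩)

/-- The components of the monoidal transformation with prescribed components at singletons. -/
def transApp : ∀ l : List P.Ob, F.obj ⟨l⟩ ⟶ G.obj ⟨l⟩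
  | [] => eqToHom (hF.map_one.trans hG.map_one.symm)
  | a :: l => eqToHom (hF.map_mul ⟨[a]⟩ ⟨l⟩) ≫ tensor (k := k) (t a) (transApp l) ≫
      eqToHom (hG.map_mul ⟨[a]⟩ ⟨l⟩).symm

theorem transApp_nil : MEq (transApp hF hG t []) (𝟙 (one k : X)) :=
  MEq.eqToHom _ rfl hF.map_one

theorem transApp_cons (a : P.Ob) (l : List P.Ob) :
    MEq (transApp hF hG t (a :: l)) (tensor (k := k) (t a) (transApp hF hG t l)) := MEq.conj _ _ _

theorem transApp_single (a : P.Ob) : MEq (transApp hF hG t [a]) (t a) :=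
  (transApp_cons hF hG t a []).trans
    ((tensor_congr k (MEq.refl _) (transApp_nil hF hG t)).trans (tensor_one _))

theorem transApp_append (a b : List P.Ob) :
    MEq (transApp hF hG t (a ++ b)) (tensor (k := k) (transApp hF hG t a) (transApp hF hG t b)) := by
  induction a with
  | nil =>
    exact (((tensor_congr k (transApp_nil hF hG t) (MEq.refl _)).trans (one_tensor _))).symm
  | cons x a ih =>
    exact (transApp_cons hF hG t x (a ++ b)).trans ((tensor_congr k (MEq.refl _) ih).trans
      ((StrictStr.tensor_assoc _ _ _).symm.trans
        (tensor_congr k (transApp_cons hF hG t x a).symm (MEq.refl _))))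

theorem transApp_naturality (ht : ∀ {a b : List P.Ob} (x : P.Gen a b),
      F.map (P.gen x) ≫ transApp hF hG t b = transApp hF hG t a ≫ G.map (P.gen x)) {a b : List P.Ob} (w : Word k P.Gen a b) :
    F.map (P.hom w) ≫ transApp hF hG t b = transApp hF hG t a ≫ G.map (P.hom w) := by
  have hbr : ∀ (hk : k ≠ Kind.plain) (a b : List P.Ob),
      F.map (P.hom (Word.braid hk a b)) ≫ transApp hF hG t (b ++ a) =
        transApp hF hG t (a ++ b) ≫ G.map (P.hom (Word.braid hk a b)) := by
    intro hk a b
    apply MEq.eq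
    refine (MEq.comp (hF.map_braid hk ⟨a⟩ ⟨b⟩) (transApp_append hF hG t b a)).trans ?_
    rw [← braid_nat]
    exact (MEq.comp (transApp_append hF hG t a b) (hG.map_braid hk ⟨a⟩ ⟨b⟩)).symm
  induction w with
  | id a => rw [hom_id, F.map_id, G.map_id, Category.id_comp, Category.comp_id]
  | comp f g hf hg =>
    rw [hom_comp, F.map_comp, G.map_comp, Category.assoc, hg, reassoc_of% hf]
  | gen x => exact ht x
  | tensor f g hf hg =>
    apply MEq.eq
    refine (MEq.comp (hF.map_tensor (P.hom f) (P.hom g)) (transApp_append hF hG t _ _)).trans ?_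
    rw [← tensor_comp, hf, hg, tensor_comp]
    exact (MEq.comp (transApp_append hF hG t _ _) (hG.map_tensor (P.hom f) (P.hom g))).symm
  | braid hk a b => exact hbr hk a b
  | braidInv hk a b =>
    have h := hbr hk a b
    have e (H : P.Carrier ⥤ X) : H.map (P.hom (Word.braid hk a b)) ≫
        H.map (P.hom (Word.braidInv hk a b)) = 𝟙 _ := by
      rw [← H.map_comp]
      exact (congrArg H.map (P.hom_sound (Eqv.braid_inv hk a b))).trans (H.map_id _)
    have e' (H : P.Carrier ⥤ X) : H.map (P.hom (Word.braidInv hk a b)) ≫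
        H.map (P.hom (Word.braid hk a b)) = 𝟙 _ := by
      rw [← H.map_comp]
      exact (congrArg H.map (P.hom_sound (Eqv.inv_braid hk a b))).trans (H.map_id _)
    have h2 := congrArg (fun z => F.map (P.hom (Word.braidInv hk a b)) ≫ z ≫
      G.map (P.hom (Word.braidInv hk a b))) h
    simpa [e G, reassoc_of% e' F] using h2.symm

variable (ht : ∀ {a b : List P.Ob} (x : P.Gen a b),
  F.map (P.gen x) ≫ transApp hF hG t b = transApp hF hG t a ≫ G.map (P.gen x))

/-- The monoidal transformation with prescribed components at singletons. -/
def liftTrans : F ⟶ G where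
  app l := transApp hF hG t l.toList
  naturality a b f := by
    obtain ⟨w, rfl⟩ := P.hom_surj f
    exact transApp_naturality hF hG t ht w

theorem liftTrans_mon : IsMonTrans k (liftTrans hF hG t ht) where
  app_one := transApp_nil hF hG t
  app_mul a b := transApp_append hF hG t a.toList b.toList

theorem liftTrans_single (a : P.Ob) : MEq ((liftTrans hF hG t ht).app ⟨[a]⟩) (t a) :=
  transApp_single hF hG t a

end LiftTrans
end Ext
end Presentation
/-! ## The 2-monads -/

section Free

variable (k : Kind) (C : Type u) [Category.{u} C]

/-- Generators of the free structure: the morphisms of `C`, as morphisms between 1-tuples. -/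
inductive FreeGen : List C → List C → Type u
  | of {a b : C} (f : a ⟶ b) : FreeGen [a] [b]

/-- Relations of the free structure: the inclusion of `C` is a functor. -/
inductive FreeRel : ∀ {a b : List C}, Word k (FreeGen C) a b → Word k (FreeGen C) a b → Prop
  | id (a : C) : FreeRel (Word.gen (FreeGen.of (𝟙 a))) (Word.id [a])
  | comp {a b c : C} (f : a ⟶ b) (g : b ⟶ c) :
      FreeRel (Word.gen (FreeGen.of (f ≫ g)))
        ((Word.gen (FreeGen.of f)).comp (Word.gen (FreeGen.of g)))

/-- The presentation of the free strict structure of kind `k` on `C`. -/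
def freePres : Presentation.{u} k where
  Ob := C
  Gen := FreeGen C
  Rel := FreeRel k C

/-- The free strict monoidal category (`k = plain`), permutative category (`k = symmetric`), or
braided strict monoidal category (`k = braided`) on `C`. -/
abbrev Free : Type u := (freePres k C).Carrier

namespace Free

variable {C}

/-- A tuple, as an object of the free structure. -/
abbrev tup (l : List C) : Free k C := Presentation.Carrier.tuple l

variable (C) in
/-- The inclusion of `C` as 1-tuples. -/
def unit : C ⥤ Free k C where
  obj a := tup k [a]
  map f := (freePres k C).gen (FreeGen.of f)
  map_id a := (freePres k C).hom_sound (Presentation.Eqv.rel (FreeRel.id a))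
  map_comp f g := (freePres k C).hom_sound (Presentation.Eqv.rel (FreeRel.comp f g))

variable {k}
variable {X Y : Type*} [Category X] [StrictStr k X] [Category Y] [StrictStr k Y]

/-- The value of `lift F` on generators. -/
def liftGen (F : C ⥤ X) : ∀ {a b : List C}, FreeGen C a b →
    (Presentation.evalObj (P := freePres k C) F.obj a ⟶
      Presentation.evalObj (P := freePres k C) F.obj b)
  | _, _, FreeGen.of f => eqToHom (StrictStr.mul_one _) ≫ F.map f ≫ eqToHom (StrictStr.mul_one _).symm

theorem lift_sound (F : C ⥤ X) {a b : List C} {f f' : Word k (FreeGen C) a b}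
    (h : FreeRel k C f f') :
    Presentation.evalWord (P := freePres k C) F.obj (liftGen F) f =
      Presentation.evalWord (P := freePres k C) F.obj (liftGen F) f' := by
  obtain (_ | _) := h
  · apply MEq.eq
    refine (MEq.conj _ _ _).trans ?_
    refine (MEq.of_eq (F.map_id _)).trans ?_
    exact MEq.eqToHom rfl rfl (StrictStr.mul_one _).symm
  · apply MEq.eq
    refine (MEq.conj _ _ _).trans ?_
    refine (MEq.of_eq (F.map_comp _ _)).trans ?_
    exact (MEq.comp (MEq.conj _ _ _) (MEq.conj _ _ _)).symm

/-- The strict functor on the free structure induced by a functor `F`: it sends a tuple to the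
product of the values of `F`. -/
def lift (F : C ⥤ X) : Free k C ⥤ X :=
  Presentation.lift (P := freePres k C) F.obj (liftGen F) (lift_sound F)

theorem lift_strict (F : C ⥤ X) : IsStrictFun k (lift (k := k) F) :=
  Presentation.lift_strict _ _ (lift_sound F)

theorem unit_lift (F : C ⥤ X) : unit k C ⋙ lift (k := k) F = F := by
  refine CategoryTheory.Functor.ext (fun a => StrictStr.mul_one _) ?_
  intro a b f
  rfl

theorem functor_ext {F G : Free k C ⥤ X} (hF : IsStrictFun k F) (hG : IsStrictFun k G)
    (h : unit k C ⋙ F = unit k C ⋙ G) : F = G := by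
  refine Presentation.functor_ext hF hG (fun a => Functor.congr_obj h a) ?_
  rintro _ _ ⟨f⟩
  exact MEq.of_functor_eq h f

theorem lift_comp (F : C ⥤ X) {G : X ⥤ Y} (hG : IsStrictFun k G) :
    lift (k := k) F ⋙ G = lift (F ⋙ G) := by
  refine functor_ext ((lift_strict F).comp hG) (lift_strict _) ?_
  rw [← Functor.assoc, unit_lift, unit_lift]

theorem lift_unit : lift (unit k C) = 𝟭 (Free k C) := by
  refine functor_ext (lift_strict _) IsStrictFun.id ?_
  rw [unit_lift]; rfl

theorem lift₂_aux {F G : Free k C ⥤ X} (hF : IsStrictFun k F) (hG : IsStrictFun k G)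
    (α : unit k C ⋙ F ⟶ unit k C ⋙ G) {a b : List C} (x : FreeGen C a b) :
    F.map ((freePres k C).gen x) ≫ Presentation.transApp hF hG (fun a => α.app a) b =
      Presentation.transApp hF hG (fun a => α.app a) a ≫ G.map ((freePres k C).gen x) := by
  obtain ⟨f⟩ := x
  apply MEq.eq
  refine (MEq.comp (MEq.refl _) (Presentation.transApp_single hF hG _ _)).trans ?_
  refine MEq.trans ?_ (MEq.comp (Presentation.transApp_single hF hG _ _).symm (MEq.refl _))
  exact MEq.of_eq (α.naturality f)

/-- The monoidal transformation induced by a transformation of restrictions along `unit`. -/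
def lift₂ {F G : Free k C ⥤ X} (hF : IsStrictFun k F) (hG : IsStrictFun k G)
    (α : unit k C ⋙ F ⟶ unit k C ⋙ G) : F ⟶ G :=
  Presentation.liftTrans hF hG (fun a => α.app a) (lift₂_aux hF hG α)

theorem lift₂_mon {F G : Free k C ⥤ X} (hF : IsStrictFun k F) (hG : IsStrictFun k G)
    (α : unit k C ⋙ F ⟶ unit k C ⋙ G) : IsMonTrans k (lift₂ hF hG α) :=
  Presentation.liftTrans_mon _ _ _ (lift₂_aux hF hG α)

theorem lift₂_unit {F G : Free k C ⥤ X} (hF : IsStrictFun k F) (hG : IsStrictFun k G)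
    (α : unit k C ⋙ F ⟶ unit k C ⋙ G) (a : C) :
    MEq ((lift₂ hF hG α).app ((unit k C).obj a)) (α.app a) :=
  Presentation.liftTrans_single _ _ _ (lift₂_aux hF hG α) _

theorem trans_ext {F G F' G' : Free k C ⥤ X} {θ : F ⟶ G} {θ' : F' ⟶ G'}
    (hθ : IsMonTrans k θ) (hθ' : IsMonTrans k θ')
    (h : ∀ a : C, MEq (θ.app ((unit k C).obj a)) (θ'.app ((unit k C).obj a))) (l : Free k C) :
    MEq (θ.app l) (θ'.app l) := Presentation.trans_ext hθ hθ' h l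

variable (k)
variable {D E : Type u} [Category.{u} D] [Category.{u} E]

/-- Functoriality of the free structure: `F` is applied to the entries of tuples. -/
def map (F : C ⥤ D) : Free k C ⥤ Free k D := lift (F ⋙ unit k D)

theorem map_strict (F : C ⥤ D) : IsStrictFun k (map k F) := lift_strict _

theorem unit_map (F : C ⥤ D) : unit k C ⋙ map k F = F ⋙ unit k D := unit_lift _

theorem map_id : map k (𝟭 C) = 𝟭 (Free k C) := lift_unit

theorem map_comp (F : C ⥤ D) (G : D ⥤ E) : map k (F ⋙ G) = map k F ⋙ map k G := by
  unfold map
  rw [lift_comp _ (lift_strict _), Functor.assoc, Functor.assoc, unit_lift]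

/-- The transformation of free structures whose components are the tuples of components. -/
def map₂ {F G : C ⥤ D} (α : F ⟶ G) : map k F ⟶ map k G :=
  lift₂ (map_strict k F) (map_strict k G)
    (eqToHom (unit_map k F) ≫ Functor.whiskerRight α (unit k D) ≫ eqToHom (unit_map k G).symm)

theorem map₂_mon {F G : C ⥤ D} (α : F ⟶ G) : IsMonTrans k (map₂ k α) := lift₂_mon _ _ _

theorem map₂_unit {F G : C ⥤ D} (α : F ⟶ G) (a : C) :
    MEq ((map₂ k α).app ((unit k C).obj a)) ((unit k D).map (α.app a)) := by
  refine (lift₂_unit _ _ _ _).trans ?_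
  simp only [NatTrans.comp_app, eqToHom_app, Functor.whiskerRight_app]
  exact MEq.conj _ _ _

theorem trans_eq {F G : Free k C ⥤ X} {θ θ' : F ⟶ G}
    (hθ : IsMonTrans k θ) (hθ' : IsMonTrans k θ')
    (h : ∀ a : C, MEq (θ.app ((unit k C).obj a)) (θ'.app ((unit k C).obj a))) : θ = θ' :=
  NatTrans.ext (funext fun l => (trans_ext hθ hθ' h l).eq)

theorem map₂_id (F : C ⥤ D) : map₂ k (𝟙 F) = 𝟙 (map k F) := by
  refine trans_eq k (map₂_mon k _) (IsMonTrans.id (map_strict k F)) fun a => ?_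
  refine (map₂_unit k _ a).trans ?_
  refine (MEq.of_eq (CategoryTheory.Functor.map_id (unit k D) (F.obj a))).trans ?_
  exact MEq.eqToHom rfl rfl (Functor.congr_obj (unit_map k F) a).symm

theorem map₂_comp {F G H : C ⥤ D} (α : F ⟶ G) (β : G ⟶ H) :
    map₂ k (α ≫ β) = map₂ k α ≫ map₂ k β := by
  refine trans_eq k (map₂_mon k _) ((map₂_mon k α).comp (map₂_mon k β)) fun a => ?_
  refine (map₂_unit k _ a).trans ?_
  rw [NatTrans.comp_app, Functor.map_comp]
  exact MEq.comp (map₂_unit k α a).symm (map₂_unit k β a).symm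

theorem map₂_whiskerLeft (F : C ⥤ D) {G H : D ⥤ E} (α : G ⟶ H) (l : Free k C) :
    MEq ((map₂ k (F.whiskerLeft α)).app l) ((map₂ k α).app ((map k F).obj l)) := by
  refine trans_ext (map₂_mon k _) ((map₂_mon k α).whiskerLeft (map_strict k F)) (fun a => ?_) l
  refine (map₂_unit k _ a).trans ?_
  refine (map₂_unit k α (F.obj a)).symm.trans ?_
  exact MEq.app _ (Functor.congr_obj (unit_map k F) a).symm

theorem map₂_whiskerRight {F G : C ⥤ D} (α : F ⟶ G) (H : D ⥤ E) (l : Free k C) :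
    MEq ((map₂ k (Functor.whiskerRight α H)).app l) ((map k H).map ((map₂ k α).app l)) := by
  refine trans_ext (map₂_mon k _) ((map₂_mon k α).whiskerRight (map_strict k H)) (fun a => ?_) l
  refine (map₂_unit k _ a).trans ?_
  refine MEq.trans ?_ ((map₂_unit k α a).symm.map (map k H))
  exact (MEq.of_functor_eq (unit_map k H) (α.app a)).symm

variable (C) in
/-- Concatenation of tuples of tuples. -/
def mult : Free k (Free k C) ⥤ Free k C := lift (𝟭 _)

theorem unit_mult : unit k (Free k C) ⋙ mult k C = 𝟭 _ := unit_lift _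

theorem mult_strict : IsStrictFun k (mult k C) := lift_strict _

theorem map_unit_mult : map k (unit k C) ⋙ mult k C = 𝟭 _ := by
  unfold map mult
  rw [lift_comp _ (lift_strict _), Functor.assoc, unit_lift, Functor.comp_id, lift_unit]

theorem map_lift (F : C ⥤ D) (G : D ⥤ X) : map k F ⋙ lift (k := k) G = lift (F ⋙ G) := by
  unfold map
  rw [lift_comp _ (lift_strict _), Functor.assoc, unit_lift]

/-- Evaluation of tuples in a strict structure. -/
def ev (X : Type u) [Category.{u} X] [StrictStr k X] : Free k X ⥤ X := lift (𝟭 X)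

theorem ev_nat {X Y : Type u} [Category.{u} X] [Category.{u} Y] [StrictStr k X] [StrictStr k Y]
    {F : X ⥤ Y} (hF : IsStrictFun k F) : map k F ⋙ ev k Y = ev k X ⋙ F := by
  unfold ev
  rw [map_lift, lift_comp _ hF]; rfl

end Free

/-- Transformations with equal components. -/
theorem natTrans_eq {X Y : Type*} [Category X] [Category Y] {F G F' G' : X ⥤ Y} (θ : F ⟶ G)
    (θ' : F' ⟶ G') (h : F = F') (h' : G' = G) (e : ∀ a, MEq (θ.app a) (θ'.app a)) :
    θ = eqToHom h ≫ θ' ≫ eqToHom h' := by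
  subst h; subst h'
  ext a
  simpa using (e a).eq

/-- The 2-functor underlying the 2-monad. -/
def freeFunctor : StrictPseudofunctor Cat.{u, u} Cat.{u, u} :=
  StrictPseudofunctor.mk''
    { obj := fun C => Cat.of (Free k C)
      map := fun F => (Free.map k F.toFunctor).toCatHom
      map₂ := fun α => (Free.map₂ k α.toNatTrans).toCatHom₂
      map_id := fun C => Cat.ext (Free.map_id k)
      map_comp := fun F G => Cat.ext (Free.map_comp k F.toFunctor G.toFunctor)
      map₂_id := fun F => Cat.Hom₂.ext (Free.map₂_id k F.toFunctor)
      map₂_comp := fun α β => Cat.Hom₂.ext (Free.map₂_comp k α.toNatTrans β.toNatTrans)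
      map₂_whisker_left := fun F G H α => Cat.Hom₂.ext (by
        simp only [Cat.Hom.toNatTrans_comp, Cat.Hom₂.eqToHom_toNatTrans]
        exact natTrans_eq _ _ _ _ (Free.map₂_whiskerLeft k F.toFunctor α.toNatTrans))
      map₂_whisker_right := fun α H => Cat.Hom₂.ext (by
        simp only [Cat.Hom.toNatTrans_comp, Cat.Hom₂.eqToHom_toNatTrans]
        exact natTrans_eq _ _ _ _ (Free.map₂_whiskerRight k α.toNatTrans H.toFunctor)) }

/-- The 2-monad on `Cat` whose algebras are strict monoidal categories (`k = plain`), permutative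
categories (`k = symmetric`), or braided strict monoidal categories (`k = braided`). -/
def monad : TwoMonad Cat.{u, u} where
  T := freeFunctor k
  η C := (Free.unit k C).toCatHom
  η_nat F := Cat.ext (Free.unit_map k F.toFunctor).symm
  η_nat₂ {C D F G} α := Cat.Hom₂.ext (by
    simp only [Cat.Hom.toNatTrans_comp, Cat.Hom₂.eqToHom_toNatTrans]
    exact natTrans_eq _ _ _ _ (fun a => (Free.map₂_unit k α.toNatTrans a).symm))
  μ C := (Free.mult k C).toCatHom
  μ_nat {C D} F := Cat.ext (Free.ev_nat k (X := Free k C) (Y := Free k D)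
    (Free.map_strict k F.toFunctor))
  μ_nat₂ {C D F G} α := Cat.Hom₂.ext (by
    simp only [Cat.Hom.toNatTrans_comp, Cat.Hom₂.eqToHom_toNatTrans]
    refine natTrans_eq _ _ _ _ (fun l => ?_)
    refine Free.trans_ext ((Free.map₂_mon k (Free.map₂ k α.toNatTrans)).whiskerRight
      (Free.mult_strict k)) ((Free.map₂_mon k α.toNatTrans).whiskerLeft (Free.mult_strict k))
      (fun a => ?_) l
    refine ((Free.map₂_unit k _ a).map (Free.mult k D)).trans ?_
    refine MEq.trans (MEq.of_functor_eq (Free.unit_mult k (C := D))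
      ((Free.map₂ k α.toNatTrans).app a)) ?_
    exact MEq.app (Free.map₂ k α.toNatTrans) (Functor.congr_obj (Free.unit_mult k (C := C)) a).symm)
  left_unit C := Cat.ext (Free.unit_mult k)
  right_unit C := Cat.ext (Free.map_unit_mult k)
  assoc C := Cat.ext (Free.ev_nat k (X := Free k (Free k C)) (Y := Free k C) (Free.mult_strict k))

/-- The algebra over the 2-monad given by a strict structure on a category: tuples are sent to their
products. -/
def algebraOf (X : Type u) [Category.{u} X] [StrictStr k X] : Algebra (monad.{u} k) where
  X := Cat.of X
  x := (Free.ev k X).toCatHom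
  unit := Cat.ext (Free.unit_lift (𝟭 X))
  mult := Cat.ext (Free.ev_nat k (X := Free k X) (Y := X) (Free.lift_strict _))

end Free
/-! ## The construction `Q` -/

section Prod

variable {k : Kind} (A : Algebra (monad.{u} k))

/-- The action `t ↦ t_•` of the 2-monad on the underlying category of an algebra. -/
def act : Free k A.X ⥤ A.X := A.x.toFunctor

theorem unit_act : Free.unit k A.X ⋙ act A = 𝟭 A.X := congrArg Cat.Hom.toFunctor A.unit

theorem map_act : Free.map k (act A) ⋙ act A = Free.mult k A.X ⋙ act A :=
  congrArg Cat.Hom.toFunctor A.mult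

/-- The product `a_•` of a tuple of objects of an algebra. -/
def prod (a : List A.X) : A.X := (act A).obj (Free.tup k a)

theorem prod_single (a : A.X) : prod A [a] = a := Functor.congr_obj (unit_act A) a

theorem evalObj_single {P : Presentation.{u} k} {O : Presentation.{u} k} (F : O.Ob → P.Ob)
    (l : List O.Ob) :
    Presentation.evalObj (P := O) (fun a => (Presentation.Carrier.tuple [F a] : P.Carrier)) l =
      Presentation.Carrier.tuple (l.map F) := by
  induction l with
  | nil => rfl
  | cons a l ih => rw [Presentation.evalObj, ih]; rfl

theorem Free.map_obj {C D : Type u} [Category.{u} C] [Category.{u} D] (F : C ⥤ D) (l : List C) :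
    (Free.map k F).obj (Free.tup k l) = Free.tup k (l.map F.obj) :=
  evalObj_single (P := freePres k D) (O := freePres k C) F.obj l

theorem prod_insert (a b c : List A.X) :
    prod A (a ++ ([prod A b] ++ c)) = prod A (a ++ (b ++ c)) := by
  have h := Functor.congr_obj (map_act A) (mul k ((Free.map k (Free.unit k A.X)).obj (Free.tup k a))
    (mul k (Free.tup k [Free.tup k b]) ((Free.map k (Free.unit k A.X)).obj (Free.tup k c))))
  have e1 (l : List A.X) : (Free.map k (act A)).obj ((Free.map k (Free.unit k A.X)).obj
      (Free.tup k l)) = Free.tup k l := by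
    rw [← Functor.comp_obj, ← Free.map_comp, unit_act, Free.map_id]; rfl
  have e2 (l : List A.X) : (Free.mult k A.X).obj ((Free.map k (Free.unit k A.X)).obj
      (Free.tup k l)) = Free.tup k l := Functor.congr_obj (Free.map_unit_mult k) _
  rw [Functor.comp_obj, Functor.comp_obj, (Free.map_strict k _).map_mul,
    (Free.map_strict k _).map_mul, (Free.mult_strict k).map_mul, (Free.mult_strict k).map_mul,
    e1, e1, e2, e2] at h
  refine Eq.trans ?_ (h.trans ?_)
  · rfl
  · rw [show (Free.mult k A.X).obj (Free.tup k [Free.tup k b]) = Free.tup k b from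
      Functor.congr_obj (Free.unit_mult k) _]; rfl

theorem prod_insert_left (b c : List A.X) : prod A ([prod A b] ++ c) = prod A (b ++ c) :=
  prod_insert A [] b c

theorem prod_insert_right (a b : List A.X) : prod A (a ++ [prod A b]) = prod A (a ++ b) := by
  simpa using prod_insert A a b []

end Prod

theorem StrictStr.tensor_comp_right {k : Kind} {X : Type*} [Category X] [StrictStr k X]
    (a : X) {b b' b'' z : X} (f : b ⟶ b') (g : b' ⟶ b'') (h : mul k a b'' ⟶ z) :
    MEq (tensor (k := k) (𝟙 a) f ≫ tensor (k := k) (𝟙 a) g ≫ h)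
      (tensor (k := k) (𝟙 a) (f ≫ g) ≫ h) := by
  refine MEq.of_eq ?_
  rw [← Category.assoc, ← tensor_comp, Category.comp_id]

theorem Presentation.meq_of_comp_cast {k : Kind} (P : Presentation.{u} k) {a b c : List P.Ob}
    {w : Word k P.Gen a c} {w' : Word k P.Gen a b} {h : b = c}
    (e : P.Eqv w (w'.comp (Word.cast h))) : MEq (P.hom w) (P.hom w') := by
  refine MEq.trans (MEq.of_eq (P.hom_sound e)) ?_
  rw [hom_comp, hom_cast]; exact MEq.right _ _

theorem Presentation.meq_of_cast {k : Kind} (P : Presentation.{u} k) {a b : List P.Ob}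
    {w : Word k P.Gen a b} {h : a = b}
    (e : P.Eqv w (Word.cast h)) : MEq (P.hom w) (𝟙 (Carrier.tuple a)) := by
  refine MEq.trans (MEq.of_eq (P.hom_sound e)) ?_
  rw [hom_cast]; exact MEq.eqToHom _ rfl rfl

section QA

variable {k : Kind} (A : Algebra (monad.{u} k))

/-- Generating morphisms of `Q A`: free morphisms `t`, adjoined morphisms `q_⟨a⟩ : ⟨a⟩ ⟶ (a_•)`,
and their inverses. -/
inductive QGen : List A.X → List A.X → Type u
  | free {a b : List A.X} (t : Free.tup k a ⟶ Free.tup k b) : QGen a b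
  | q (a : List A.X) : QGen a [prod A a]
  | qInv (a : List A.X) : QGen [prod A a] a

/-- Relations of `Q A`: free morphisms compose, tensor and braid as in `T A` (`free_*`), `qInv` is
inverse to `q`, `q` is natural in free morphisms (`nat`), associative (`assoc_*`) and normal
(`norm`). The identity words `Word.cast` identify equal products, for example of
`⟨a⟩;(b_•)` and of `⟨a⟩;⟨b⟩`. -/
inductive QRel : ∀ {a b : List A.X}, Word k (QGen A) a b → Word k (QGen A) a b → Prop
  | free_id (a : List A.X) : QRel (Word.gen (QGen.free (𝟙 (Free.tup k a)))) (Word.id a)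
  | free_comp {a b c : List A.X} (t : Free.tup k a ⟶ Free.tup k b)
      (t' : Free.tup k b ⟶ Free.tup k c) :
      QRel (Word.gen (QGen.free (t ≫ t')))
        ((Word.gen (QGen.free t)).comp (Word.gen (QGen.free t')))
  | free_tensor {a b c d : List A.X} (t : Free.tup k a ⟶ Free.tup k b)
      (t' : Free.tup k c ⟶ Free.tup k d) :
      QRel (Word.gen (QGen.free (a := a ++ c) (b := b ++ d) (tensor (k := k) t t')))
        ((Word.gen (QGen.free t)).tensor (Word.gen (QGen.free t')))
  | free_braid (hk : k ≠ Kind.plain) (a b : List A.X) :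
      QRel (Word.gen (QGen.free (a := a ++ b) (b := b ++ a)
        (braid hk (Free.tup k a) (Free.tup k b)))) (Word.braid hk a b)
  | q_inv (a : List A.X) :
      QRel ((Word.gen (QGen.q a)).comp (Word.gen (QGen.qInv a))) (Word.id a)
  | inv_q (a : List A.X) :
      QRel ((Word.gen (QGen.qInv a)).comp (Word.gen (QGen.q a))) (Word.id [prod A a])
  | nat {a b : List A.X} (t : Free.tup k a ⟶ Free.tup k b) :
      QRel ((Word.gen (QGen.free t)).comp (Word.gen (QGen.q b)))
        ((Word.gen (QGen.q a)).comp
          (Word.gen (QGen.free ((Free.unit k A.X).map ((act A).map t)))))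
  | assoc_unit (a b : List A.X) :
      QRel (((Word.id a).tensor ((Word.gen (QGen.q [])).tensor (Word.id b))).comp
          (Word.gen (QGen.q (a ++ ([prod A []] ++ b)))))
        ((Word.gen (QGen.q (a ++ b))).comp
          (Word.cast (congrArg (fun x => [x]) (prod_insert A a [] b).symm)))
  | assoc_right (a b : List A.X) :
      QRel (((Word.id a).tensor (Word.gen (QGen.q b))).comp
          (Word.gen (QGen.q (a ++ [prod A b]))))
        ((Word.gen (QGen.q (a ++ b))).comp
          (Word.cast (congrArg (fun x => [x]) (prod_insert_right A a b).symm)))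
  | assoc_left (a b : List A.X) :
      QRel (((Word.gen (QGen.q a)).tensor (Word.id b)).comp
          (Word.gen (QGen.q ([prod A a] ++ b))))
        ((Word.gen (QGen.q (a ++ b))).comp
          (Word.cast (congrArg (fun x => [x]) (prod_insert_left A a b).symm)))
  | norm (a : A.X) :
      QRel (Word.gen (QGen.q [a])) (Word.cast (congrArg (fun x => [x]) (prod_single A a).symm))

/-- The presentation of `Q A`. -/
def QPres : Presentation.{u} k where
  Ob := A.X
  Gen := QGen A
  Rel := QRel A

/-- The underlying category of `Q A`. -/
abbrev QCat : Type u := (QPres A).Carrier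

/-- A tuple, as an object of `Q A`. -/
abbrev qtup (a : List A.X) : QCat A := Presentation.Carrier.tuple a

/-- The inclusion of free morphisms. -/
def iota : Free k A.X ⥤ QCat A where
  obj a := qtup A a.toList
  map t := (QPres A).gen (QGen.free t)
  map_id a := (QPres A).hom_sound (Presentation.Eqv.rel (QRel.free_id a.toList))
  map_comp t t' := (QPres A).hom_sound (Presentation.Eqv.rel (QRel.free_comp t t'))

/-- The adjoined isomorphism `q_⟨a⟩`. -/
def q (a : List A.X) : qtup A a ≅ qtup A [prod A a] where
  hom := (QPres A).gen (QGen.q a)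
  inv := (QPres A).gen (QGen.qInv a)
  hom_inv_id := (QPres A).hom_sound (Presentation.Eqv.rel (QRel.q_inv a))
  inv_hom_id := (QPres A).hom_sound (Presentation.Eqv.rel (QRel.inv_q a))

theorem iota_strict : IsStrictFun k (iota A) where
  map_one := rfl
  map_mul _ _ := rfl
  map_tensor t t' :=
    MEq.of_eq ((QPres A).hom_sound (Presentation.Eqv.rel (QRel.free_tensor t t')))
  map_braid hk a b := MEq.of_eq
    ((QPres A).hom_sound (Presentation.Eqv.rel (QRel.free_braid hk a.toList b.toList)))

/-- A morphism of `A`, as a free morphism between 1-tuples. -/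
def single : A.X ⥤ QCat A := Free.unit k A.X ⋙ iota A

theorem q_nat {a b : List A.X} (t : Free.tup k a ⟶ Free.tup k b) :
    (iota A).map t ≫ (q A b).hom = (q A a).hom ≫ (single A).map ((act A).map t) :=
  (QPres A).hom_sound (Presentation.Eqv.rel (QRel.nat t))

theorem q_norm (a : A.X) : MEq (q A [a]).hom (𝟙 (qtup A [a])) :=
  (QPres A).meq_of_cast (Presentation.Eqv.rel (QRel.norm a))

theorem q_right (a b : List A.X) :
    MEq (tensor (k := k) (𝟙 (qtup A a)) (q A b).hom ≫ (q A (a ++ [prod A b])).hom)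
      (q A (a ++ b)).hom :=
  (QPres A).meq_of_comp_cast (Presentation.Eqv.rel (QRel.assoc_right a b))

theorem q_left (a b : List A.X) :
    MEq (tensor (k := k) (q A a).hom (𝟙 (qtup A b)) ≫ (q A ([prod A a] ++ b)).hom)
      (q A (a ++ b)).hom :=
  (QPres A).meq_of_comp_cast (Presentation.Eqv.rel (QRel.assoc_left a b))

theorem q_congr {a b : List A.X} (h : a = b) : MEq (q A a).hom (q A b).hom := by
  subst h; exact MEq.refl _

theorem q_insert (a b c : List A.X) :
    MEq (tensor (k := k) (𝟙 (qtup A a)) (tensor (k := k) (q A b).hom (𝟙 (qtup A c))) ≫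
        (q A (a ++ ([prod A b] ++ c))).hom)
      (q A (a ++ (b ++ c))).hom := by
  refine (MEq.comp (MEq.refl _) (q_right A a ([prod A b] ++ c)).symm).trans ?_
  refine (StrictStr.tensor_comp_right _ _ _ _).trans ?_
  refine (MEq.comp (tensor_congr k (MEq.refl _) (q_left A b c))
    (q_congr A (congrArg (fun x => a ++ [x]) (prod_insert_left A b c)))).trans ?_
  exact q_right A a (b ++ c)

end QA
theorem MEq.app_conj {X Y : Type*} [Category X] [Category Y] {F G H H' K K' : X ⥤ Y} (h : F = G)
    (θ : G ⟶ H) (e : H = H') (θ' : H' ⟶ K) (h' : K = K') (a : X) :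
    MEq ((CategoryTheory.eqToHom h ≫ θ ≫ CategoryTheory.eqToHom e ≫ θ' ≫
        CategoryTheory.eqToHom h').app a)
      (θ.app a ≫ CategoryTheory.eqToHom (Functor.congr_obj e a) ≫ θ'.app a) := by
  subst h; subst e; subst h'; exact MEq.of_eq (by simp)

section QMap

variable {k : Kind} {A B : Algebra (monad.{u} k)} (f : TMap A B)

/-- The underlying functor of a T-map. -/
def fn : A.X ⥤ B.X := f.f.toFunctor

/-- The algebra constraint of a T-map. -/
def con : Free.map k (fn f) ⋙ act B ≅ act A ⋙ fn f where
  hom := f.con.hom.toNatTrans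
  inv := f.con.inv.toNatTrans
  hom_inv_id := congrArg Cat.Hom₂.toNatTrans f.con.hom_inv_id
  inv_hom_id := congrArg Cat.Hom₂.toNatTrans f.con.inv_hom_id

theorem con_unit (a : A.X) :
    MEq ((con f).hom.app ((Free.unit k A.X).obj a)) (𝟙 ((fn f).obj a)) := by
  have h := congrArg (fun z => z.toNatTrans.app a) f.unit
  simp only [Cat.Hom₂.eqToHom_toNatTrans, eqToHom_app] at h
  refine MEq.trans (MEq.of_eq h) ?_
  exact MEq.eqToHom _ rfl ((congrArg (act B).obj (Functor.congr_obj (Free.unit_map k (fn f)) a)).trans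
    (prod_single B _))

theorem con_mult (L : Free k (Free k A.X)) :
    MEq ((con f).hom.app ((Free.mult k A.X).obj L))
      ((act B).map ((Free.map₂ k (con f).hom).app L) ≫
        eqToHom (congrArg (act B).obj (Functor.congr_obj (Free.map_comp k (act A) (fn f)) L)) ≫
        (con f).hom.app ((Free.map k (act A)).obj L)) := by
  have h := congrArg (fun z => z.toNatTrans.app L) f.mult
  simp only [Cat.Hom₂.eqToHom_toNatTrans, Cat.Hom.toNatTrans_comp] at h
  exact MEq.trans (MEq.of_eq h) (MEq.app_conj _ _ _ _ _ _)

theorem con_nat {a b : Free k A.X} (t : a ⟶ b) :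
    (act B).map ((Free.map k (fn f)).map t) ≫ (con f).hom.app b =
      (con f).hom.app a ≫ (fn f).map ((act A).map t) := (con f).hom.naturality t

/-- `f` applied to the entries of a tuple. -/
abbrev mapTup (a : List A.X) : List B.X := ((Free.map k (fn f)).obj (Free.tup k a)).toList

theorem map₂_con_unit (a : Free k A.X) :
    MEq ((Free.map₂ k (con f).hom).app ((Free.map k (Free.unit k A.X)).obj a))
      (𝟙 ((Free.map k (fn f)).obj a)) := by
  refine (Free.map₂_whiskerLeft k (Free.unit k A.X) (con f).hom a).symm.trans ?_
  refine Free.trans_ext (Free.map₂_mon k _) (IsMonTrans.id (Free.map_strict k (fn f)))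
    (fun x => ?_) a
  refine (Free.map₂_unit k _ x).trans ?_
  refine ((con_unit f x).map (Free.unit k B.X)).trans ?_
  rw [CategoryTheory.Functor.map_id]
  exact MEq.eqToHom rfl rfl (Functor.congr_obj (Free.unit_map k (fn f)) x).symm

/-- The constraint is compatible with insertion of products. -/
theorem con_insert (a b c : List A.X)
    (e : (act B).obj (mul k ((Free.map k (fn f)).obj (Free.tup k a))
        (mul k ((Free.unit k B.X).obj ((fn f).obj (prod A b)))
          ((Free.map k (fn f)).obj (Free.tup k c)))) =
      (act B).obj ((Free.map k (fn f)).obj (Free.tup k (a ++ ([prod A b] ++ c))))) :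
    MEq ((act B).map (tensor (k := k) (𝟙 ((Free.map k (fn f)).obj (Free.tup k a)))
        (tensor (k := k) ((Free.unit k B.X).map ((con f).hom.app (Free.tup k b)))
          (𝟙 ((Free.map k (fn f)).obj (Free.tup k c))))) ≫
        eqToHom e ≫ (con f).hom.app (Free.tup k (a ++ ([prod A b] ++ c))))
      ((con f).hom.app (Free.tup k (a ++ (b ++ c)))) := by
  let L : Free k (Free k A.X) := mul k ((Free.map k (Free.unit k A.X)).obj (Free.tup k a))
    (mul k ((Free.unit k (Free k A.X)).obj (Free.tup k b))
      ((Free.map k (Free.unit k A.X)).obj (Free.tup k c)))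
  have e1 (l : List A.X) : (Free.map k (act A)).obj ((Free.map k (Free.unit k A.X)).obj
      (Free.tup k l)) = Free.tup k l := by
    rw [← Functor.comp_obj, ← Free.map_comp, unit_act, Free.map_id]; rfl
  have e2 (l : List A.X) : (Free.mult k A.X).obj ((Free.map k (Free.unit k A.X)).obj
      (Free.tup k l)) = Free.tup k l := Functor.congr_obj (Free.map_unit_mult k) _
  have e3 : (Free.mult k A.X).obj ((Free.unit k (Free k A.X)).obj (Free.tup k b)) =
      Free.tup k b := Functor.congr_obj (Free.unit_mult k) _
  have h1 : (Free.mult k A.X).obj L = Free.tup k (a ++ (b ++ c)) := by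
    rw [(Free.mult_strict k).map_mul, (Free.mult_strict k).map_mul, e2, e2, e3]; rfl
  have h2 : (Free.map k (act A)).obj L = Free.tup k (a ++ ([prod A b] ++ c)) := by
    rw [(Free.map_strict k _).map_mul, (Free.map_strict k _).map_mul, e1, e1]; rfl
  refine MEq.trans ?_ (MEq.app (con f).hom h1)
  refine MEq.trans ?_ (con_mult f L).symm
  refine MEq.comp (MEq.map (act B) ?_) (MEq.comp (MEq.eqToHom _ _ ?_) (MEq.app (con f).hom h2).symm)
  · have hm := Free.map₂_mon k (con f).hom
    refine MEq.trans ?_ (hm.app_mul _ _).symm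
    refine tensor_congr k (map₂_con_unit f _).symm ?_
    refine MEq.trans ?_ (hm.app_mul _ _).symm
    refine tensor_congr k ?_ (map₂_con_unit f _).symm
    exact (Free.map₂_unit k (con f).hom (Free.tup k b)).symm
  · refine e.trans ?_
    rw [Free.map_comp, Functor.comp_obj, h2]

end QMap
theorem StrictStr.tensor_split {k : Kind} {X : Type*} [Category X] [StrictStr k X]
    (a c : X) {b b' b'' : X} (f : b ⟶ b') (g : b' ⟶ b'') :
    tensor (k := k) (𝟙 a) (tensor (k := k) (f ≫ g) (𝟙 c)) =
      tensor (k := k) (𝟙 a) (tensor (k := k) f (𝟙 c)) ≫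
        tensor (k := k) (𝟙 a) (tensor (k := k) g (𝟙 c)) := by
  rw [← tensor_comp, ← tensor_comp, Category.comp_id, Category.comp_id]

section QMap

variable {k : Kind} {A B : Algebra (monad.{u} k)} (f : TMap A B)

/-- The composite `(f_•) ∘ q_⟨f a⟩`, which is the value of `Q f` at `q_⟨a⟩`. -/
def qMap (a : List A.X) :
    qtup B (mapTup f a) ≅ qtup B [(fn f).obj (prod A a)] :=
  q B (mapTup f a) ≪≫ (single B).mapIso ((con f).app (Free.tup k a))

theorem qMap_congr {a b : List A.X} (h : a = b) : MEq (qMap f a).hom (qMap f b).hom := by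
  subst h; exact MEq.refl _

theorem mapTup_append (a b : List A.X) : mapTup f (a ++ b) = mapTup f a ++ mapTup f b :=
  congrArg Presentation.Carrier.toList ((Free.map_strict k (fn f)).map_mul _ _)

theorem mapTup_single (a : A.X) : mapTup f [a] = [(fn f).obj a] := rfl

theorem mapTup_insert (a b c : List A.X) :
    mapTup f a ++ ([(fn f).obj (prod A b)] ++ mapTup f c) =
      mapTup f (a ++ ([prod A b] ++ c)) := by
  rw [mapTup_append, mapTup_append, mapTup_single]

theorem qMap_nat {a b : List A.X} (t : Free.tup k a ⟶ Free.tup k b) :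
    (iota B).map ((Free.map k (fn f)).map t) ≫ (qMap f b).hom =
      (qMap f a).hom ≫ (single B).map ((fn f).map ((act A).map t)) := by
  have h1 := q_nat B (a := mapTup f a) (b := mapTup f b) ((Free.map k (fn f)).map t)
  have h2 := congrArg (single B).map (con_nat f t)
  rw [CategoryTheory.Functor.map_comp, CategoryTheory.Functor.map_comp] at h2
  refine (Category.assoc _ _ _).symm.trans ?_
  refine (congrArg (fun z => z ≫ (single B).map ((con f).hom.app (Free.tup k b))) h1).trans ?_
  refine (Category.assoc _ _ _).trans ?_
  refine (congrArg (fun z => (q B (mapTup f a)).hom ≫ z) h2).trans ?_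
  exact (Category.assoc _ _ _).symm

theorem qMap_norm (a : A.X) : MEq (qMap f [a]).hom (𝟙 (qtup B [(fn f).obj a])) := by
  have h1 := q_norm B ((fn f).obj a)
  have h2 := (con_unit f a).map (single B)
  rw [CategoryTheory.Functor.map_id] at h2
  refine (MEq.comp h1 h2).trans ?_
  exact MEq.of_eq (Category.comp_id _)

theorem qMap_insert (a b c : List A.X)
    (hl : mapTup f a ++ ([(fn f).obj (prod A b)] ++ mapTup f c) =
      mapTup f (a ++ ([prod A b] ++ c))) :
    MEq (tensor (k := k) (𝟙 (qtup B (mapTup f a)))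
        (tensor (k := k) (qMap f b).hom (𝟙 (qtup B (mapTup f c)))) ≫ eqToHom (congrArg (qtup B) hl) ≫
        (qMap f (a ++ ([prod A b] ++ c))).hom)
      (qMap f (a ++ (b ++ c))).hom := by
  let T : Free.tup k (mapTup f a ++ ([prod B (mapTup f b)] ++ mapTup f c)) ⟶
      Free.tup k (mapTup f a ++ ([(fn f).obj (prod A b)] ++ mapTup f c)) :=
    tensor (k := k) (𝟙 ((Free.map k (fn f)).obj (Free.tup k a)))
        (tensor (k := k) ((Free.unit k B.X).map ((con f).hom.app (Free.tup k b)))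
          (𝟙 ((Free.map k (fn f)).obj (Free.tup k c))))
  have hl' : mapTup f a ++ (mapTup f b ++ mapTup f c) = mapTup f (a ++ (b ++ c)) := by
    rw [mapTup_append, mapTup_append]
  have hi := con_insert f a b c (congrArg (prod B) hl)
  have hq := q_insert B (mapTup f a) (mapTup f b) (mapTup f c)
  have hn := q_nat B T
  have hT : MEq ((iota B).map T) (tensor (k := k) (𝟙 (qtup B (mapTup f a)))
      (tensor (k := k) ((single B).map ((con f).hom.app (Free.tup k b)))
        (𝟙 (qtup B (mapTup f c))))) := by
    refine ((iota_strict B).map_tensor _ _).trans ?_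
    refine tensor_congr k (MEq.of_eq ((iota B).map_id _)) ?_
    refine ((iota_strict B).map_tensor _ _).trans ?_
    exact tensor_congr k (MEq.refl _) (MEq.of_eq ((iota B).map_id _))
  have hX : tensor (k := k) (𝟙 (qtup B (mapTup f a)))
      (tensor (k := k) (qMap f b).hom (𝟙 (qtup B (mapTup f c)))) =
    tensor (k := k) (𝟙 (qtup B (mapTup f a)))
        (tensor (k := k) (q B (mapTup f b)).hom (𝟙 (qtup B (mapTup f c)))) ≫
      tensor (k := k) (𝟙 (qtup B (mapTup f a)))
      (tensor (k := k) ((single B).map ((con f).hom.app (Free.tup k b)))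
        (𝟙 (qtup B (mapTup f c)))) := StrictStr.tensor_split _ _ _ _
  have hY : MEq (eqToHom (congrArg (qtup B) hl) ≫ (qMap f (a ++ ([prod A b] ++ c))).hom)
      ((q B (mapTup f a ++ ([(fn f).obj (prod A b)] ++ mapTup f c))).hom ≫
        (single B).map (eqToHom (congrArg (prod B) hl) ≫
          (con f).hom.app (Free.tup k (a ++ ([prod A b] ++ c))))) := by
    refine (MEq.left _ _).trans ?_
    refine MEq.comp (q_congr B hl).symm (MEq.map (single B) (MEq.left _ _).symm)
  rw [hX]
  refine (MEq.comp (MEq.comp (MEq.refl _) hT.symm) hY).trans ?_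
  refine (MEq.of_eq (Category.assoc _ _ _)).trans ?_
  refine (MEq.comp (MEq.refl _) (MEq.of_eq ((Category.assoc _ _ _).symm.trans
    (congrArg (fun z => z ≫ (single B).map (eqToHom (congrArg (prod B) hl) ≫
          (con f).hom.app (Free.tup k (a ++ ([prod A b] ++ c))))) hn)))).trans ?_
  refine (MEq.comp (MEq.refl _) (MEq.of_eq (Category.assoc _ _ _))).trans ?_
  refine (MEq.of_eq (Category.assoc _ _ _).symm).trans ?_
  refine MEq.comp (hq.trans (q_congr B hl')) ?_
  refine (MEq.of_eq (CategoryTheory.Functor.map_comp _ _ _).symm).trans ?_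
  exact MEq.map (single B) hi

/-- The value of `Q f` on a generator. -/
def qGen : ∀ {a b : List A.X}, QGen A a b →
    (qtup B (mapTup f a) ⟶ qtup B (mapTup f b))
  | _, _, QGen.free t => (iota B).map ((Free.map k (fn f)).map t)
  | _, _, QGen.q a => (qMap f a).hom
  | _, _, QGen.qInv a => (qMap f a).inv

theorem qObj (a : List A.X) :
    Presentation.evalObj (P := QPres A) (fun x => qtup B [(fn f).obj x]) a =
      qtup B (mapTup f a) := by
  have h1 := evalObj_single (P := QPres B) (O := QPres A) (fn f).obj a
  refine h1.trans ?_
  exact congrArg (fun z : Free k B.X => qtup B z.toList) (Free.map_obj (fn f) a).symm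

/-- The value of `Q f` on a generator, between products of 1-tuples. -/
def qGen' {a b : List A.X} (x : QGen A a b) :
    Presentation.evalObj (P := QPres A) (fun x => qtup B [(fn f).obj x]) a ⟶
      Presentation.evalObj (P := QPres A) (fun x => qtup B [(fn f).obj x]) b :=
  eqToHom (qObj f a) ≫ qGen f x ≫ eqToHom (qObj f b).symm

/-- The value of `Q f` on a word. -/
abbrev qEval {a b : List A.X} (w : Word k (QGen A) a b) :
    Presentation.evalObj (P := QPres A) (fun x => qtup B [(fn f).obj x]) a ⟶
      Presentation.evalObj (P := QPres A) (fun x => qtup B [(fn f).obj x]) b :=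
  Presentation.evalWord (P := QPres A) (fun x => qtup B [(fn f).obj x]) (qGen' f) w

theorem qEval_gen {a b : List A.X} (x : QGen A a b) :
    MEq (qEval f (Word.gen x)) (qGen f x) := MEq.conj _ _ _

theorem qEval_id (a : List A.X) :
    MEq (qEval f (Word.id a)) (𝟙 (qtup B (mapTup f a))) := MEq.eqToHom rfl rfl (qObj f a)

theorem qEval_tensor {a b c d : List A.X} {w : Word k (QGen A) a b} {w' : Word k (QGen A) c d}
    {a' b' c' d' : QCat B} {x : a' ⟶ b'} {y : c' ⟶ d'} (h : MEq (qEval f w) x)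
    (h' : MEq (qEval f w') y) :
    MEq (qEval f (w.tensor w')) (tensor (k := k) x y) :=
  (Presentation.evalWord_tensor _ _ _ _).trans (tensor_congr k h h')

theorem qEval_comp {a b c : List A.X} {w : Word k (QGen A) a b} {w' : Word k (QGen A) b c}
    {a' b' c' : QCat B} {x : a' ⟶ b'} {y : b' ⟶ c'} (h : MEq (qEval f w) x)
    (h' : MEq (qEval f w') y) :
    MEq (qEval f (w.comp w')) (x ≫ y) := MEq.comp h h'

theorem qEval_cast {a b c : List A.X} (w : Word k (QGen A) a b) (h : b = c) :
    MEq (qEval f (w.comp (Word.cast h))) (qEval f w) := by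
  subst h; exact MEq.of_eq (Category.comp_id _)

theorem qEval_sound {a b : List A.X} {w w' : Word k (QGen A) a b} (h : QRel A w w') :
    qEval f w = qEval f w' := by
  apply MEq.eq
  cases h with
  | free_id a =>
    refine (qEval_gen f _).trans (MEq.trans (MEq.of_eq ?_) (qEval_id f a).symm)
    exact (congrArg (iota B).map ((Free.map k (fn f)).map_id _)).trans ((iota B).map_id _)
  | free_comp t t' =>
    refine (qEval_gen f _).trans (MEq.trans (MEq.of_eq ?_)
      (qEval_comp f (qEval_gen f _) (qEval_gen f _)).symm)
    exact (congrArg (iota B).map ((Free.map k (fn f)).map_comp _ _)).trans ((iota B).map_comp _ _)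
  | free_tensor t t' =>
    refine (qEval_gen f _).trans (MEq.trans ?_
      (qEval_tensor f (qEval_gen f _) (qEval_gen f _)).symm)
    exact (((Free.map_strict k (fn f)).map_tensor t t').map (iota B)).trans
      ((iota_strict B).map_tensor _ _)
  | free_braid hk a b =>
    refine (qEval_gen f _).trans (MEq.trans ?_ (Presentation.evalWord_braid _ _ _ _ _).symm)
    refine (((Free.map_strict k (fn f)).map_braid hk _ _).map (iota B)).trans
      (((iota_strict B).map_braid _ _ _).trans ?_)
    exact braid_congr hk (qObj f a).symm (qObj f b).symm
  | q_inv a =>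
    refine (qEval_comp f (qEval_gen f _) (qEval_gen f _)).trans
      (MEq.trans (MEq.of_eq ?_) (qEval_id f a).symm)
    exact (qMap f a).hom_inv_id
  | inv_q a =>
    refine (qEval_comp f (qEval_gen f _) (qEval_gen f _)).trans
      (MEq.trans (MEq.of_eq ?_) (qEval_id f _).symm)
    exact (qMap f a).inv_hom_id
  | nat t =>
    refine (qEval_comp f (qEval_gen f _) (qEval_gen f _)).trans
      (MEq.trans ?_ (qEval_comp f (qEval_gen f _) (qEval_gen f _)).symm)
    refine (MEq.of_eq (qMap_nat f t)).trans ?_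
    refine MEq.comp (MEq.refl _) ?_
    exact (MEq.of_functor_eq (Free.unit_map k (fn f)) ((act A).map t)).symm.map (iota B)
  | assoc_unit a b =>
    refine MEq.trans ?_ (qEval_cast f _ _).symm
    refine MEq.trans ?_ (qEval_gen f _).symm
    refine MEq.trans ?_ (qMap_insert f a [] b (mapTup_insert f a [] b))
    refine MEq.comp ?_ ?_
    · exact qEval_tensor f (qEval_id f a) (qEval_tensor f (qEval_gen f _) (qEval_id f b))
    · exact (qEval_gen f _).trans (MEq.left _ _).symm
  | assoc_right a b =>
    refine MEq.trans ?_ (qEval_cast f _ _).symm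
    refine MEq.trans ?_ (qEval_gen f _).symm
    refine MEq.trans ?_ ((qMap_insert f a b [] (mapTup_insert f a b [])).trans
      (qMap_congr f (congrArg (fun z => a ++ z) (List.append_nil b))))
    refine MEq.comp ?_ ?_
    · refine qEval_tensor f (qEval_id f a) ((qEval_gen f _).trans ?_)
      exact (tensor_one _).symm
    · exact (qEval_gen f _).trans (MEq.left _ _).symm
  | assoc_left a b =>
    refine MEq.trans ?_ (qEval_cast f _ _).symm
    refine MEq.trans ?_ (qEval_gen f _).symm
    refine MEq.trans ?_ (qMap_insert f [] a b (mapTup_insert f [] a b))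
    refine MEq.comp ?_ ?_
    · refine (qEval_tensor f (qEval_gen f _) (qEval_id f b)).trans ?_
      exact (one_tensor _).symm
    · exact (qEval_gen f _).trans (MEq.left _ _).symm
  | norm a =>
    refine (qEval_gen f _).trans ((qMap_norm f a).trans ?_)
    refine MEq.trans ?_ (MEq.of_eq (Presentation.evalWord_cast _ _ _)).symm
    exact (MEq.eqToHom _ rfl (qObj f [a])).symm

end QMap
section QMap

variable {k : Kind} {A B C : Algebra (monad.{u} k)}

/-- The underlying functor of `Q f`: the strict functor with `a ↦ (f a)` on 1-tuples,
`t ↦ (T f) t` on free morphisms, and `q_⟨a⟩ ↦ (f_•) ∘ q_⟨f a⟩`. -/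
def QFun (f : TMap A B) : QCat A ⥤ QCat B :=
  Presentation.lift (P := QPres A) (fun x => qtup B [(fn f).obj x]) (qGen' f) (qEval_sound f)

theorem QFun_strict (f : TMap A B) : IsStrictFun k (QFun f) :=
  Presentation.lift_strict _ _ (qEval_sound f)

theorem QFun_obj (f : TMap A B) (a : List A.X) :
    (QFun f).obj (qtup A a) = qtup B (mapTup f a) := qObj f a

theorem QFun_free (f : TMap A B) {a b : Free k A.X} (t : a ⟶ b) :
    MEq ((QFun f).map ((iota A).map t)) ((iota B).map ((Free.map k (fn f)).map t)) :=
  qEval_gen f (QGen.free t)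

theorem QFun_q (f : TMap A B) (a : List A.X) :
    MEq ((QFun f).map (q A a).hom) (qMap f a).hom := qEval_gen f (QGen.q a)

theorem QFun_single (f : TMap A B) {a b : A.X} (s : a ⟶ b) :
    MEq ((QFun f).map ((single A).map s)) ((single B).map ((fn f).map s)) :=
  (QFun_free f _).trans ((MEq.of_functor_eq (Free.unit_map k (fn f)) s).map (iota B))

theorem meq_inv {X : Type*} [Category X] {a b c d : X} {f : a ≅ b} {g : c ≅ d}
    (h : MEq f.hom g.hom) : MEq f.inv g.inv := by
  obtain ⟨rfl, rfl, h⟩ := h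
  refine MEq.of_eq ?_
  have : f = g := by ext; simpa using h
  rw [this]

theorem MEq.app_eqToHom {X Y : Type*} [Category X] [Category Y] {F G : X ⥤ Y} (h : F = G) (a : X)
    {x : Y} (e : F.obj a = x) : MEq ((CategoryTheory.eqToHom h).app a) (𝟙 x) := by
  subst h; subst e; exact MEq.refl _

theorem inv_natural {X Y : Type*} [Category X] [Category Y] {F G : X ⥤ Y} {a b : X} (u : a ≅ b)
    {s : F.obj a ⟶ G.obj a} {t : F.obj b ⟶ G.obj b} (h : F.map u.hom ≫ t = s ≫ G.map u.hom) :
    F.map u.inv ≫ s = t ≫ G.map u.inv := by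
  have h2 := congrArg (fun z => F.map u.inv ≫ z ≫ G.map u.inv) h
  simpa [← Functor.map_comp_assoc, ← Functor.map_comp] using h2.symm

/-- Strict functors out of `Q A` that agree on free morphisms and on the `q_⟨a⟩` are equal. -/
theorem QFun_ext {X : Type*} [Category X] [StrictStr k X] {F G : QCat A ⥤ X}
    (hF : IsStrictFun k F) (hG : IsStrictFun k G)
    (ho : ∀ a : A.X, F.obj (qtup A [a]) = G.obj (qtup A [a]))
    (hf : ∀ {a b : Free k A.X} (t : a ⟶ b), MEq (F.map ((iota A).map t)) (G.map ((iota A).map t)))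
    (hq : ∀ a : List A.X, MEq (F.map (q A a).hom) (G.map (q A a).hom)) : F = G := by
  refine Presentation.functor_ext hF hG ho ?_
  rintro a b (t | a | a)
  · exact hf t
  · exact hq a
  · exact meq_inv (f := F.mapIso (q A _)) (g := G.mapIso (q A _)) (hq _)

theorem QFun_id : QFun (TMap.id A) = 𝟭 (QCat A) := by
  have e : Free.map k (fn (TMap.id A)) = 𝟭 _ := Free.map_id k
  refine QFun_ext (QFun_strict _) IsStrictFun.id (fun a => rfl) (fun t => ?_) (fun a => ?_)
  · refine (QFun_free _ t).trans ?_
    exact (MEq.of_functor_eq e t).map (iota A)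
  · refine (QFun_q _ a).trans ?_
    have h1 : mapTup (TMap.id A) a = a :=
      congrArg Presentation.Carrier.toList (Functor.congr_obj e (Free.tup k a))
    have h2 : MEq ((con (TMap.id A)).hom.app (Free.tup k a)) (𝟙 (prod A a)) := by
      have h3 : (con (TMap.id A)).hom = eqToHom
        (congrArg Cat.Hom.toFunctor (TMap.id_aux A)) := Cat.Hom₂.eqToHom_toNatTrans _
      exact (MEq.of_eq (congrArg (fun z => z.app (Free.tup k a)) h3)).trans
        (MEq.app_eqToHom (F := Free.map k (fn (TMap.id A)) ⋙ act A) _ (Free.tup k a)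
          (congrArg (prod A) h1))
    have h4 := h2.map (single A)
    rw [CategoryTheory.Functor.map_id] at h4
    exact (MEq.comp (q_congr A h1) h4).trans (MEq.of_eq (Category.comp_id _))

theorem con_comp (f : TMap A B) (g : TMap B C) (a : Free k A.X) :
    MEq ((con (f.comp g)).hom.app a)
      ((con g).hom.app ((Free.map k (fn f)).obj a) ≫ (fn g).map ((con f).hom.app a)) := by
  have h := congrArg (fun z => z.toNatTrans.app a) (TMap.compCon_hom f.con g.con)
  simp only [Cat.Hom₂.eqToHom_toNatTrans, Cat.Hom.toNatTrans_comp] at h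
  refine (MEq.of_eq h).trans ((MEq.app_conj _ _ _ _ _ _).trans ?_)
  exact MEq.comp (MEq.refl _) (MEq.left _ _)

theorem QFun_comp (f : TMap A B) (g : TMap B C) :
    QFun (f.comp g) = QFun f ⋙ QFun g := by
  have e : Free.map k (fn (f.comp g)) = Free.map k (fn f) ⋙ Free.map k (fn g) :=
    Free.map_comp k (fn f) (fn g)
  refine QFun_ext (QFun_strict _) ((QFun_strict f).comp (QFun_strict g))
    (fun a => rfl) (fun t => ?_) (fun a => ?_)
  · refine (QFun_free _ t).trans ?_
    refine ((MEq.of_functor_eq e t).map (iota C)).trans ?_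
    exact ((QFun_free f t).map (QFun g) |>.trans (QFun_free g _)).symm
  · refine (QFun_q _ a).trans ?_
    have h1 : mapTup (f.comp g) a = mapTup g (mapTup f a) :=
      congrArg Presentation.Carrier.toList (Functor.congr_obj e (Free.tup k a))
    have h2 := (con_comp f g (Free.tup k a)).map (single C)
    rw [CategoryTheory.Functor.map_comp] at h2
    refine MEq.trans ?_ ((QFun_q f a).map (QFun g)).symm
    refine (MEq.comp (q_congr C h1) h2).trans ?_
    refine (MEq.of_eq (Category.assoc _ _ _).symm).trans ?_
    refine MEq.trans ?_ (MEq.of_eq ((QFun g).map_comp _ _)).symm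
    exact MEq.comp (QFun_q g (mapTup f a)).symm (QFun_single g _).symm

variable {f g h : TMap A B} 

/-- The underlying transformation of an algebra 2-cell. -/
def cellNat (α : f ⟶ g) : fn f ⟶ fn g := α.cell.toNatTrans

theorem cell_comm (α : f ⟶ g) (a : Free k A.X) :
    (con f).hom.app a ≫ (cellNat α).app ((act A).obj a) =
      (act B).map ((Free.map₂ k (cellNat α)).app a) ≫ (con g).hom.app a :=
  congrArg (fun z => z.toNatTrans.app a) α.comm

/-- The components of `Q α` at 1-tuples. -/
def QTransSingle (α : f ⟶ g) (a : A.X) :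
    (QFun f).obj (qtup A [a]) ⟶ (QFun g).obj (qtup A [a]) := (single B).map ((cellNat α).app a)

theorem QTrans_aux (α : f ⟶ g) (a : List A.X) :
    MEq (Presentation.transApp (QFun_strict f) (QFun_strict g) (QTransSingle α) a)
      ((iota B).map ((Free.map₂ k (cellNat α)).app (Free.tup k a))) := by
  have hm := (Free.map₂_mon k (cellNat α)).whiskerRight (iota_strict B)
  induction a with
  | nil => exact (Presentation.transApp_nil (P := QPres A) _ _ _).trans hm.app_one.symm
  | cons x a ih =>
    refine (Presentation.transApp_cons (P := QPres A) _ _ _ x a).trans ?_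
    refine MEq.trans ?_ (hm.app_mul (Free.tup k [x]) (Free.tup k a)).symm
    exact tensor_congr k ((Free.map₂_unit k (cellNat α) x).map (iota B)).symm ih

theorem QTrans_q (α : f ⟶ g) (a : List A.X) :
    (iota B).map ((Free.map₂ k (cellNat α)).app (Free.tup k a)) ≫ (qMap g a).hom =
      (qMap f a).hom ≫ (single B).map ((cellNat α).app (prod A a)) := by
  have h1 := q_nat B (a := mapTup f a) (b := mapTup g a)
    ((Free.map₂ k (cellNat α)).app (Free.tup k a))
  have h2 := congrArg (single B).map (cell_comm α (Free.tup k a))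
  rw [CategoryTheory.Functor.map_comp, CategoryTheory.Functor.map_comp] at h2
  refine (Category.assoc _ _ _).symm.trans ?_
  refine (congrArg (fun z => z ≫ (single B).map ((con g).hom.app (Free.tup k a))) h1).trans ?_
  refine (Category.assoc _ _ _).trans ?_
  refine (congrArg (fun z => (q B (mapTup f a)).hom ≫ z) h2.symm).trans ?_
  exact (Category.assoc _ _ _).symm

theorem QTrans_nat (α : f ⟶ g) {a b : List A.X} (x : QGen A a b) :
    (QFun f).map ((QPres A).gen x) ≫
        Presentation.transApp (QFun_strict f) (QFun_strict g) (QTransSingle α) b =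
      Presentation.transApp (QFun_strict f) (QFun_strict g) (QTransSingle α) a ≫
        (QFun g).map ((QPres A).gen x) := by
  have hq (a : List A.X) : (QFun f).map (q A a).hom ≫
        Presentation.transApp (QFun_strict f) (QFun_strict g) (QTransSingle α) [prod A a] =
      Presentation.transApp (QFun_strict f) (QFun_strict g) (QTransSingle α) a ≫
        (QFun g).map (q A a).hom := by
    apply MEq.eq
    refine (MEq.comp (QFun_q f a) (Presentation.transApp_single _ _ _ _)).trans ?_
    refine MEq.trans ?_ (MEq.comp (QTrans_aux α a) (QFun_q g a)).symm
    exact MEq.of_eq (QTrans_q α a).symm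
  cases x with
  | free t =>
    apply MEq.eq
    refine (MEq.comp (QFun_free f t) (QTrans_aux α _)).trans ?_
    refine MEq.trans ?_ (MEq.comp (QTrans_aux α _) (QFun_free g t)).symm
    refine MEq.of_eq ?_
    exact ((iota B).map_comp _ _).symm.trans ((congrArg (iota B).map
      ((Free.map₂ k (cellNat α)).naturality t)).trans ((iota B).map_comp _ _))
  | q => exact hq _
  | qInv => exact inv_natural (q A b) (hq b)

/-- The underlying transformation of `Q α`, with components the tuples of components of `α`. -/
def QTrans (α : f ⟶ g) : QFun f ⟶ QFun g :=
  Presentation.liftTrans (QFun_strict f) (QFun_strict g) (QTransSingle α) (QTrans_nat α)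

theorem QTrans_mon (α : f ⟶ g) : IsMonTrans k (QTrans α) :=
  Presentation.liftTrans_mon _ _ _ (QTrans_nat α)

theorem QTrans_single (α : f ⟶ g) (a : A.X) :
    MEq ((QTrans α).app (qtup A [a])) ((single B).map ((cellNat α).app a)) :=
  Presentation.liftTrans_single (P := QPres A) (QFun_strict f) (QFun_strict g) (QTransSingle α)
    (QTrans_nat α) a

end QMap
section Q

variable {k : Kind}

/-- A strict functor, as a strict map of algebras. -/
def strictOf {X Y : Type u} [Category.{u} X] [Category.{u} Y] [StrictStr k X] [StrictStr k Y]
    {F : X ⥤ Y} (hF : IsStrictFun k F) : StrictTMap (algebraOf k X) (algebraOf k Y) where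
  f := F.toCatHom
  comm := Cat.ext (Free.ev_nat k (X := X) (Y := Y) hF)

theorem MEq.eqToHom_app_comp {X Y : Type*} [Category X] [Category Y] {F G : X ⥤ Y} (h : F = G)
    (a : X) {y : Y} (f : G.obj a ⟶ y) : MEq ((CategoryTheory.eqToHom h).app a ≫ f) f := by
  subst h; exact MEq.of_eq (Category.id_comp _)

theorem MEq.comp_eqToHom_app {X Y : Type*} [Category X] [Category Y] {F G : X ⥤ Y} (h : F = G)
    (a : X) {y : Y} (f : y ⟶ F.obj a) : MEq (f ≫ (CategoryTheory.eqToHom h).app a) f := by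
  subst h; exact MEq.of_eq (Category.comp_id _)

theorem Free.ev_map₂ {X Y : Type u} [Category.{u} X] [Category.{u} Y] [StrictStr k X]
    [StrictStr k Y] {F G : X ⥤ Y} (hF : IsStrictFun k F) (hG : IsStrictFun k G) {θ : F ⟶ G}
    (h : IsMonTrans k θ) (l : Free k X) :
    MEq ((Free.ev k Y).map ((Free.map₂ k θ).app l)) (θ.app ((Free.ev k X).obj l)) := by
  have e : ∀ {Z : Type u} [Category.{u} Z] [StrictStr k Z],
      Free.unit k Z ⋙ Free.ev k Z = 𝟭 Z := Free.unit_lift _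
  refine Free.trans_ext ((Free.map₂_mon k θ).whiskerRight (Free.lift_strict (𝟭 Y)))
    (h.whiskerLeft (Free.lift_strict (𝟭 X))) (fun a => ?_) l
  refine ((Free.map₂_unit k θ a).map (Free.ev k Y)).trans ?_
  refine (MEq.of_functor_eq e (θ.app a)).trans ?_
  exact MEq.app θ (Functor.congr_obj e a).symm

/-- A monoidal transformation, as an algebra 2-cell. -/
def strictCellOf {X Y : Type u} [Category.{u} X] [Category.{u} Y] [StrictStr k X] [StrictStr k Y]
    {F G : X ⥤ Y} (hF : IsStrictFun k F) (hG : IsStrictFun k G) {θ : F ⟶ G}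
    (h : IsMonTrans k θ) : strictOf hF ⟶ strictOf hG :=
  StrictTMap.Cell.mk (TMap.Cell.mk (f := (strictOf hF).toTMap) (g := (strictOf hG).toTMap)
    θ.toCatHom₂ (by
      have e1 : (strictOf hF).toTMap.con.hom.toNatTrans = eqToHom (Free.ev_nat k hF) :=
        Cat.Hom₂.eqToHom_toNatTrans (strictOf hF).comm
      have e2 : (strictOf hG).toTMap.con.hom.toNatTrans = eqToHom (Free.ev_nat k hG) :=
        Cat.Hom₂.eqToHom_toNatTrans (strictOf hG).comm
      refine Cat.Hom₂.ext (NatTrans.ext (funext fun l => MEq.eq ?_))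
      refine (MEq.comp (MEq.of_eq (congrArg (fun z => z.app l) e1)) (MEq.refl _)).trans ?_
      refine MEq.trans ?_
        (MEq.comp (MEq.refl _) (MEq.of_eq (congrArg (fun z => z.app l) e2))).symm
      refine (MEq.eqToHom_app_comp _ _ _).trans (MEq.trans ?_ (MEq.comp_eqToHom_app _ _ _).symm)
      exact (Free.ev_map₂ hF hG h l).symm))

/-- The algebra `Q A`, with product given by concatenation. -/
def QAlg (A : Algebra (monad.{u} k)) : Algebra (monad.{u} k) := algebraOf k (QCat A)

theorem QTrans_id {A B : Algebra (monad.{u} k)} (f : TMap A B) : QTrans (𝟙 f) = 𝟙 (QFun f) := by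
  ext l
  refine (Presentation.trans_ext (P := QPres A) (QTrans_mon (𝟙 f)) (IsMonTrans.id (QFun_strict f))
    (fun a => ?_) l).eq
  refine (QTrans_single (𝟙 f) a).trans (MEq.of_eq ?_)
  exact (single B).map_id _

theorem QTrans_comp {A B : Algebra (monad.{u} k)} {f g h : TMap A B} (α : f ⟶ g) (β : g ⟶ h) :
    QTrans (α ≫ β) = QTrans α ≫ QTrans β := by
  ext l
  refine (Presentation.trans_ext (P := QPres A) (QTrans_mon (α ≫ β))
    ((QTrans_mon α).comp (QTrans_mon β)) (fun a => ?_) l).eq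
  refine (QTrans_single (α ≫ β) a).trans ?_
  refine (MEq.of_eq ((single B).map_comp _ _)).trans ?_
  exact (MEq.comp (QTrans_single α a) (QTrans_single β a)).symm

theorem QTrans_whiskerLeft {A B C : Algebra (monad.{u} k)} (f : A ⟶ B) {g h : B ⟶ C} (α : g ⟶ h)
    (l : QCat A) : MEq ((QTrans (f ◁ α)).app l) ((QTrans α).app ((QFun f).obj l)) := by
  refine Presentation.trans_ext (P := QPres A) (QTrans_mon (f ◁ α))
    ((QTrans_mon α).whiskerLeft (QFun_strict f)) (fun a => ?_) l
  exact (QTrans_single (f ◁ α) a).trans (QTrans_single α ((fn f).obj a)).symm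

theorem QTrans_whiskerRight {A B C : Algebra (monad.{u} k)} {f g : A ⟶ B} (α : f ⟶ g) (h : B ⟶ C)
    (l : QCat A) : MEq ((QTrans (α ▷ h)).app l) ((QFun h).map ((QTrans α).app l)) := by
  refine Presentation.trans_ext (P := QPres A) (QTrans_mon (α ▷ h))
    ((QTrans_mon α).whiskerRight (QFun_strict h)) (fun a => ?_) l
  refine (QTrans_single (α ▷ h) a).trans ?_
  exact ((QTrans_single α a).map (QFun h) |>.trans (QFun_single h _)).symm

theorem strict_hom_ext {A B : StrictAlgebra (monad.{u} k)} {f g f' g' : A ⟶ B} (θ : f ⟶ g)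
    (θ' : f' ⟶ g') (h : f = f') (h' : g' = g) (e : f.f = f'.f) (e' : g'.f = g.f)
    (w : ∀ a, MEq (θ.toCell.cell.toNatTrans.app a) (θ'.toCell.cell.toNatTrans.app a)) :
    θ = eqToHom h ≫ θ' ≫ eqToHom h' := by
  subst h; subst h'
  refine StrictTMap.hom_ext (Cat.Hom₂.ext (NatTrans.ext (funext fun a => ?_)))
  rw [eqToHom_refl, eqToHom_refl, Category.comp_id, Category.id_comp]
  exact (w a).eq

/-- The value of `Q` on an algebra 2-cell. -/
def QCell {A B : Algebra (monad.{u} k)} {f g : TMap A B} (α : f ⟶ g) :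
    strictOf (QFun_strict f) ⟶ strictOf (QFun_strict g) :=
  strictCellOf (QFun_strict f) (QFun_strict g) (QTrans_mon α)

theorem QCell_whiskerL {A B C : Algebra (monad.{u} k)} (f : A ⟶ B) {g h : B ⟶ C} (α : g ⟶ h)
    (l : QCat A) :
    MEq ((QTrans (f ◁ α)).app l) ((StrictAlgebra.whiskerL (strictOf (QFun_strict f))
      (QCell α)).toCell.cell.toNatTrans.app l) := by
  rw [StrictAlgebra.whiskerL_cell]
  exact QTrans_whiskerLeft f α l

theorem QCell_whiskerR {A B C : Algebra (monad.{u} k)} {f g : A ⟶ B} (α : f ⟶ g) (h : B ⟶ C)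
    (l : QCat A) :
    MEq ((QTrans (α ▷ h)).app l) ((StrictAlgebra.whiskerR (QCell α)
      (strictOf (QFun_strict h))).toCell.cell.toNatTrans.app l) := by
  rw [StrictAlgebra.whiskerR_cell]
  exact QTrans_whiskerRight α h l

variable (k) in
/-- The 2-functor `Q` from algebras and T-maps to algebras and strict T-maps. -/
def Q : StrictPseudofunctor (Algebra (monad.{u} k)) (StrictAlgebra (monad.{u} k)) :=
  StrictPseudofunctor.mk''
    { obj := fun A => ⟨QAlg A⟩
      map := fun f => strictOf (QFun_strict f)
      map₂ := fun α => QCell α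
      map_id := fun A => StrictTMap.ext (Cat.ext QFun_id)
      map_comp := fun f g => StrictTMap.ext (Cat.ext (QFun_comp f g))
      map₂_id := fun f => StrictTMap.hom_ext (Cat.Hom₂.ext (QTrans_id f))
      map₂_comp := fun α β => StrictTMap.hom_ext (Cat.Hom₂.ext (QTrans_comp α β))
      map₂_whisker_left := fun f g h α => strict_hom_ext _ _ _ _
        (Cat.ext (QFun_comp f g)) (Cat.ext (QFun_comp f h).symm) (QCell_whiskerL f α)
      map₂_whisker_right := fun {A B C f g} α h => strict_hom_ext _ _ _ _
        (Cat.ext (QFun_comp f h)) (Cat.ext (QFun_comp g h).symm) (QCell_whiskerR α h) }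

end Q
/-! ## Effective pseudomorphism classifiers -/

section Effective

/-- A 2-functor `Q`, left 2-adjoint to the inclusion `i` with unit `ζ` and counit `δ`, is effective
if for each algebra `Y` there is an algebra 2-cell isomorphism `Θ : ζ_Y ∘ δ_Y ≅ 1` such that
`(ζ_Y, δ_Y, Θ)` is an adjoint surjective equivalence in the 2-category of algebras and T-maps. -/
def IsEffective {K : Type*} [Bicategory K] [Strict K] {M : TwoMonad K}
    {Q : StrictPseudofunctor (Algebra M) (StrictAlgebra M)}
    (adj : TwoAdjunction Q (StrictAlgebra.incl M)) : Prop :=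
  ∀ Y : StrictAlgebra M,
    ∃ Θ : (StrictAlgebra.incl M).map (adj.counit Y) ≫ adj.unit ((StrictAlgebra.incl M).obj Y) ≅
        𝟙 ((StrictAlgebra.incl M).obj (Q.obj ((StrictAlgebra.incl M).obj Y))),
      IsAdjointSurjectiveEquivalence (adj.unit ((StrictAlgebra.incl M).obj Y))
        ((StrictAlgebra.incl M).map (adj.counit Y)) Θ

variable {k : Kind}

/-- The explicit description of `ζ_A : A ⟶ Q A`: objects and morphisms of `A` are sent to 1-tuples,
and the algebra constraint at `⟨a⟩` is `q_⟨a⟩`. -/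
def IsExplicitUnit (A : Algebra (monad.{u} k)) (ζ : TMap A (QAlg A)) : Prop :=
  fn ζ = single A ∧
    ∀ a : List A.X, MEq (X := QCat A) ((con ζ).hom.app (Free.tup k a)) (q A a).hom

/-- The explicit description of `δ_B : Q B ⟶ B`: tuples and free morphisms are sent to their
products, and each `q_⟨b⟩` to an identity. -/
def IsExplicitCounit (B : Algebra (monad.{u} k)) (δ : StrictTMap (QAlg B) B) : Prop :=
  iota B ⋙ fn δ.toTMap = act B ∧
    ∀ b : List B.X, MEq ((fn δ.toTMap).map (q B b).hom) (𝟙 (prod B b))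

/-- The explicit description of an algebra 2-cell `Θ` from `ζ_B ∘ δ_B` to the identity of `Q B`:
its component at `⟨b⟩` is the inverse of `q_⟨b⟩`. -/
def IsExplicitEfficacy (B : Algebra (monad.{u} k)) {f : TMap (QAlg B) (QAlg B)}
    (Θ : f ⟶ 𝟙 (QAlg B)) : Prop :=
  ∀ b : List B.X, MEq (X := QCat B) ((cellNat Θ).app (qtup B b)) (q B b).inv

end Effective

end PsMor

universe u

/-!
The functor `δ_B : Q B ⥤ B` multiplies out tuples, the functor `ζ_B : B ⥤ Q B` is the inclusion of
1-tuples, and the isomorphisms `q_⟨b⟩ : ⟨b⟩ ⟶ (b_•)` form a natural isomorphism `1 ≅ ζ_B δ_B`.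
Everything in the theorem is read off from this isomorphism and from the universal property of
`Q B` as a presented category.

* An algebra `B` over the 2-monad is a strict structure on its underlying category whose operations
  are the values of the action at the operations of the free structure (`algStr`), the action being
  the evaluation of tuples (`ev_eq_act`). Hence `δ_B` may be defined on generators, and it is a
  strict map because it is a strict functor (`counitFun`, `counitMap`).
* Naturality of the `q_⟨b⟩` has to be checked on words (`qIso_word`). The axioms give it on
  generators; on a concatenation of words it follows since `q_{⟨a⟩;⟨c⟩}` is
  `(q_⟨a⟩; q_⟨c⟩)` followed by `q_{(a_•),(c_•)}` (`q_mul`), and `q_{(a_•),(c_•)}` is natural in the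
  free morphisms between pairs.
* Iterating `q_mul` gives the analogous factorization of `q` at the concatenation of a tuple of
  tuples (`q_ev`). It is both the multiplication axiom for the constraint of the T-map `ζ_A`
  (`unitMap`) and the compatibility of the `q_⟨b⟩` with algebra constraints, by which they form an
  algebra 2-cell `1 ⟶ ζ_B δ_B` (`qCell`); its inverse is `Θ` (`efficacy`).
* Naturality of `ζ` says that `Q f` sends `q_⟨a⟩` to `(f_•) ∘ q_⟨f a⟩`. Naturality of `δ` and the
  identity `δ_{Q A} ∘ Q ζ_A = 1` compare strict functors out of `Q A`, so they are checked on free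
  morphisms and on the `q_⟨a⟩`. The equality `δ_B ζ_B = 1` holds because `δ_B` sends each `q_⟨b⟩` to
  an identity, and `Θ * ζ_B = 1` is the normality axiom.
-/

namespace PsMor

open StrictStr

/-! ### The strict structure underlying an algebra -/

section AlgStr

variable {k : Kind} (A : Algebra (monad.{u} k))

theorem act_unit_map {a b : A.X} (f : a ⟶ b) :
    MEq ((act A).map ((Free.unit k A.X).map f)) f := MEq.of_functor_eq (unit_act A) f

/-- Associativity of the action, for the product of two free morphisms. -/
theorem act_map_unit_act_tensor {a b c d : Free k A.X} (s : a ⟶ b) (t : c ⟶ d) :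
    MEq ((act A).map (tensor (k := k) ((Free.unit k A.X).map ((act A).map s))
        ((Free.unit k A.X).map ((act A).map t))))
      ((act A).map (tensor (k := k) s t)) := by
  have h := MEq.of_functor_eq (map_act A) (tensor (k := k) ((Free.unit k (Free k A.X)).map s)
    ((Free.unit k (Free k A.X)).map t))
  refine MEq.trans (MEq.map (act A) ?_) (h.trans (MEq.map (act A) ?_))
  · refine MEq.trans ?_ ((Free.map_strict k (act A)).map_tensor _ _).symm
    exact tensor_congr k (MEq.of_functor_eq (Free.unit_map k (act A)) s).symm
      (MEq.of_functor_eq (Free.unit_map k (act A)) t).symm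
  · refine ((Free.mult_strict k).map_tensor _ _).trans ?_
    exact tensor_congr k (MEq.of_functor_eq (Free.unit_mult k) s)
      (MEq.of_functor_eq (Free.unit_mult k) t)

theorem act_obj_mul (a b : Free k A.X) :
    (act A).obj (mul k a b) = (act A).obj (mul k ((Free.unit k A.X).obj ((act A).obj a))
      ((Free.unit k A.X).obj ((act A).obj b))) := by
  obtain ⟨h, -, -⟩ := act_map_unit_act_tensor A (𝟙 a) (𝟙 b)
  exact h.symm

theorem act_map_braid (hk : k ≠ Kind.plain) (a b : Free k A.X) :
    MEq ((act A).map (braid hk a b))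
      ((act A).map (braid hk ((Free.unit k A.X).obj ((act A).obj a))
        ((Free.unit k A.X).obj ((act A).obj b)))) := by
  have h := MEq.of_functor_eq (map_act A) (braid hk ((Free.unit k (Free k A.X)).obj a)
    ((Free.unit k (Free k A.X)).obj b))
  refine MEq.trans (MEq.map (act A) ?_) (h.symm.trans (MEq.map (act A) ?_))
  · refine MEq.trans ?_ ((Free.mult_strict k).map_braid _ _ _).symm
    exact braid_congr hk (Functor.congr_obj (Free.unit_mult k) a).symm
      (Functor.congr_obj (Free.unit_mult k) b).symm
  · refine ((Free.map_strict k (act A)).map_braid _ _ _).trans ?_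
    exact braid_congr hk (Functor.congr_obj (Free.unit_map k (act A)) a)
      (Functor.congr_obj (Free.unit_map k (act A)) b)

/-- The value of the action at a product depends only on the values at the factors. -/
theorem act_tensor_congr {a b c d a' b' c' d' : Free k A.X} {s : a ⟶ b} {t : c ⟶ d}
    {s' : a' ⟶ b'} {t' : c' ⟶ d'} (h : MEq ((act A).map s) ((act A).map s'))
    (h' : MEq ((act A).map t) ((act A).map t')) :
    MEq ((act A).map (tensor (k := k) s t)) ((act A).map (tensor (k := k) s' t')) :=
  (act_map_unit_act_tensor A s t).symm.trans (MEq.trans (MEq.map (act A)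
    (tensor_congr k (h.map _) (h'.map _))) (act_map_unit_act_tensor A s' t'))

theorem act_obj_congr {a b a' b' : Free k A.X} (h : (act A).obj a = (act A).obj a')
    (h' : (act A).obj b = (act A).obj b') :
    (act A).obj (mul k a b) = (act A).obj (mul k a' b') := by
  rw [act_obj_mul, h, h', ← act_obj_mul]

theorem act_braid_congr (hk : k ≠ Kind.plain) {a b a' b' : Free k A.X}
    (h : (act A).obj a = (act A).obj a') (h' : (act A).obj b = (act A).obj b') :
    MEq ((act A).map (braid hk a b)) ((act A).map (braid hk a' b')) := by
  refine (act_map_braid A hk a b).trans (MEq.trans (MEq.map (act A) ?_)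
    (act_map_braid A hk a' b').symm)
  exact braid_congr hk (congrArg _ h) (congrArg _ h')

theorem act_unit_obj (a : A.X) : (act A).obj ((Free.unit k A.X).obj a) = a := prod_single A a

theorem act_unit_act_map {a b : Free k A.X} (s : a ⟶ b) :
    MEq ((act A).map ((Free.unit k A.X).map ((act A).map s))) ((act A).map s) :=
  act_unit_map A _

theorem act_id_unit (a : A.X) :
    MEq ((act A).map (𝟙 ((Free.unit k A.X).obj a)))
      ((act A).map ((Free.unit k A.X).map (𝟙 a))) := by
  rw [CategoryTheory.Functor.map_id (Free.unit k A.X)]; exact MEq.refl _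

/-- The strict structure of kind `k` on the category underlying an algebra: the product, the unit
and the braiding are the values of the action at those of the free structure. -/
@[reducible]
def algStr : StrictStr k A.X where
  mul a b := (act A).obj (mul k ((Free.unit k A.X).obj a) ((Free.unit k A.X).obj b))
  one := (act A).obj (one k)
  mul_assoc a b c := by
    rw [act_obj_congr A (act_unit_obj A _) rfl, StrictStr.mul_assoc,
      act_obj_congr A rfl (act_unit_obj A _).symm]
  one_mul a := by
    rw [act_obj_congr A (act_unit_obj A _) rfl, StrictStr.one_mul, act_unit_obj]
  mul_one a := by
    rw [act_obj_congr A rfl (act_unit_obj A _), StrictStr.mul_one, act_unit_obj]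
  tensor f g := (act A).map (tensor (k := k) ((Free.unit k A.X).map f) ((Free.unit k A.X).map g))
  tensor_id a b := by simp [tensor_id]
  tensor_comp f g f' g' := by simp [tensor_comp]
  tensor_assoc f g h :=
    (act_tensor_congr A (act_unit_act_map A _) (MEq.refl _)).trans
      (((StrictStr.tensor_assoc _ _ _).map (act A)).trans
        (act_tensor_congr A (MEq.refl _) (act_unit_act_map A _).symm))
  one_tensor f := by
    refine (act_tensor_congr A ?_ (MEq.refl _)).trans
      (((StrictStr.one_tensor (k := k) ((Free.unit k A.X).map f)).map (act A)).trans
        (act_unit_map A f))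
    rw [CategoryTheory.Functor.map_id, CategoryTheory.Functor.map_id,
      CategoryTheory.Functor.map_id]
    exact MEq.eqToHom rfl rfl (act_unit_obj A _)
  tensor_one f := by
    refine (act_tensor_congr A (MEq.refl _) ?_).trans
      (((StrictStr.tensor_one (k := k) ((Free.unit k A.X).map f)).map (act A)).trans
        (act_unit_map A f))
    rw [CategoryTheory.Functor.map_id, CategoryTheory.Functor.map_id,
      CategoryTheory.Functor.map_id]
    exact MEq.eqToHom rfl rfl (act_unit_obj A _)
  braid hk a b := (act A).map (braid hk ((Free.unit k A.X).obj a) ((Free.unit k A.X).obj b))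
  braidInv hk a b := (act A).map (braidInv hk ((Free.unit k A.X).obj a) ((Free.unit k A.X).obj b))
  braid_inv hk a b := by rw [← Functor.map_comp, braid_inv, CategoryTheory.Functor.map_id]
  inv_braid hk a b := by rw [← Functor.map_comp, inv_braid, CategoryTheory.Functor.map_id]
  braid_nat hk {a b c d} f g := by rw [← Functor.map_comp, braid_nat, Functor.map_comp]
  hexagon₁ hk a b c := by
    refine (act_braid_congr A hk rfl (act_unit_obj A _)).trans ?_
    refine ((StrictStr.hexagon₁ hk _ _ _).map (act A)).trans ?_
    rw [Functor.map_comp, Functor.map_comp]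
    refine MEq.comp (act_tensor_congr A (act_unit_act_map A _).symm ?_) (MEq.comp ?_
      (act_tensor_congr A ?_ (act_unit_act_map A _).symm))
    · exact act_id_unit A c
    · rw [eqToHom_map]
      exact MEq.eqToHom _ _ (act_obj_congr A (act_unit_obj A _).symm rfl)
    · exact act_id_unit A b
  hexagon₂ hk a b c := by
    refine (act_braid_congr A hk (act_unit_obj A _) rfl).trans ?_
    refine ((StrictStr.hexagon₂ hk _ _ _).map (act A)).trans ?_
    rw [Functor.map_comp, Functor.map_comp]
    refine MEq.comp (act_tensor_congr A ?_ (act_unit_act_map A _).symm) (MEq.comp ?_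
      (act_tensor_congr A (act_unit_act_map A _).symm ?_))
    · exact act_id_unit A a
    · rw [eqToHom_map]
      exact MEq.eqToHom _ _ (act_obj_congr A rfl (act_unit_obj A _).symm)
    · exact act_id_unit A b
  symmetry hk hs a b := by
    rw [← Functor.map_comp, symmetry hk hs, CategoryTheory.Functor.map_id]

attribute [local instance] algStr

theorem act_strict : IsStrictFun k (act A) where
  map_one := rfl
  map_mul a b := act_obj_mul A a b
  map_tensor s t := (act_map_unit_act_tensor A s t).symm
  map_braid hk a b := act_map_braid A hk a b

/-- The action is the evaluation of tuples in the structure `algStr`. -/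
theorem ev_eq_act : Free.ev k A.X = act A :=
  Free.functor_ext (Free.lift_strict _) (act_strict A) ((Free.unit_lift _).trans (unit_act A).symm)

/-- The functor underlying a strict map is strict for the structures of the two algebras. -/
theorem IsStrictFun.of_act {B : Algebra (monad.{u} k)} {F : A.X ⥤ B.X}
    (h : Free.map k F ⋙ act B = act A ⋙ F) : IsStrictFun k F := by
  have e := Free.unit_map k F
  refine ⟨?_, fun a b => ?_, fun f g => ?_, fun hk a b => ?_⟩
  · refine (Functor.congr_obj h (one k)).symm.trans ?_
    exact congrArg (act B).obj (Free.map_strict k F).map_one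
  · refine (Functor.congr_obj h _).symm.trans (congrArg (act B).obj ?_)
    refine ((Free.map_strict k F).map_mul _ _).trans ?_
    exact congrArg₂ (mul k) (Functor.congr_obj e a) (Functor.congr_obj e b)
  · refine (MEq.of_functor_eq h _).symm.trans (MEq.map (act B) ?_)
    refine ((Free.map_strict k F).map_tensor _ _).trans ?_
    exact tensor_congr k (MEq.of_functor_eq e f) (MEq.of_functor_eq e g)
  · refine (MEq.of_functor_eq h _).symm.trans (MEq.map (act B) ?_)
    refine ((Free.map_strict k F).map_braid _ _ _).trans ?_
    exact braid_congr hk (Functor.congr_obj e a) (Functor.congr_obj e b)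

/-- A transformation between strict maps that is compatible with the action is monoidal. -/
theorem IsMonTrans.of_act {B : Algebra (monad.{u} k)} {F G : A.X ⥤ B.X} {θ : F ⟶ G}
    (h : ∀ l : Free k A.X, MEq ((act B).map ((Free.map₂ k θ).app l)) (θ.app ((act A).obj l))) :
    IsMonTrans k θ where
  app_one := by
    refine (h (one k)).symm.trans (((Free.map₂_mon k θ).app_one.map (act B)).trans ?_)
    rw [CategoryTheory.Functor.map_id]; exact MEq.refl _
  app_mul a b := by
    refine (h (mul k ((Free.unit k A.X).obj a) ((Free.unit k A.X).obj b))).symm.trans ?_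
    refine MEq.map (act B) (((Free.map₂_mon k θ).app_mul _ _).trans ?_)
    exact tensor_congr k (Free.map₂_unit k θ a) (Free.map₂_unit k θ b)

/-- The structure recovered from the algebra of a strict structure is the original one. -/
theorem algebraOf_id_strict (X : Type u) [Category.{u} X] [StrictStr k X] :
    @IsStrictFun k (algebraOf k X).X X _ _ (algStr _) _ (𝟭 X) where
  map_one := rfl
  map_mul a b := by
    refine ((Free.lift_strict (k := k) (𝟭 X)).map_mul _ _).trans ?_
    exact congrArg₂ (mul k) (Functor.congr_obj (Free.unit_lift (𝟭 X)) a)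
      (Functor.congr_obj (Free.unit_lift (𝟭 X)) b)
  map_tensor f g := by
    refine ((Free.lift_strict (k := k) (𝟭 X)).map_tensor ((Free.unit k X).map f)
      ((Free.unit k X).map g)).trans ?_
    exact tensor_congr k (MEq.of_functor_eq (Free.unit_lift (𝟭 X)) f)
      (MEq.of_functor_eq (Free.unit_lift (𝟭 X)) g)
  map_braid hk a b := by
    refine ((Free.lift_strict (k := k) (𝟭 X)).map_braid hk _ _).trans ?_
    exact braid_congr hk (Functor.congr_obj (Free.unit_lift (𝟭 X)) a)
      (Functor.congr_obj (Free.unit_lift (𝟭 X)) b)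

end AlgStr

/-! ### The counit -/

section Counit

variable {k : Kind} (B : Algebra (monad.{u} k))

attribute [local instance] algStr

theorem evalObj_eq_prod (l : List B.X) :
    Presentation.evalObj (P := QPres B) (X := B.X) (fun b => b) l = prod B l := by
  induction l with
  | nil => rfl
  | cons b l ih =>
    refine (congrArg (mul k b) ih).trans ?_
    refine Eq.trans ?_ ((act_strict B).map_mul (Free.tup k [b]) (Free.tup k l)).symm
    exact congrArg (fun z => mul k z (prod B l)) (prod_single B b).symm

/-- The value of `δ` on a generator: `t` is sent to `t_•`, and each `q_⟨b⟩` to an identity. -/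
def counitGen : ∀ {a b : List B.X}, QGen B a b → (prod B a ⟶ prod B b)
  | _, _, QGen.free t => (act B).map t
  | _, _, QGen.q a => eqToHom (prod_single B (prod B a)).symm
  | _, _, QGen.qInv a => eqToHom (prod_single B (prod B a))

/-- The value of `δ` on a generator, between iterated products. -/
def counitGen' {a b : List B.X} (x : QGen B a b) :
    Presentation.evalObj (P := QPres B) (X := B.X) (fun b => b) a ⟶
      Presentation.evalObj (P := QPres B) (X := B.X) (fun b => b) b :=
  eqToHom (evalObj_eq_prod B a) ≫ counitGen B x ≫ eqToHom (evalObj_eq_prod B b).symm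

/-- The value of `δ` on a word. -/
abbrev counitEval {a b : List B.X} (w : Word k (QGen B) a b) :
    Presentation.evalObj (P := QPres B) (X := B.X) (fun b => b) a ⟶
      Presentation.evalObj (P := QPres B) (X := B.X) (fun b => b) b :=
  Presentation.evalWord (P := QPres B) (X := B.X) (fun b => b) (counitGen' B) w

theorem counitEval_gen {a b : List B.X} (x : QGen B a b) :
    MEq (counitEval B (Word.gen x)) (counitGen B x) := MEq.conj _ _ _

theorem counitEval_free {a b : List B.X} (t : Free.tup k a ⟶ Free.tup k b) :
    MEq (counitEval B (Word.gen (QGen.free t))) ((act B).map t) := counitEval_gen B (QGen.free t)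

theorem counitEval_q (a : List B.X) :
    MEq (counitEval B (Word.gen (QGen.q a))) (𝟙 (prod B a)) :=
  (counitEval_gen B _).trans (MEq.eqToHom (prod_single B (prod B a)).symm rfl rfl)

theorem counitEval_qInv (a : List B.X) :
    MEq (counitEval B (Word.gen (QGen.qInv a))) (𝟙 (prod B a)) :=
  (counitEval_gen B _).trans (MEq.eqToHom (prod_single B (prod B a)) rfl (prod_single B _))

theorem counitEval_id (a : List B.X) :
    MEq (counitEval B (Word.id a)) (𝟙 (prod B a)) :=
  MEq.eqToHom rfl rfl (evalObj_eq_prod B a)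

theorem counitEval_tensor_id {a b c d : List B.X} {w : Word k (QGen B) a b}
    {w' : Word k (QGen B) c d} {x y : B.X} (h : MEq (counitEval B w) (𝟙 x))
    (h' : MEq (counitEval B w') (𝟙 y)) :
    MEq (counitEval B (w.tensor w')) (𝟙 (mul k x y)) :=
  (Presentation.evalWord_tensor _ _ _ _).trans ((tensor_congr k h h').trans
    (MEq.of_eq (tensor_id x y)))

theorem MEq.comp_right_id {X : Type*} [Category X] {a b c y : X} (f : a ⟶ b) {g : b ⟶ c}
    (h : MEq g (𝟙 y)) : MEq (f ≫ g) f := by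
  obtain ⟨rfl, rfl, rfl⟩ := h
  exact MEq.of_eq (by simp)

theorem MEq.comp_left_id {X : Type*} [Category X] {a b c y : X} {f : a ⟶ b} (h : MEq f (𝟙 y))
    (g : b ⟶ c) : MEq (f ≫ g) g := by
  obtain ⟨rfl, rfl, rfl⟩ := h
  exact MEq.of_eq (by simp)

theorem MEq.comp_id {X : Type*} [Category X] {a b c x y : X} {f : a ⟶ b} {g : b ⟶ c}
    (h : MEq f (𝟙 x)) (h' : MEq g (𝟙 y)) : MEq (f ≫ g) (𝟙 y) :=
  (MEq.comp_left_id h g).trans h'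

/-- Parallel morphisms that are both identities up to equality of objects are equal. -/
theorem MEq.of_id {X : Type*} [Category X] {a b x y : X} {f g : a ⟶ b}
    (h : MEq f (𝟙 x)) (h' : MEq g (𝟙 y)) : f = g := by
  obtain ⟨rfl, rfl, rfl⟩ := h
  obtain ⟨rfl, h, rfl⟩ := h'
  simp

theorem counitEval_cast {a b : List B.X} (h : a = b) :
    MEq (counitEval B (Word.cast h)) (𝟙 (prod B b)) := by
  subst h; exact counitEval_id B a

/-- The relations that involve a `q_⟨a⟩`, other than naturality, only equate words whose values are
identities up to equality of objects. -/
theorem counitEval_sound {a b : List B.X} {w w' : Word k (QGen B) a b} (h : QRel B w w') :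
    counitEval B w = counitEval B w' := by
  cases h with
  | free_id a =>
    exact ((counitEval_free B _).trans (MEq.trans (MEq.of_eq ((act B).map_id _))
      (counitEval_id B a).symm)).eq
  | free_comp t t' =>
    exact ((counitEval_free B _).trans (MEq.trans (MEq.of_eq ((act B).map_comp _ _))
      (MEq.comp (counitEval_free B _) (counitEval_free B _)).symm)).eq
  | free_tensor t t' =>
    refine ((counitEval_free B _).trans (MEq.trans ((act_strict B).map_tensor t t') ?_)).eq
    exact ((Presentation.evalWord_tensor _ _ _ _).trans
      (tensor_congr k (counitEval_free B _) (counitEval_free B _))).symm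
  | free_braid hk a b =>
    refine ((counitEval_free B _).trans (MEq.trans ((act_strict B).map_braid hk _ _) ?_)).eq
    refine MEq.trans ?_ (Presentation.evalWord_braid _ _ _ _ _).symm
    exact braid_congr hk (evalObj_eq_prod B a).symm (evalObj_eq_prod B b).symm
  | q_inv a =>
    exact MEq.of_id (MEq.comp_id (counitEval_q B _) (counitEval_qInv B _)) (counitEval_id B _)
  | inv_q a =>
    exact MEq.of_id (MEq.comp_id (counitEval_qInv B _) (counitEval_q B _)) (counitEval_id B _)
  | nat t =>
    refine ((MEq.comp_right_id _ (counitEval_q B _)).trans (MEq.trans ?_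
      (MEq.comp_left_id (counitEval_q B _) _).symm)).eq
    refine (counitEval_free B t).trans (MEq.trans ?_ (counitEval_free B _).symm)
    exact (act_unit_map B _).symm
  | assoc_unit a b =>
    exact MEq.of_id (MEq.comp_id (counitEval_tensor_id B (counitEval_id B _)
      (counitEval_tensor_id B (counitEval_q B _) (counitEval_id B _))) (counitEval_q B _))
      (MEq.comp_id (counitEval_q B _) (counitEval_cast B _))
  | assoc_right a b =>
    exact MEq.of_id (MEq.comp_id (counitEval_tensor_id B (counitEval_id B _)
      (counitEval_q B _)) (counitEval_q B _))
      (MEq.comp_id (counitEval_q B _) (counitEval_cast B _))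
  | assoc_left a b =>
    exact MEq.of_id (MEq.comp_id (counitEval_tensor_id B (counitEval_q B _)
      (counitEval_id B _)) (counitEval_q B _))
      (MEq.comp_id (counitEval_q B _) (counitEval_cast B _))
  | norm a =>
    exact MEq.of_id (counitEval_q B _) (counitEval_cast B _)

/-- The underlying functor of `δ`, which multiplies out tuples, and sends each `q_⟨b⟩` to an
identity. -/
def counitFun : QCat B ⥤ B.X :=
  Presentation.lift (P := QPres B) (X := B.X) (fun b => b) (counitGen' B) (counitEval_sound B)

theorem counitFun_strict : IsStrictFun k (counitFun B) :=
  Presentation.lift_strict _ _ (counitEval_sound B)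

theorem counitFun_obj (b : List B.X) : (counitFun B).obj (qtup B b) = prod B b :=
  evalObj_eq_prod B b

theorem counitFun_free {a b : Free k B.X} (t : a ⟶ b) :
    MEq ((counitFun B).map ((iota B).map t)) ((act B).map t) := counitEval_gen B (QGen.free t)

theorem counitFun_q (b : List B.X) :
    MEq ((counitFun B).map (q B b).hom) (𝟙 (prod B b)) := counitEval_q B b

theorem iota_counitFun : iota B ⋙ counitFun B = act B :=
  CategoryTheory.Functor.ext (fun a => counitFun_obj B a.toList) (fun a b t => by
    obtain ⟨_, _, h⟩ := counitFun_free B t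
    exact h)

theorem single_counitFun : single B ⋙ counitFun B = 𝟭 B.X :=
  (congrArg (fun F => Free.unit k B.X ⋙ F) (iota_counitFun B)).trans (unit_act B)

theorem map_counitFun : Free.map k (counitFun B) ⋙ act B = Free.ev k (QCat B) ⋙ counitFun B :=
  (congrArg (fun F => Free.map k (counitFun B) ⋙ F) (ev_eq_act B).symm).trans
    (Free.ev_nat k (counitFun_strict B))

/-- The counit `δ_B`, as a strict map of algebras. -/
def counitMap : StrictTMap (QAlg B) B where
  f := (counitFun B).toCatHom
  comm := Cat.ext (map_counitFun B)

end Counit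

/-! ### The adjoined isomorphisms as a natural transformation -/

section QNat

variable {k : Kind} (A : Algebra (monad.{u} k))

attribute [local instance] algStr

theorem MEq.comp_eqToHom_comp {X : Type*} [Category X] {a b c d a' b' c' : X} {f : a ⟶ b}
    {g : c ⟶ d} {f' : a' ⟶ b'} {g' : b' ⟶ c'} (h : b = c) (hf : MEq f f') (hg : MEq g g') :
    MEq (f ≫ CategoryTheory.eqToHom h ≫ g) (f' ≫ g') :=
  MEq.comp hf ((MEq.left h g).trans hg)

theorem StrictStr.tensor_comp_one_tensor {X : Type*} [Category X] [StrictStr k X]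
    {a b c d e : X} (f : a ⟶ b) (g : c ⟶ d) (h : d ⟶ e) :
    tensor (k := k) f (g ≫ h) = tensor (k := k) f g ≫ tensor (k := k) (𝟙 b) h := by
  rw [← tensor_comp, Category.comp_id]

/-- Associativity of the `q_⟨a⟩` for two tuples at once, obtained by multiplying out the second tuple
after the first. -/
theorem q_mul (a c : List A.X) :
    MEq (tensor (k := k) (q A a).hom (q A c).hom ≫ (q A ([prod A a] ++ [prod A c])).hom)
      (q A (a ++ c)).hom := by
  have h : tensor (k := k) (q A a).hom (q A c).hom =
      tensor (k := k) (q A a).hom (𝟙 (qtup A c)) ≫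
        tensor (k := k) (𝟙 (qtup A [prod A a])) (q A c).hom := by
    rw [← tensor_comp, Category.comp_id, Category.id_comp]
  refine (MEq.of_eq ((congrArg (fun z => z ≫ (q A ([prod A a] ++ [prod A c])).hom) h).trans
    (Category.assoc _ _ _))).trans ?_
  exact (MEq.comp (MEq.refl _) (q_right A [prod A a] c)).trans (q_left A a c)

/-- The variant of `q_mul` in which the objects `a_•` and `c_•` are only equal to given ones. -/
theorem q_tensor {a c : List A.X} {p r : A.X} {x : qtup A a ⟶ qtup A [p]}
    {y : qtup A c ⟶ qtup A [r]} (hx : MEq x (q A a).hom) (hy : MEq y (q A c).hom) :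
    MEq (tensor (k := k) x y ≫ (q A ([p] ++ [r])).hom) (q A (a ++ c)).hom := by
  obtain rfl : p = prod A a := by
    obtain ⟨_, h, _⟩ := hx
    exact List.head_eq_of_cons_eq (congrArg Presentation.Carrier.toList h)
  obtain rfl : r = prod A c := by
    obtain ⟨_, h, _⟩ := hy
    exact List.head_eq_of_cons_eq (congrArg Presentation.Carrier.toList h)
  rw [hx.eq, hy.eq]
  exact q_mul A a c

theorem counitFun_single_map {a b : A.X} (f : a ⟶ b) :
    MEq ((counitFun A).map ((single A).map f)) f :=
  MEq.of_functor_eq (single_counitFun A) f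

/-- The isomorphism `q_⟨a⟩`, with target `ζ (δ ⟨a⟩)`, which equals `(a_•)` but not definitionally. -/
def qIso (a : QCat A) : a ≅ (counitFun A ⋙ single A).obj a :=
  q A a.toList ≪≫ eqToIso (congrArg (fun b => qtup A [b]) (counitFun_obj A a.toList).symm)

theorem qIso_hom (a : QCat A) : MEq (qIso A a).hom (q A a.toList).hom :=
  MEq.right (q A a.toList).hom
    (congrArg (fun b => qtup A [b]) (counitFun_obj A a.toList).symm)

theorem qIso_free {a b : Free k A.X} (t : a ⟶ b) :
    (iota A).map t ≫ (qIso A ((iota A).obj b)).hom =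
      (qIso A ((iota A).obj a)).hom ≫
        (counitFun A ⋙ single A).map ((iota A).map t) := by
  refine MEq.eq ((MEq.comp (MEq.refl _) (qIso_hom A _)).trans ?_)
  refine (MEq.of_eq (q_nat A t)).trans ?_
  exact (MEq.comp (qIso_hom A _) ((counitFun_free A t).map (single A))).symm

theorem qIso_q (a : List A.X) :
    (q A a).hom ≫ (qIso A (qtup A [prod A a])).hom =
      (qIso A (qtup A a)).hom ≫ (counitFun A ⋙ single A).map (q A a).hom := by
  have h : MEq ((counitFun A ⋙ single A).map (q A a).hom) (𝟙 (qtup A [prod A a])) :=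
    ((counitFun_q A a).map (single A)).trans (MEq.of_eq ((single A).map_id _))
  refine MEq.eq ((MEq.comp_right_id _ ((qIso_hom A _).trans (q_norm A _))).trans ?_)
  exact ((MEq.comp_right_id _ h).trans (qIso_hom A _)).symm

/-- Naturality passes to concatenations. The functor `ζ δ` does not preserve them, and the
discrepancy is absorbed by `q_⟨δ a, δ c⟩`, which is natural in free morphisms. -/
theorem qIso_tensor {a b c d : QCat A} {f : a ⟶ b} {g : c ⟶ d}
    (hf : f ≫ (qIso A b).hom = (qIso A a).hom ≫ (counitFun A ⋙ single A).map f)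
    (hg : g ≫ (qIso A d).hom = (qIso A c).hom ≫ (counitFun A ⋙ single A).map g) :
    tensor (k := k) f g ≫ (qIso A (mul k b d)).hom =
      (qIso A (mul k a c)).hom ≫ (counitFun A ⋙ single A).map (tensor (k := k) f g) := by
  let δ := counitFun A
  let T : Free.tup k ([δ.obj a] ++ [δ.obj c]) ⟶ Free.tup k ([δ.obj b] ++ [δ.obj d]) :=
    tensor (k := k) ((Free.unit k A.X).map (δ.map f)) ((Free.unit k A.X).map (δ.map g))
  have hT : MEq (tensor (k := k) ((δ ⋙ single A).map f) ((δ ⋙ single A).map g))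
      ((iota A).map T) := ((iota_strict A).map_tensor _ _).symm
  have hq (x y : QCat A) : MEq (qIso A (mul k x y)).hom
      (tensor (k := k) (qIso A x).hom (qIso A y).hom ≫ (q A ([δ.obj x] ++ [δ.obj y])).hom) :=
    (qIso_hom A _).trans (q_tensor A (qIso_hom A x) (qIso_hom A y)).symm
  have hδ : MEq ((δ ⋙ single A).map (tensor (k := k) f g)) ((single A).map ((act A).map T)) :=
    ((counitFun_strict A).map_tensor f g).map (single A)
  refine MEq.eq ((MEq.comp (MEq.refl _) (hq b d)).trans ?_)
  refine MEq.trans ?_ (MEq.comp (hq a c) hδ).symm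
  refine (MEq.of_eq (Category.assoc _ _ _).symm).trans ?_
  refine MEq.trans ?_ (MEq.of_eq (Category.assoc _ _ _).symm)
  refine MEq.trans ?_ (MEq.comp (MEq.refl _) (MEq.of_eq (q_nat A T)))
  refine MEq.trans ?_ (MEq.of_eq (Category.assoc _ _ _))
  refine MEq.comp ?_ (MEq.refl _)
  rw [← tensor_comp, hf, hg, tensor_comp]
  exact MEq.comp (MEq.refl _) hT

/-- Naturality of the `q_⟨a⟩` in the class of a word. -/
theorem qIso_word {a b : List A.X} (w : Word k (QGen A) a b) :
    (QPres A).hom w ≫ (qIso A (qtup A b)).hom =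
      (qIso A (qtup A a)).hom ≫ (counitFun A ⋙ single A).map ((QPres A).hom w) := by
  induction w with
  | id a =>
    refine (Category.id_comp _).trans ((Category.comp_id _).symm.trans ?_)
    exact congrArg (fun z => (qIso A (qtup A a)).hom ≫ z)
      ((counitFun A ⋙ single A).map_id (qtup A a)).symm
  | comp f g hf hg =>
    refine (Category.assoc _ _ _).trans ((congrArg (fun z => (QPres A).hom f ≫ z) hg).trans ?_)
    refine (Category.assoc _ _ _).symm.trans ((congrArg (fun z => z ≫ _) hf).trans ?_)
    refine (Category.assoc _ _ _).trans (congrArg (fun z => _ ≫ z) ?_)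
    exact ((counitFun A ⋙ single A).map_comp _ _).symm
  | gen x =>
    cases x with
    | free t => exact qIso_free A t
    | q => exact qIso_q A _
    | qInv =>
      exact inv_natural (F := 𝟭 (QCat A)) (G := counitFun A ⋙ single A) (q A _)
        (qIso_q A _)
  | tensor f g hf hg => exact qIso_tensor A hf hg
  -- The braidings of `Q A` and their inverses are free morphisms.
  | braid hk a b =>
    have h := ((iota_strict A).map_braid hk (Free.tup k a) (Free.tup k b)).eq
    have h2 := qIso_free A (braid hk (Free.tup k a) (Free.tup k b))
    rw [h] at h2
    exact h2
  | braidInv hk a b =>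
    have h := ((iota_strict A).map_braidInv hk (Free.tup k a) (Free.tup k b)).eq
    have h2 := qIso_free A (braidInv hk (Free.tup k a) (Free.tup k b))
    rw [h] at h2
    exact h2

/-- The natural isomorphism `1 ≅ ζ δ` with components the `q_⟨a⟩`. -/
def qNatIso : 𝟭 (QCat A) ≅ counitFun A ⋙ single A :=
  NatIso.ofComponents (qIso A) (fun f => by
    obtain ⟨w, rfl⟩ := (QPres A).hom_surj f
    exact qIso_word A w)

/-- The evaluation in `Q A` of a tuple of 1-tuples is the inclusion of free morphisms. -/
theorem map_single_ev : Free.map k (single A) ⋙ Free.ev k (QCat A) = iota A :=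
  Free.functor_ext ((Free.map_strict k _).comp (Free.lift_strict _)) (iota_strict A)
    ((congrArg (fun F => F ⋙ Free.ev k (QCat A)) (Free.unit_map k (single A))).trans
      (congrArg (fun F => single A ⋙ F) (Free.unit_lift (𝟭 (QCat A)))))

theorem map_comp_single_ev {C : Type u} [Category.{u} C] (H : C ⥤ A.X) :
    Free.map k (H ⋙ single A) ⋙ Free.ev k (QCat A) = Free.map k H ⋙ iota A := by
  rw [Free.map_comp, Functor.assoc, map_single_ev]

/-- Associativity of the `q_⟨a⟩` for a tuple of tuples: multiplying out each entry and then the tuple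
of the products is the same as multiplying out the concatenation. The tuples are the values `F c`
of a functor, their products are the `H c`, and `θ` has the components `q`; the morphism `g` is the
`q` of the tuple of products, with a source that is only equal to that tuple. -/
theorem q_ev {C : Type u} [Category.{u} C] {F : C ⥤ QCat A} {H : C ⥤ A.X}
    (θ : F ⟶ H ⋙ single A) (hθ : ∀ c, MEq (θ.app c) (q A (F.obj c).toList).hom)
    (L : Free k C) {z : QCat A}
    {g : (Free.ev k (QCat A)).obj ((Free.map k (H ⋙ single A)).obj L) ⟶ z}
    (hg : MEq g (q A ((Free.map k H).obj L).toList).hom) :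
    MEq ((Free.ev k (QCat A)).map ((Free.map₂ k θ).app L) ≫ g)
      (q A ((Free.ev k (QCat A)).obj ((Free.map k F).obj L)).toList).hom := by
  refine (MEq.comp (MEq.refl _)
    (hg.trans (MEq.left (Functor.congr_obj (map_comp_single_ev A H) L) _).symm)).trans ?_
  clear hg g z
  have hm := (Free.map₂_mon k θ).whiskerRight (Free.lift_strict (𝟭 (QCat A)))
  obtain ⟨L⟩ := L
  induction L with
  | nil => exact MEq.comp_left_id hm.app_one _ |>.trans (MEq.left _ _)
  | cons c L ih =>
    let E := (Free.ev k (QCat A)).map ((Free.map₂ k θ).app (Free.tup k L)) ≫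
      eqToHom (Functor.congr_obj (map_comp_single_ev A H) (Free.tup k L))
    let m : List A.X := ((Free.map k H).obj (Free.tup k L)).toList
    have h1 : MEq ((Free.ev k (QCat A)).map ((Free.map₂ k θ).app (Free.tup k (c :: L))))
        (tensor (k := k) (θ.app c) E) := by
      refine (hm.app_mul (Free.tup k [c]) (Free.tup k L)).trans (tensor_congr k ?_ ?_)
      · refine ((Free.map₂_unit k θ c).map (Free.ev k (QCat A))).trans ?_
        exact MEq.of_functor_eq (Free.unit_lift (𝟭 (QCat A))) (θ.app c)
      · exact (MEq.right _ _).symm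
    have h2 : MEq (q A ((Free.map k H).obj (Free.tup k (c :: L))).toList).hom
        (tensor (k := k) (𝟙 (qtup A [H.obj c])) (q A m).hom ≫
          (q A ([H.obj c] ++ [prod A m])).hom) := (q_right A [H.obj c] m).symm
    -- By `h2`, `q` at the tuple of products may first multiply out all entries but the first, to which
    -- the inductive hypothesis applies; two tuples remain.
    refine (MEq.comp_eqToHom_comp _ h1 h2).trans ?_
    refine (MEq.of_eq (Category.assoc _ _ _).symm).trans ?_
    have h3 : tensor (k := k) (θ.app c) (E ≫ (q A m).hom) =
      tensor (k := k) (θ.app c) E ≫ tensor (k := k) (𝟙 (qtup A [H.obj c])) (q A m).hom :=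
        StrictStr.tensor_comp_one_tensor _ _ _
    have h4 : MEq (E ≫ (q A m).hom) (q A ((Free.ev k (QCat A)).obj
        ((Free.map k F).obj (Free.tup k L))).toList).hom :=
      (MEq.of_eq (Category.assoc _ _ _)).trans ih
    refine (MEq.of_eq (congrArg (fun z => z ≫ (q A ([H.obj c] ++ [prod A m])).hom)
      h3.symm)).trans ?_
    exact q_tensor A (hθ c) h4

end QNat

/-! ### The unit -/

section Unit

variable {k : Kind} (A : Algebra (monad.{u} k))

theorem cell_ext {X Y : Cat.{u, u}} {F G : X ⟶ Y} {θ θ' : F ⟶ G}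
    (h : ∀ a, MEq (θ.toNatTrans.app a) (θ'.toNatTrans.app a)) : θ = θ' :=
  Cat.Hom₂.ext (NatTrans.ext (funext fun a => (h a).eq))

theorem MEq.cat_eqToHom_app {X Y : Cat.{u, u}} {F G : X ⟶ Y} (h : F = G) (a : X) {x : Y}
    (e : F.toFunctor.obj a = x) :
    MEq ((CategoryTheory.eqToHom h).toNatTrans.app a) (𝟙 x) := by
  subst h; subst e; exact MEq.refl _

/-- A natural isomorphism, as an invertible 2-cell. -/
def catIso {X Y : Cat.{u, u}} {F G : X ⟶ Y} (e : F.toFunctor ≅ G.toFunctor) : F ≅ G where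
  hom := ⟨e.hom⟩
  inv := ⟨e.inv⟩
  hom_inv_id := Cat.Hom₂.ext e.hom_inv_id
  inv_hom_id := Cat.Hom₂.ext e.inv_hom_id

/-- The constraint of `ζ_A`, with component `q_⟨a⟩` at `⟨a⟩`. -/
def unitCon : Free.map k (single A) ⋙ Free.ev k (QCat A) ≅ act A ⋙ single A :=
  eqToIso (map_single_ev A) ≪≫ Functor.isoWhiskerLeft (iota A) (qNatIso A) ≪≫
    eqToIso (congrArg (fun F => F ⋙ single A) (iota_counitFun A))

theorem unitCon_app (a : Free k A.X) :
    MEq ((unitCon A).hom.app a) (q A a.toList).hom := by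
  refine (MEq.eqToHom_app_comp (map_single_ev A) a _).trans ?_
  refine (MEq.comp_eqToHom_app (congrArg (fun F => F ⋙ single A) (iota_counitFun A)) a _).trans ?_
  exact qIso_hom A _

/-- The multiplication axiom for the constraint of `ζ_A`. -/
theorem unitCon_mult (L : Free k (Free k A.X)) :
    MEq ((unitCon A).hom.app ((Free.mult k A.X).obj L))
      ((Free.ev k (QCat A)).map ((Free.map₂ k (unitCon A).hom).app L) ≫
        eqToHom (congrArg (Free.ev k (QCat A)).obj
          (Functor.congr_obj (Free.map_comp k (act A) (single A)) L)) ≫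
        (unitCon A).hom.app ((Free.map k (act A)).obj L)) := by
  have e (a : Free k A.X) : (Free.map k (single A) ⋙ Free.ev k (QCat A)).obj a =
    (iota A).obj a := Functor.congr_obj (map_single_ev A) a
  have e' : (Free.ev k (QCat A)).obj ((Free.map k (Free.map k (single A) ⋙
      Free.ev k (QCat A))).obj L) = (iota A).obj ((Free.mult k A.X).obj L) := by
    rw [map_single_ev]
    exact Functor.congr_obj (Free.ev_nat k (X := Free k A.X) (Y := QCat A) (iota_strict A)) L
  refine (unitCon_app A _).trans (MEq.trans ?_ (q_ev A (unitCon A).hom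
    (fun a => (unitCon_app A a).trans
      (q_congr A (congrArg Presentation.Carrier.toList (e a).symm))) L
    ((MEq.left _ _).trans (unitCon_app A _))).symm)
  exact q_congr A (congrArg Presentation.Carrier.toList e'.symm)

/-- The unit `ζ_A`: the inclusion of 1-tuples, with the `q_⟨a⟩` as its algebra constraint. -/
def unitMap : TMap A (QAlg A) where
  f := (single A).toCatHom
  con := catIso (unitCon A)
  unit := cell_ext fun a => by
    refine MEq.trans ?_ (MEq.cat_eqToHom_app _ _ rfl).symm
    refine (unitCon_app A _).trans ((q_norm A a).trans ?_)
    exact MEq.eqToHom rfl rfl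
      (Functor.congr_obj (map_single_ev A) ((Free.unit k A.X).obj a)).symm
  mult := cell_ext fun L => by
    simp only [Cat.Hom₂.eqToHom_toNatTrans, Cat.Hom.toNatTrans_comp]
    refine MEq.trans ?_ (MEq.app_conj _ _ _ _ _ _).symm
    exact unitCon_mult A L

theorem con_unitMap (a : Free k A.X) :
    MEq (X := QCat A) ((con (unitMap A)).hom.app a) (q A a.toList).hom := unitCon_app A a

end Unit

/-! ### The 2-adjunction -/

section Adjunction

variable {k : Kind} {A B : Algebra (monad.{u} k)}

/-- T-maps with equal functors and equal components of constraints are equal. -/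
theorem tmap_ext {f g : TMap A B} (h : fn f = fn g)
    (h' : ∀ a, MEq ((con f).hom.app a) ((con g).hom.app a)) : f = g := by
  refine TMap.ext' (Cat.ext h) (cell_ext fun a => ?_)
  simp only [Cat.Hom₂.eqToHom_toNatTrans, Cat.Hom.toNatTrans_comp]
  refine (h' a).trans ?_
  exact ((MEq.eqToHom_app_comp _ _ _).trans (MEq.comp_eqToHom_app _ _ _)).symm

theorem tmap_cell_ext {f g f' g' : A ⟶ B} (θ : f ⟶ g) (θ' : f' ⟶ g') (h : f = f')
    (h' : g' = g) (w : ∀ a, MEq ((cellNat θ).app a) ((cellNat θ').app a)) :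
    θ = eqToHom h ≫ θ' ≫ eqToHom h' := by
  subst h; subst h'
  rw [eqToHom_refl, eqToHom_refl, Category.comp_id, Category.id_comp]
  exact TMap.hom_ext (cell_ext w)

theorem con_toTMap (f : StrictTMap A B) (a : Free k A.X) {x : B.X}
    (e : (Free.map k (fn f.toTMap) ⋙ act B).obj a = x) :
    MEq ((con f.toTMap).hom.app a) (𝟙 x) := MEq.cat_eqToHom_app f.comm a e

theorem con_comp_strict {C : Algebra (monad.{u} k)} (f : TMap A B) (g : StrictTMap B C)
    (a : Free k A.X) :
    MEq ((con (f.comp g.toTMap)).hom.app a) ((fn g.toTMap).map ((con f).hom.app a)) :=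
  (con_comp f g.toTMap a).trans (MEq.comp_left_id (con_toTMap g _ rfl) _)

theorem single_QFun (f : TMap A B) : single A ⋙ QFun f = fn f ⋙ single B :=
  CategoryTheory.Functor.ext (fun _ => rfl) fun _ _ s => by
    obtain ⟨_, _, h⟩ := QFun_single f s
    exact h

/-- Both constraints have the component `(f_•) ∘ q_⟨f a⟩`, which is the value of `Q f` at
`q_⟨a⟩`. -/
theorem unitMap_nat (f : TMap A B) :
    f.comp (unitMap B) = (unitMap A).comp (strictOf (QFun_strict f)).toTMap := by
  refine tmap_ext (single_QFun f).symm fun a => ?_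
  refine (con_comp f (unitMap B) a).trans
    (MEq.trans ?_ (con_comp_strict (unitMap A) (strictOf (QFun_strict f)) a).symm)
  refine (MEq.comp (con_unitMap B _) (MEq.refl _)).trans ?_
  refine MEq.trans ?_ ((con_unitMap A a).map (QFun f)).symm
  exact (QFun_q f a.toList).symm

theorem unitMap_nat₂ {f g : TMap A B} (α : f ⟶ g) (a : A.X) :
    MEq ((single B).map ((cellNat α).app a)) ((QTrans α).app ((single A).obj a)) :=
  (QTrans_single α a).symm

theorem unitMap_counitMap : (unitMap A).comp (counitMap A).toTMap = TMap.id A := by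
  refine tmap_ext (single_counitFun A) fun a => ?_
  refine (con_comp_strict (unitMap A) (counitMap A) a).trans ?_
  refine ((con_unitMap A a).map (counitFun A)).trans ((counitFun_q A _).trans ?_)
  exact (MEq.cat_eqToHom_app (TMap.id_aux A) a
    (congrArg (act A).obj (Functor.congr_obj (Free.map_id k) a))).symm

section

attribute [local instance] algStr

theorem fn_strict (f : StrictTMap A B) : IsStrictFun k (fn f.toTMap) :=
  IsStrictFun.of_act A (congrArg Cat.Hom.toFunctor f.comm)

theorem QFun_counitFun (f : StrictTMap A B) :
    QFun f.toTMap ⋙ counitFun B = counitFun A ⋙ fn f.toTMap := by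
  have e : Free.map k (fn f.toTMap) ⋙ act B = act A ⋙ fn f.toTMap :=
    congrArg Cat.Hom.toFunctor f.comm
  refine QFun_ext ((QFun_strict _).comp (counitFun_strict B))
    ((counitFun_strict A).comp (fn_strict f)) (fun a => ?_) (fun t => ?_) (fun a => ?_)
  · refine (counitFun_obj B [(fn f.toTMap).obj a]).trans ((prod_single B _).trans ?_)
    exact congrArg (fn f.toTMap).obj ((counitFun_obj A [a]).trans (prod_single A a)).symm
  · refine ((QFun_free f.toTMap t).map (counitFun B)).trans ((counitFun_free B _).trans ?_)
    refine (MEq.of_functor_eq e t).trans ?_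
    exact ((counitFun_free A t).map (fn f.toTMap)).symm
  · refine ((QFun_q f.toTMap a).map (counitFun B)).trans ?_
    refine MEq.trans ?_ ((counitFun_q A a).map (fn f.toTMap)).symm
    refine (MEq.of_eq ((counitFun B).map_comp _ _)).trans ?_
    refine (MEq.comp_left_id (counitFun_q B _) _).trans ?_
    refine (counitFun_single_map B _).trans ((con_toTMap f _ (Functor.congr_obj e _)).trans ?_)
    exact MEq.of_eq ((fn f.toTMap).map_id _).symm

/-- An algebra 2-cell between strict maps is a monoidal transformation. -/
theorem cellNat_mon {f g : StrictTMap A B} (α : f ⟶ g) :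
    IsMonTrans k (cellNat α.toCell) := by
  refine IsMonTrans.of_act A fun l => ?_
  have h := cell_comm α.toCell l
  refine MEq.trans ?_ ((MEq.of_eq h.symm).trans (MEq.comp_left_id (con_toTMap f l rfl) _))
  exact (MEq.comp_right_id _ (con_toTMap g l rfl)).symm

theorem counitMap_nat₂ {f g : StrictTMap A B} (α : f ⟶ g) (l : QCat A) :
    MEq ((counitFun B).map ((QTrans α.toCell).app l))
      ((cellNat α.toCell).app ((counitFun A).obj l)) := by
  refine Presentation.trans_ext (P := QPres A)
    ((QTrans_mon α.toCell).whiskerRight (counitFun_strict B))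
    ((cellNat_mon α).whiskerLeft (counitFun_strict A)) (fun a => ?_) l
  refine ((QTrans_single α.toCell a).map (counitFun B)).trans ?_
  refine (counitFun_single_map B _).trans ?_
  exact MEq.app (cellNat α.toCell) ((counitFun_obj A [a]).trans (prod_single A a)).symm

end

theorem QFun_unitMap_counitFun :
    QFun (unitMap A) ⋙ counitFun (QAlg A) = 𝟭 (QCat A) := by
  -- The category `Q A` carries its own structure and the one recovered from the algebra `Q A`. The
  -- counit is strict for the latter, and is compared with the identity in the former.
  have h := @IsStrictFun.comp k (QCat A) (QCat (QAlg A)) (QAlg A).X _ _ _ _ _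
    (algStr (QAlg A)) _ _ (QFun_strict (unitMap A)) (counitFun_strict (QAlg A))
  let F : QCat A ⥤ QCat A := QFun (unitMap A) ⋙ counitFun (QAlg A)
  have hs : IsStrictFun k F :=
    @IsStrictFun.comp k (QCat A) (QAlg A).X (QCat A) _ _ _ _ (algStr (QAlg A)) _
      _ _ h (algebraOf_id_strict (k := k) (QCat A))
  refine QFun_ext (F := F) hs IsStrictFun.id (fun a => ?_) (fun t => ?_) (fun a => ?_)
  · exact Functor.congr_obj (single_counitFun (QAlg A)) (qtup A [a])
  · refine ((QFun_free (unitMap A) t).map (counitFun (QAlg A))).trans ?_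
    refine (counitFun_free (QAlg A) _).trans ?_
    exact MEq.of_functor_eq (map_single_ev A) t
  · refine ((QFun_q (unitMap A) a).map (counitFun (QAlg A))).trans ?_
    refine (MEq.of_eq ((counitFun (QAlg A)).map_comp _ _)).trans ?_
    refine (MEq.comp_left_id (counitFun_q (QAlg A) _) _).trans ?_
    exact (counitFun_single_map (QAlg A) _).trans (con_unitMap A (Free.tup k a))

theorem counitMap_nat (f : StrictTMap A B) :
    (strictOf (QFun_strict f.toTMap)).comp (counitMap B) = (counitMap A).comp f :=
  StrictTMap.ext (Cat.ext (QFun_counitFun f))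

theorem counitMap_whisker {f g : StrictTMap A B} (α : f ⟶ g) :
    StrictAlgebra.whiskerR (QCell α.toCell) (counitMap B) =
      eqToHom (counitMap_nat f) ≫ StrictAlgebra.whiskerL (counitMap A) α ≫
        eqToHom (counitMap_nat g).symm := by
  refine strict_hom_ext (A := ⟨QAlg A⟩) (B := ⟨B⟩) _ _ (counitMap_nat f) (counitMap_nat g).symm
    (congrArg StrictTMap.f (counitMap_nat f)) (congrArg StrictTMap.f (counitMap_nat g).symm)
    fun l => ?_
  refine (MEq.of_eq (congrArg (fun z => z.toNatTrans.app l)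
    (StrictAlgebra.whiskerR_cell (QCell α.toCell) (counitMap B)))).trans ?_
  refine MEq.trans ?_ (MEq.of_eq (congrArg (fun z => z.toNatTrans.app l)
    (StrictAlgebra.whiskerL_cell (counitMap A) α))).symm
  exact counitMap_nat₂ α l

variable (k) in
/-- The 2-adjunction between `Q` and the inclusion. -/
def adjunction : TwoAdjunction (Q.{u} k) (StrictAlgebra.incl (monad.{u} k)) where
  unit := unitMap
  unit_nat f := unitMap_nat f
  unit_nat₂ α := tmap_cell_ext _ _ _ _ (unitMap_nat₂ α)
  counit B := counitMap B.alg
  counit_nat f := counitMap_nat f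
  counit_nat₂ α := counitMap_whisker α
  right_triangle _ := unitMap_counitMap
  left_triangle _ := StrictTMap.ext (Cat.ext QFun_unitMap_counitFun)

/-- An inverse of the 2-cell underlying an algebra 2-cell is compatible with the constraints. -/
theorem cell_comm_inv {f g : TMap A B} (α : f ⟶ g) (β : g.f ⟶ f.f) (h : α.cell ≫ β = 𝟙 _)
    (h' : β ≫ α.cell = 𝟙 _) : g.con.hom ≫ A.x ◁ β = (monad k).T.map₂ β ▷ B.x ≫ f.con.hom := by
  have e1 : A.x ◁ α.cell ≫ A.x ◁ β = 𝟙 _ := by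
    rw [← whiskerLeft_comp, h, whiskerLeft_id]
  have e2 : (monad k).T.map₂ β ▷ B.x ≫ (monad k).T.map₂ α.cell ▷ B.x = 𝟙 _ := by
    rw [← comp_whiskerRight, ← PrelaxFunctor.map₂_comp, h', PrelaxFunctor.map₂_id, id_whiskerRight]
  have e3 := α.comm
  calc g.con.hom ≫ A.x ◁ β
      = (monad k).T.map₂ β ▷ B.x ≫ ((monad k).T.map₂ α.cell ▷ B.x ≫ g.con.hom) ≫ A.x ◁ β := by
        simp only [Category.assoc, reassoc_of% e2]
    _ = (monad k).T.map₂ β ▷ B.x ≫ f.con.hom := by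
        rw [← e3]; simp only [Category.assoc, e1, Category.comp_id]

end Adjunction

/-! ### The adjoint surjective equivalence -/

section Efficacy

variable {k : Kind} (B : Algebra (monad.{u} k))

theorem qNatIso_hom_app (b : QCat B) : MEq ((qNatIso B).hom.app b) (q B b.toList).hom :=
  qIso_hom B b

/-- The algebra 2-cell `1 ⟶ ζ δ` with components the `q_⟨b⟩`. -/
def qCell : 𝟙 (QAlg B) ⟶ (counitMap B).toTMap ≫ unitMap B :=
  TMap.Cell.mk (f := 𝟙 (QAlg B)) (g := (counitMap B).toTMap ≫ unitMap B) ⟨(qNatIso B).hom⟩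
    (cell_ext fun L => by
      have h2 : MEq (X := QCat B) ((con ((counitMap B).toTMap.comp (unitMap B))).hom.app L)
          (q B ((Free.map k (counitFun B)).obj L).toList).hom := by
        have h := (con_toTMap (counitMap B) L rfl).map (single B)
        rw [CategoryTheory.Functor.map_id] at h
        exact (con_comp _ _ L).trans ((MEq.comp_right_id (X := QCat B) _ h).trans
          (con_unitMap B _))
      have h3 : MEq (X := QCat B) ((con (TMap.id (QAlg B))).hom.app L)
        (𝟙 ((Free.ev k (QCat B)).obj L)) := MEq.cat_eqToHom_app (TMap.id_aux (QAlg B)) L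
          (congrArg (Free.ev k (QCat B)).obj (Functor.congr_obj (Free.map_id k) L))
      refine (MEq.comp_left_id (X := QCat B) h3 _).trans ?_
      refine (qNatIso_hom_app B _).trans (MEq.trans ?_
        (q_ev B (qNatIso B).hom (qNatIso_hom_app B) L h2).symm)
      refine q_congr B ?_
      exact congrArg (fun F => ((Free.ev k (QCat B)).obj (Functor.obj F L)).toList)
        (Free.map_id k).symm)

/-- The isomorphism `Θ : ζ δ ≅ 1`, with components the inverses of the `q_⟨b⟩`. -/
def efficacy : (counitMap B).toTMap ≫ unitMap B ≅ 𝟙 (QAlg B) where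
  hom := TMap.Cell.mk (f := (counitMap B).toTMap ≫ unitMap B) (g := 𝟙 (QAlg B))
    ⟨(qNatIso B).inv⟩ (cell_comm_inv (qCell B) _ (Cat.Hom₂.ext (qNatIso B).hom_inv_id)
      (Cat.Hom₂.ext (qNatIso B).inv_hom_id))
  inv := qCell B
  hom_inv_id := TMap.hom_ext (Cat.Hom₂.ext (qNatIso B).inv_hom_id)
  inv_hom_id := TMap.hom_ext (Cat.Hom₂.ext (qNatIso B).hom_inv_id)

theorem efficacy_app (b : List B.X) :
    MEq (X := QCat B) ((cellNat (efficacy B).hom).app (qtup B b)) (q B b).inv :=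
  meq_inv (f := (qNatIso B).app (qtup B b)) (g := q B b) (qNatIso_hom_app B (qtup B b))

theorem efficacy_single (b : B.X) :
    MEq (X := QCat B) ((cellNat (efficacy B).hom).app (qtup B [b])) (𝟙 (qtup B [b])) :=
  (efficacy_app B [b]).trans
    (meq_inv (f := q B [b]) (g := Iso.refl (qtup B [b])) (q_norm B b))

theorem efficacy_isAdjointSurjectiveEquivalence :
    IsAdjointSurjectiveEquivalence (unitMap B) (counitMap B).toTMap (efficacy B) := by
  refine ⟨unitMap_counitMap, TMap.hom_ext (cell_ext fun b => ?_)⟩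
  rw [TMap.veqToHom_cell]
  refine MEq.trans ?_ (MEq.cat_eqToHom_app _ b
    (congrArg (single B).obj (Functor.congr_obj (single_counitFun B) b))).symm
  exact efficacy_single B b

end Efficacy

end PsMor

theorem mainTheorem9 (k : PsMor.Kind) :
    ∃ adj : PsMor.TwoAdjunction (PsMor.Q.{u} k) (PsMor.StrictAlgebra.incl (PsMor.monad.{u} k)),
      PsMor.IsEffective adj ∧
      (∀ A : PsMor.Algebra (PsMor.monad.{u} k), PsMor.IsExplicitUnit A (adj.unit A)) ∧
      (∀ B : PsMor.StrictAlgebra (PsMor.monad.{u} k),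
        PsMor.IsExplicitCounit B.alg (adj.counit B)) ∧
      (∀ B : PsMor.StrictAlgebra (PsMor.monad.{u} k),
        ∃ Θ : (PsMor.StrictAlgebra.incl (PsMor.monad.{u} k)).map (adj.counit B) ≫
            adj.unit ((PsMor.StrictAlgebra.incl (PsMor.monad.{u} k)).obj B) ≅ 𝟙 _,
          PsMor.IsAdjointSurjectiveEquivalence
            (adj.unit ((PsMor.StrictAlgebra.incl (PsMor.monad.{u} k)).obj B))
            ((PsMor.StrictAlgebra.incl (PsMor.monad.{u} k)).map (adj.counit B)) Θ ∧
          PsMor.IsExplicitEfficacy B.alg Θ.hom) := by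
  refine ⟨PsMor.adjunction k, fun B => ⟨PsMor.efficacy B.alg, ?_⟩, fun A => ⟨rfl, fun a => ?_⟩,
    fun B => ⟨PsMor.iota_counitFun B.alg, PsMor.counitFun_q B.alg⟩,
    fun B => ⟨PsMor.efficacy B.alg, ?_, PsMor.efficacy_app B.alg⟩⟩
  · exact PsMor.efficacy_isAdjointSurjectiveEquivalence B.alg
  · exact PsMor.con_unitMap A (PsMor.Free.tup k a)
  · exact PsMor.efficacy_isAdjointSurjectiveEquivalence B.alg
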